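/- Let $k$ be an algebraically closed field of characteristic $0$, $G$ a finite group, and let $(g_1,\dots,g_\theta,\chi_1,\dots,\chi_\theta)$ be a datum for a quantum linear space: $g_i\in G$ is central, $\chi_i:G\to k^\times$ is a character, and with $q_{ij}=\chi_j(g_i)$, $q_i=q_{ii}$ one has $q_{ij}q_{ji}=1$ for $i\neq j$ and $N_i=\operatorname{ord}(q_i)>1$. Let $\Gamma\subseteq G$ be the subgroup generated by the $g_i$, and let $V$ be the Yetter–Drinfeld module over $G$ with basis $x_1,\dots,x_\theta$, $\delta(x_i)=g_i\otimes x_i$, $h\cdot x_i=\chi_i(h)x_i$. Its Nichols algebra $\mathfrak B(V)$ is generated by the $x_i$ with relations $x_i^{N_i}=0$ and $x_ix_j=q_{ij}x_jx_i$ ($i\ne j$), and is a braided Hopf algebra with the $x_i$ primitive. Let $\mathcal D=\{a_{ij}\}_{i\neq j}\cup\{\xi_i\}$ be a family of scalars which is compatible with $V$ (that is, $a_{ij}=0$ if $g_ig_j\ne1$, and $\xi_i=0$ if $g_i^{N_i}\neq 1$) and $\Gamma$-invariant; here $\mathcal D$ is called $F$-invariant, for a subset $F\subseteq G$, if $\chi_i(g)\chi_j(g)a_{ij}=a_{ij}$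 for $i\ne j$ and $\chi_i(g)^{N_i}\xi_i=\xi_i$ for all $g\in F$. Put $$J_{\mathcal D}=\prod_{i}\Bigl(1\otimes1+\sum_{n=1}^{N_i-1}\frac{\xi_i}{(N_i-n)!_{q_i}\,(n)!_{q_i}}\,x_i^{N_i-n}\otimes x_i^n\Bigr)\prod_{i\neq j}\exp_{q_{ij}}(a_{ij}\,x_i\otimes x_j)$$ in the braided tensor square of $\mathfrak B(V)$, where $\exp_{q_{ij}}(x)=\sum_{n=0}^{N_i-1}x^n/(n)!_{q_{ij}}$. Consider $\mathfrak B(V)\otimes kG$ with product $(v\otimes g)(v'\otimes g')=v\,(g\cdot v')\otimes gg'$ and coproduct $v\otimes g\mapsto v_{(1)}\otimes g\otimes v_{(2)}\otimes g$, which is a braided Hopf algebra over $\Gamma$ (coaction and action of $\Gamma$ on the factor $\mathfrak B(V)$), and let $(\mathfrak B(V)\otimes kG)^{J_{\mathcal D}}$ be the same algebra with coproduct $\Delta^{J}(h)=J^{-1}\Delta(h)J$, where $J=J_{\mathcal D}^1\otimes 1\otimes J_{\mathcal D}^2\otimes 1$. Let $A(V,G,\mathcal D)$ be the quotient of the bosonization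 $(\mathfrak B(V)\otimes kG)^{J_{\mathcal D}}\#k\Gamma$ by the two-sided ideal generated by the elements $(1\otimes h)\#1-(1\otimes1)\#h$, $h\in\Gamma$, with the induced structure. Let $\widehat{\mathcal D}$ be the family of scalars $b_{ij}=q_{ij}a_{ji}-a_{ij}$ ($i\ne j$) and $\xi_i$; call $\mathcal D$ q-symmetric if $a_{ij}=-q_{ij}a_{ji}$ for all $i\neq j$. Then $A(V,G,\mathcal D)$ is a (well-defined) Hopf algebra, and it is pointed if and only if $\widehat{\mathcal D}$ is $G$-invariant. If moreover $\mathcal D$ is q-symmetric, then $A(V,G,\mathcal D)$ is pointed if and only if $\mathcal D$ is $G$-invariant, and $\mathcal D$ is $G$-invariant if and only if $A(V,G,\mathcal D)\cong\mathfrak B(V)\#kG$ as Hopf algebras. -/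

import Mathlib

open scoped TensorProduct

noncomputable section

/-! ### Subcoalgebras, pointed coalgebras, Hopf algebras -/

section Coalg

variable (k C : Type*) [Field k] [AddCommGroup C] [Module k C] [CoalgebraStruct k C]

/-- `D` is a subcoalgebra of `C`: `Δ(D) ⊆ D ⊗ D`. -/
def IsSubcoalgebra (D : Submodule k C) : Prop :=
  ∀ x ∈ D, CoalgebraStruct.comul (R := k) x ∈
    LinearMap.range (TensorProduct.map D.subtype D.subtype)

/-- `D` is a simple subcoalgebra: it is nonzero and has no proper nonzero subcoalgebra. -/
def IsSimpleSubcoalgebra (D : Submodule k C) : Prop :=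
  IsSubcoalgebra k C D ∧ D ≠ ⊥ ∧
    ∀ E : Submodule k C, IsSubcoalgebra k C E → E ≤ D → E = ⊥ ∨ E = D

/-- A coalgebra is pointed if every simple subcoalgebra is one-dimensional. -/
def IsPointed : Prop :=
  ∀ D : Submodule k C, IsSimpleSubcoalgebra k C D → Module.finrank k D = 1

end Coalg

/-- The algebra and coalgebra structures on `A` form a Hopf algebra: comultiplication and counit
are multiplicative and unital, and there is an antipode. -/
structure IsHopfAlgebra (k A : Type*) [Field k] [Ring A] [Algebra k A] [Coalgebra k A] :
    Prop where
  counit_one : Coalgebra.counit (R := k) (1 : A) = 1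
  counit_mul (x y : A) : Coalgebra.counit (R := k) (x * y) =
    Coalgebra.counit (R := k) x * Coalgebra.counit (R := k) y
  comul_one : Coalgebra.comul (R := k) (1 : A) = 1
  comul_mul (x y : A) : Coalgebra.comul (R := k) (x * y) =
    Coalgebra.comul (R := k) x * Coalgebra.comul (R := k) y
  exists_antipode : ∃ S : A →ₗ[k] A,
    LinearMap.mul' k A ∘ₗ S.rTensor A ∘ₗ Coalgebra.comul =
      Algebra.linearMap k A ∘ₗ Coalgebra.counit ∧
    LinearMap.mul' k A ∘ₗ S.lTensor A ∘ₗ Coalgebra.comul =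
      Algebra.linearMap k A ∘ₗ Coalgebra.counit

/-! ### Algebras in Yetter-Drinfeld categories over a group algebra -/

section YD

set_option linter.unusedSectionVars false

variable (k K R : Type*) [Field k] [Group K] [Ring R] [Algebra k R] [MulSemiringAction K R]
  [SMulCommClass K k R]

/-- An algebra in the category of left Yetter-Drinfeld modules over the group `K`: `K` acts by
algebra automorphisms, and there is a left coaction `δ : R → k[K] ⊗ R` which is an algebra
map. A left `k[K]`-comodule is the same as a space spanned by homogeneous elements, that is
elements `r` with `δ(r) = g ⊗ r` for some `g`. -/
class YDAlgebra where
  coaction : R →ₐ[k] MonoidAlgebra k K ⊗[k] R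
  span_homogeneous :
    Submodule.span k {r : R | ∃ g : K, coaction r = MonoidAlgebra.of k K g ⊗ₜ[k] r} = ⊤
  coaction_smul (h : K) (r : R) : coaction (h • r) =
    TensorProduct.map (MonoidAlgebra.mapDomainAlgHom k k (MulAut.conj h).toMonoidHom).toLinearMap
      (DistribSMul.toLinearMap k R h) (coaction r)

variable [YDAlgebra k K R]

/-- The action of the group algebra `k[K]` on `R`. -/
def groupAlgebraAction : MonoidAlgebra k K ⊗[k] R →ₗ[k] R :=
  TensorProduct.lift (MonoidAlgebra.lift k (Module.End k R) K
    { toFun := fun h => DistribSMul.toLinearMap k R h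
      map_one' := by ext; simp
      map_mul' := fun g h => by ext; simp [mul_smul] }).toLinearMap

@[simp] lemma groupAlgebraAction_of_tmul (g : K) (r : R) :
    groupAlgebraAction k K R (MonoidAlgebra.of k K g ⊗ₜ[k] r) = g • r := by
  simp [groupAlgebraAction]

/-- The braiding `b ⊗ c ↦ b₍₋₁₎ • c ⊗ b₍₀₎` of the Yetter-Drinfeld category. -/
def ydBraiding : R ⊗[k] R →ₗ[k] R ⊗[k] R :=
  (groupAlgebraAction k K R).rTensor R ∘ₗ
  (TensorProduct.assoc k (MonoidAlgebra k K) R R).symm.toLinearMap ∘ₗ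
  (TensorProduct.comm k R R).toLinearMap.lTensor (MonoidAlgebra k K) ∘ₗ
  (TensorProduct.assoc k (MonoidAlgebra k K) R R).toLinearMap ∘ₗ
  (YDAlgebra.coaction : R →ₐ[k] MonoidAlgebra k K ⊗[k] R).toLinearMap.rTensor R

/-- The underlying space `R ⊗ R` of the braided tensor square of `R`. -/
@[nolint unusedArguments]
def BraidedTensor (k _K R : Type*) [Field k] [Ring R] [Algebra k R] : Type _ := R ⊗[k] R

instance (k K R : Type*) [Field k] [Ring R] [Algebra k R] : AddCommGroup (BraidedTensor k K R) :=
  inferInstanceAs (AddCommGroup (R ⊗[k] R))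

instance (k K R : Type*) [Field k] [Ring R] [Algebra k R] : Module k (BraidedTensor k K R) :=
  inferInstanceAs (Module k (R ⊗[k] R))

/-- The identification of `R ⊗ R` with the braided tensor square. -/
def BraidedTensor.equiv (k K R : Type*) [Field k] [Ring R] [Algebra k R] :
    R ⊗[k] R ≃ₗ[k] BraidedTensor k K R := LinearEquiv.refl k _


/-- The multiplication `(a ⊗ b)(c ⊗ d) = a (b₍₋₁₎ • c) ⊗ b₍₀₎ d` of the braided tensor square. -/
def BraidedTensor.mulMap :
    (R ⊗[k] R) ⊗[k] (R ⊗[k] R) →ₗ[k] R ⊗[k] R :=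
  TensorProduct.map (LinearMap.mul' k R) (LinearMap.mul' k R) ∘ₗ
  (TensorProduct.tensorTensorTensorAssoc k R R R R).symm.toLinearMap ∘ₗ
  ((ydBraiding k K R).lTensor R).rTensor R ∘ₗ
  (TensorProduct.tensorTensorTensorAssoc k R R R R).toLinearMap

/-- `r` is homogeneous of degree `g`. -/
def IsHomogeneousYD (g : K) (r : R) : Prop :=
  YDAlgebra.coaction (k := k) (K := K) r = MonoidAlgebra.of k K g ⊗ₜ[k] r

variable {k K R}

lemma BraidedTensor.mulMap_tmul {g : K} {b : R} (hb : IsHomogeneousYD k K R g b) (a c d : R) :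
    BraidedTensor.mulMap k K R ((a ⊗ₜ b) ⊗ₜ (c ⊗ₜ d)) = (a * (g • c)) ⊗ₜ[k] (b * d) := by
  unfold IsHomogeneousYD at hb
  simp [BraidedTensor.mulMap, ydBraiding, hb, groupAlgebraAction]

lemma IsHomogeneousYD.mul {g h : K} {b d : R} (hb : IsHomogeneousYD k K R g b)
    (hd : IsHomogeneousYD k K R h d) : IsHomogeneousYD k K R (g * h) (b * d) := by
  unfold IsHomogeneousYD at *
  rw [map_mul, hb, hd, Algebra.TensorProduct.tmul_mul_tmul, map_mul]

lemma IsHomogeneousYD.one : IsHomogeneousYD k K R 1 (1 : R) := by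
  rw [IsHomogeneousYD, map_one, map_one, Algebra.TensorProduct.one_def]

lemma BraidedTensor.induction {p : R ⊗[k] R → Prop}
    (h : ∀ (g : K) (a b : R), IsHomogeneousYD k K R g b → p (a ⊗ₜ b)) (h0 : p 0)
    (hadd : ∀ x y, p x → p y → p (x + y)) (x : R ⊗[k] R) : p x := by
  induction x with
  | zero => exact h0
  | add x y hx hy => exact hadd x y hx hy
  | tmul a b =>
    have hb : b ∈ Submodule.span k {r : R | ∃ g : K, IsHomogeneousYD k K R g r} := by
      have := YDAlgebra.span_homogeneous (k := k) (K := K) (R := R)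
      unfold IsHomogeneousYD
      rw [this]; trivial
    induction hb using Submodule.span_induction generalizing a with
    | mem b hb => obtain ⟨g, hg⟩ := hb; exact h g a b hg
    | zero => simpa using h0
    | add x y _ _ hx hy => rw [TensorProduct.tmul_add]; exact hadd _ _ (hx a) (hy a)
    | smul c x _ hx => rw [← TensorProduct.smul_tmul]; exact hx _

lemma BraidedTensor.mulMap_assoc (x y z : R ⊗[k] R) :
    BraidedTensor.mulMap k K R (BraidedTensor.mulMap k K R (x ⊗ₜ y) ⊗ₜ z) =
      BraidedTensor.mulMap k K R (x ⊗ₜ BraidedTensor.mulMap k K R (y ⊗ₜ z)) := by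
  refine BraidedTensor.induction (k := k) (K := K) (R := R)
    (p := fun x => mulMap k K R (mulMap k K R (x ⊗ₜ y) ⊗ₜ z) =
      mulMap k K R (x ⊗ₜ mulMap k K R (y ⊗ₜ z))) ?_ ?_ ?_ x
  · intro g a b hb
    refine BraidedTensor.induction (k := k) (K := K) (R := R)
      (p := fun y => mulMap k K R (mulMap k K R ((a ⊗ₜ b) ⊗ₜ y) ⊗ₜ z) =
        mulMap k K R ((a ⊗ₜ b) ⊗ₜ mulMap k K R (y ⊗ₜ z))) ?_ ?_ ?_ y
    · intro h c d hd
      induction z with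
      | zero => simp
      | add x x' hx hx' => simp only [TensorProduct.tmul_add, map_add, hx, hx']
      | tmul e f =>
        rw [mulMap_tmul hb, mulMap_tmul hd, mulMap_tmul hb, mulMap_tmul (hb.mul hd)]
        simp [mul_assoc, mul_smul]
    · simp
    · intro x x' hx hx'
      simp only [TensorProduct.add_tmul, TensorProduct.tmul_add, map_add, hx, hx']
  · simp
  · intro x x' hx hx'
    simp only [TensorProduct.add_tmul, map_add, hx, hx']

instance : Mul (BraidedTensor k K R) :=
  ⟨fun x y => BraidedTensor.equiv k K R (BraidedTensor.mulMap k K R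
    ((BraidedTensor.equiv k K R).symm x ⊗ₜ (BraidedTensor.equiv k K R).symm y))⟩

instance : One (BraidedTensor k K R) := ⟨BraidedTensor.equiv k K R (1 ⊗ₜ 1)⟩

lemma BraidedTensor.mul_def (x y : BraidedTensor k K R) :
    x * y = BraidedTensor.equiv k K R (BraidedTensor.mulMap k K R
      ((BraidedTensor.equiv k K R).symm x ⊗ₜ (BraidedTensor.equiv k K R).symm y)) := rfl

lemma BraidedTensor.one_def :
    (1 : BraidedTensor k K R) = BraidedTensor.equiv k K R (1 ⊗ₜ 1) := rfl

lemma BraidedTensor.equiv_mul_equiv {g : K} {b : R} (hb : IsHomogeneousYD k K R g b)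
    (a c d : R) :
    BraidedTensor.equiv k K R (a ⊗ₜ b) * BraidedTensor.equiv k K R (c ⊗ₜ d) =
      BraidedTensor.equiv k K R ((a * (g • c)) ⊗ₜ (b * d)) := by
  rw [BraidedTensor.mul_def]
  simp [BraidedTensor.mulMap_tmul hb]

instance : Ring (BraidedTensor k K R) where
  __ := (inferInstance : AddCommGroup (BraidedTensor k K R))
  left_distrib x y z := by simp [BraidedTensor.mul_def, TensorProduct.tmul_add]
  right_distrib x y z := by simp [BraidedTensor.mul_def, TensorProduct.add_tmul]
  zero_mul x := by simp [BraidedTensor.mul_def]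
  mul_zero x := by simp [BraidedTensor.mul_def]
  mul_assoc x y z := by simp [BraidedTensor.mul_def, BraidedTensor.mulMap_assoc]
  one_mul x := by
    obtain ⟨x, rfl⟩ := (BraidedTensor.equiv k K R).surjective x
    rw [BraidedTensor.one_def, BraidedTensor.mul_def]
    congr 1
    simp only [LinearEquiv.symm_apply_apply]
    induction x with
    | zero => simp
    | add x y hx hy => rw [TensorProduct.tmul_add, map_add, hx, hy]
    | tmul a b => simp [BraidedTensor.mulMap_tmul IsHomogeneousYD.one]
  mul_one x := by
    obtain ⟨x, rfl⟩ := (BraidedTensor.equiv k K R).surjective x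
    rw [BraidedTensor.one_def, BraidedTensor.mul_def]
    congr 1
    simp only [LinearEquiv.symm_apply_apply]
    refine BraidedTensor.induction (k := k) (K := K) (R := R)
      (p := fun x => BraidedTensor.mulMap k K R (x ⊗ₜ (1 ⊗ₜ 1)) = x) ?_ ?_ ?_ x
    · intro g a b hb
      simp [BraidedTensor.mulMap_tmul hb]
    · simp
    · intro x y hx hy
      rw [TensorProduct.add_tmul, map_add, hx, hy]

instance : Algebra k (BraidedTensor k K R) :=
  Algebra.ofModule
    (fun r x y => by
      simp only [BraidedTensor.mul_def, map_smul, ← TensorProduct.smul_tmul'])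
    (fun r x y => by
      simp only [BraidedTensor.mul_def, map_smul, TensorProduct.tmul_smul])

/-! ### Bosonization -/

variable (k K R)

/-- The linear map `r ⊗ g ↦ r # g` from `R ⊗ k[K]` to the smash product `R # k[K]`. -/
def smashMk : R ⊗[k] MonoidAlgebra k K →ₗ[k] SkewMonoidAlgebra R K :=
  TensorProduct.lift <| LinearMap.flip <|
    Finsupp.lsum k (fun g : K =>
      LinearMap.toSpanSingleton k (R →ₗ[k] SkewMonoidAlgebra R K)
        (SkewMonoidAlgebra.lsingle k g)) ∘ₗ
    (MonoidAlgebra.coeffLinearEquiv k).toLinearMap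

@[simp] lemma smashMk_tmul_of (r : R) (g : K) :
    smashMk k K R (r ⊗ₜ MonoidAlgebra.of k K g) = SkewMonoidAlgebra.single g r := by
  simp [smashMk, SkewMonoidAlgebra.lsingle_apply]

variable {k K R}

/-- The comultiplication of the bosonization `R # k[K]` of an algebra `R` in the Yetter-Drinfeld
category with (braided) comultiplication `Δ(r) = r⁽¹⁾ ⊗ r⁽²⁾`:
`Δ(r # h) = (r⁽¹⁾ # r⁽²⁾₍₋₁₎ h) ⊗ (r⁽²⁾₍₀₎ # h)`. -/
def bosonComul (Δ : R →ₗ[k] BraidedTensor k K R) :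
    SkewMonoidAlgebra R K →ₗ[k] SkewMonoidAlgebra R K ⊗[k] SkewMonoidAlgebra R K :=
  Finsupp.lsum k (fun h : K =>
    TensorProduct.map
      (LinearMap.mulRight k (SkewMonoidAlgebra.single h (1 : R)) ∘ₗ smashMk k K R)
      (SkewMonoidAlgebra.lsingle k h) ∘ₗ
    (TensorProduct.assoc k R (MonoidAlgebra k K) R).symm.toLinearMap ∘ₗ
    (YDAlgebra.coaction : R →ₐ[k] MonoidAlgebra k K ⊗[k] R).toLinearMap.lTensor R ∘ₗ
    (BraidedTensor.equiv k K R).symm.toLinearMap ∘ₗ Δ) ∘ₗ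
  (SkewMonoidAlgebra.coeffLinearEquiv (S := k)).toLinearMap

/-- The counit `ε(r # h) = ε(r)` of the bosonization. -/
def bosonCounit (ε : R →ₗ[k] k) : SkewMonoidAlgebra R K →ₗ[k] k :=
  Finsupp.lsum k (fun _ : K => ε) ∘ₗ (SkewMonoidAlgebra.coeffLinearEquiv (S := k)).toLinearMap

end YD

/-! ### q-numbers and the q-exponential -/

section qNumbers

variable {k : Type*} [Field k]

/-- The q-number `(n)_q = 1 + q + ⋯ + q ^ (n - 1)`. -/
def qNumber (q : k) (n : ℕ) : k := ∑ i ∈ Finset.range n, q ^ i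

/-- The q-factorial `(n)!_q = (1)_q (2)_q ⋯ (n)_q`. -/
def qFactorial (q : k) (n : ℕ) : k := ∏ i ∈ Finset.range n, qNumber q (i + 1)

/-- The q-exponential `∑_{n < N} xⁿ / (n)!_q` of an element `x` with `x ^ N = 0`. -/
def qExp {A : Type*} [Ring A] [Algebra k A] (q : k) (N : ℕ) (x : A) : A :=
  ∑ n ∈ Finset.range N, (qFactorial q n)⁻¹ • x ^ n

/-- The coefficients of the noncommutative q-binomial formula. -/
def qBinomAux (q : k) : ℕ → ℕ → k
  | 0, 0 => 1
  | 0, _ + 1 => 0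
  | n + 1, 0 => qBinomAux q n 0
  | n + 1, j + 1 => qBinomAux q n j + q ^ (j + 1) * qBinomAux q n (j + 1)

lemma qBinomAux_zero_right (q : k) (n : ℕ) : qBinomAux q n 0 = 1 := by
  induction n with
  | zero => rfl
  | succ n ih => rw [qBinomAux, ih]

lemma qBinomAux_of_lt (q : k) (n j : ℕ) (h : n < j) : qBinomAux q n j = 0 := by
  induction n generalizing j with
  | zero => cases j with
    | zero => omega
    | succ j => rfl
  | succ n ih => cases j with
    | zero => omega
    | succ j => rw [qBinomAux, ih j (by omega), ih (j + 1) (by omega)]; simp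

lemma qBinomAux_self (q : k) (n : ℕ) : qBinomAux q n n = 1 := by
  induction n with
  | zero => rfl
  | succ n ih => rw [qBinomAux, ih, qBinomAux_of_lt q n (n + 1) (by omega)]; simp

lemma qNumber_add (q : k) (m n : ℕ) : qNumber q (m + n) = qNumber q m + q ^ m * qNumber q n := by
  simp [qNumber, Finset.sum_range_add, Finset.mul_sum, pow_add]

lemma qFactorial_succ (q : k) (n : ℕ) :
    qFactorial q (n + 1) = qFactorial q n * qNumber q (n + 1) := by
  simp [qFactorial, Finset.prod_range_succ]

lemma qBinomAux_mul (q : k) (i j : ℕ) :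
    qBinomAux q (i + j) j * (qFactorial q j * qFactorial q i) = qFactorial q (i + j) := by
  suffices H : ∀ n i j, i + j = n →
      qBinomAux q (i + j) j * (qFactorial q j * qFactorial q i) = qFactorial q (i + j) from
    H _ i j rfl
  intro n
  induction n with
  | zero =>
    intro i j h
    obtain ⟨rfl, rfl⟩ : i = 0 ∧ j = 0 := by omega
    simp [qBinomAux, qFactorial]
  | succ n ih =>
    intro i j h
    rcases j with _ | j
    · simp [qBinomAux_zero_right, qFactorial]
    rcases i with _ | i
    · simp [qBinomAux_self, qFactorial]
    have h1 := ih (i + 1) j (by omega)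
    have h2 := ih i (j + 1) (by omega)
    have e : i + 1 + (j + 1) = (i + j + 1) + 1 := by ring
    have e1 : i + 1 + j = i + j + 1 := by ring
    have e2 : i + (j + 1) = i + j + 1 := by ring
    rw [e1] at h1
    rw [e2] at h2
    have h3 : qFactorial q (i + j + 1 + 1) =
        qFactorial q (i + j + 1) * (qNumber q (j + 1) + q ^ (j + 1) * qNumber q (i + 1)) := by
      rw [qFactorial_succ, ← qNumber_add, show j + 1 + (i + 1) = i + j + 1 + 1 by ring]
    rw [e, qBinomAux, h3]
    rw [qFactorial_succ q i] at h1 ⊢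
    rw [qFactorial_succ q j] at h2 ⊢
    linear_combination qNumber q (j + 1) * h1 + q ^ (j + 1) * qNumber q (i + 1) * h2

lemma qNumber_orderOf {q : k} (h : 1 < orderOf q) : qNumber q (orderOf q) = 0 := by
  have h1 : q - 1 ≠ 0 := by
    intro hq
    rw [sub_eq_zero.mp hq, orderOf_one] at h
    omega
  have h2 := geom_sum_mul q (orderOf q)
  rw [pow_orderOf_eq_one, sub_self] at h2
  exact (mul_eq_zero.mp h2).resolve_right h1

lemma qNumber_ne_zero {q : k} {n : ℕ} (h0 : 0 < n) (h : n < orderOf q) : qNumber q n ≠ 0 := by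
  intro h1
  have h2 := geom_sum_mul q n
  rw [show ∑ i ∈ Finset.range n, q ^ i = 0 from h1, zero_mul] at h2
  exact pow_ne_one_of_lt_orderOf h0.ne' h (sub_eq_zero.mp h2.symm)

lemma qFactorial_ne_zero {q : k} {n : ℕ} (h : n < orderOf q) : qFactorial q n ≠ 0 :=
  Finset.prod_ne_zero_iff.mpr fun i hi =>
    qNumber_ne_zero (by omega) (by have := Finset.mem_range.mp hi; omega)

lemma qBinomAux_orderOf {q : k} {j : ℕ} (h0 : 0 < j) (h : j < orderOf q) :
    qBinomAux q (orderOf q) j = 0 := by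
  have h1 := qBinomAux_mul q (orderOf q - j) j
  rw [Nat.sub_add_cancel h.le] at h1
  obtain ⟨m, hm⟩ : ∃ m, orderOf q = m + 1 := ⟨orderOf q - 1, by omega⟩
  have h2 : qFactorial q (orderOf q) = 0 := by
    rw [hm, qFactorial_succ, ← hm, qNumber_orderOf (by omega), mul_zero]
  rw [h2] at h1
  refine (mul_eq_zero.mp h1).resolve_right (mul_ne_zero (qFactorial_ne_zero h)
    (qFactorial_ne_zero (by omega)))

lemma add_pow_qBinomAux {A : Type*} [Ring A] [Algebra k A] {q : k} {u v : A}
    (h : v * u = q • (u * v)) (n : ℕ) :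
    (u + v) ^ n = ∑ j ∈ Finset.range (n + 1), qBinomAux q n j • (u ^ j * v ^ (n - j)) := by
  have hv : ∀ j, v * u ^ j = q ^ j • (u ^ j * v) := by
    intro j
    induction j with
    | zero => simp
    | succ j ih =>
      rw [pow_succ, ← mul_assoc, ih, smul_mul_assoc, mul_assoc, h, mul_smul_comm, smul_smul,
        ← pow_succ, ← mul_assoc]
  induction n with
  | zero => simp [qBinomAux]
  | succ n ih =>
    rw [pow_succ', ih, add_mul, Finset.mul_sum, Finset.mul_sum]
    rw [Finset.sum_range_succ' _ (n + 1), Finset.sum_range_succ' (fun j => v * _) n]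
    have e1 : ∀ j ∈ Finset.range (n + 1), qBinomAux q (n + 1) (j + 1) •
        (u ^ (j + 1) * v ^ (n + 1 - (j + 1))) = u * qBinomAux q n j • (u ^ j * v ^ (n - j)) +
          (q ^ (j + 1) * qBinomAux q n (j + 1)) • (u ^ (j + 1) * v ^ (n - j)) := by
      intro j _
      rw [qBinomAux, add_smul, mul_smul_comm, ← mul_assoc, ← pow_succ', Nat.add_sub_add_right]
    rw [Finset.sum_congr rfl e1, Finset.sum_add_distrib, add_assoc]
    congr 1
    rw [Finset.sum_range_succ _ n, qBinomAux_of_lt q n (n + 1) (by omega)]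
    simp only [mul_zero, zero_smul, add_zero]
    congr 1
    · refine Finset.sum_congr rfl fun j hj => ?_
      have hj := Finset.mem_range.mp hj
      rw [mul_smul_comm, ← mul_assoc, hv, smul_mul_assoc, mul_assoc, ← pow_succ', smul_smul,
        mul_comm, show n - (j + 1) + 1 = n - j by omega]
    · simp [qBinomAux_zero_right, pow_succ']

/-- If `vu = q uv` with `q` of order `N` and `u ^ N = v ^ N = 0`,
then `(u + v) ^ N = 0`. -/
lemma add_pow_orderOf_eq_zero {A : Type*} [Ring A] [Algebra k A] {q : k} {u v : A}
    (h : v * u = q • (u * v)) (hu : u ^ orderOf q = 0)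
    (hv : v ^ orderOf q = 0) : (u + v) ^ orderOf q = 0 := by
  rw [add_pow_qBinomAux h]
  refine Finset.sum_eq_zero fun j hj => ?_
  have hj := Finset.mem_range.mp hj
  rcases Nat.eq_zero_or_pos j with rfl | h0
  · simp [hv]
  rcases Nat.lt_or_ge j (orderOf q) with h1 | h1
  · rw [qBinomAux_orderOf h0 h1, zero_smul]
  · rw [show j = orderOf q by omega, hu]; simp

end qNumbers

/-! ### Quantum linear spaces -/

/-- A datum `(g₁, …, g_θ, χ₁, …, χ_θ)` for a quantum linear space over the group `G`. -/
structure QLSDatum (k G : Type*) [Field k] [Group G] (θ : ℕ) where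
  g : Fin θ → G
  χ : Fin θ → G →* kˣ
  g_central : ∀ i h, g i * h = h * g i
  χ_mul_χ : ∀ i j, i ≠ j → χ j (g i) * χ i (g j) = 1
  one_lt_orderOf : ∀ i, 1 < orderOf (χ i (g i) : k)

namespace QLSDatum

set_option linter.unusedSectionVars false

variable {k G : Type*} [Field k] [Group G] {θ : ℕ} (D : QLSDatum k G θ)

/-- `q_{ij} = χ_j(g_i)`. -/
def q (i j : Fin θ) : k := D.χ j (D.g i)

/-- `N_i` is the order of `q_{ii}`. -/
def N (i : Fin θ) : ℕ := orderOf (D.q i i)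

/-- `Γ` is the subgroup generated by the `g_i`. -/
def Γ : Subgroup G := Subgroup.closure (Set.range D.g)

/-- `g_i` as an element of `Γ`. -/
def gΓ (i : Fin θ) : D.Γ := ⟨D.g i, Subgroup.subset_closure ⟨i, rfl⟩⟩

lemma Γ_le_center : D.Γ ≤ Subgroup.center G := by
  refine (Subgroup.closure_le _).mpr ?_
  rintro _ ⟨i, rfl⟩
  exact Subgroup.mem_center_iff.mpr fun h => (D.g_central i h).symm

lemma Γ_comm (h : D.Γ) (s : G) : (h : G) * s = s * h :=
  (Subgroup.mem_center_iff.mp (D.Γ_le_center h.2) s).symm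

lemma q_mul_q {i j : Fin θ} (h : i ≠ j) : D.q i j * D.q j i = 1 := by
  have := congrArg (Units.val) (D.χ_mul_χ i j h)
  simpa [q] using this

lemma one_lt_N (i : Fin θ) : 1 < D.N i := D.one_lt_orderOf i

/-- The relations `x_i ^ N_i = 0` and `x_i x_j = q_{ij} x_j x_i` for `i ≠ j`. -/
inductive NicholsRel : FreeAlgebra k (Fin θ) → FreeAlgebra k (Fin θ) → Prop
  | pow (i : Fin θ) : NicholsRel (FreeAlgebra.ι k i ^ D.N i) 0
  | comm (i j : Fin θ) (h : i ≠ j) : NicholsRel (FreeAlgebra.ι k i * FreeAlgebra.ι k j)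
      (D.q i j • (FreeAlgebra.ι k j * FreeAlgebra.ι k i))

/-- The Nichols algebra `𝔅(V)` of the quantum linear space `V`. -/
def Nichols : Type _ := RingQuot D.NicholsRel

instance : Ring D.Nichols := inferInstanceAs (Ring (RingQuot D.NicholsRel))
instance : Algebra k D.Nichols := inferInstanceAs (Algebra k (RingQuot D.NicholsRel))

/-- The generators `x_i` of the Nichols algebra. -/
def x (i : Fin θ) : D.Nichols := RingQuot.mkAlgHom k D.NicholsRel (FreeAlgebra.ι k i)

lemma x_pow (i : Fin θ) : D.x i ^ D.N i = 0 := by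
  have := RingQuot.mkAlgHom_rel k (NicholsRel.pow (D := D) i)
  rw [map_pow, map_zero] at this
  exact this

lemma x_mul_x {i j : Fin θ} (h : i ≠ j) : D.x i * D.x j = D.q i j • (D.x j * D.x i) := by
  have := RingQuot.mkAlgHom_rel k (NicholsRel.comm (D := D) i j h)
  rw [map_mul, map_smul, map_mul] at this
  exact this

/-- Universal property of the presentation of the Nichols algebra. -/
def nicholsLift {A : Type*} [Ring A] [Algebra k A] (f : Fin θ → A)
    (h1 : ∀ i, f i ^ D.N i = 0) (h2 : ∀ i j, i ≠ j → f i * f j = D.q i j • (f j * f i)) :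
    D.Nichols →ₐ[k] A :=
  RingQuot.liftAlgHom k ⟨FreeAlgebra.lift k f, by
    intro a b hab
    cases hab with
    | pow i => simp [h1]
    | comm i j h => simp [h2 i j h]⟩

@[simp] lemma nicholsLift_x {A : Type*} [Ring A] [Algebra k A] (f : Fin θ → A)
    (h1 : ∀ i, f i ^ D.N i = 0) (h2 : ∀ i j, i ≠ j → f i * f j = D.q i j • (f j * f i))
    (i : Fin θ) : D.nicholsLift f h1 h2 (D.x i) = f i := by
  have := RingQuot.liftAlgHom_mkAlgHom_apply (S := k) (FreeAlgebra.lift k f)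
    (s := D.NicholsRel) (by
      intro a b hab
      cases hab with
      | pow i => simp [h1]
      | comm i j h => simp [h2 i j h]) (FreeAlgebra.ι k i)
  rw [FreeAlgebra.lift_ι_apply] at this
  exact this

variable {D} in
lemma nichols_algHom_ext {A : Type*} [Ring A] [Algebra k A] {f f' : D.Nichols →ₐ[k] A}
    (h : ∀ i, f (D.x i) = f' (D.x i)) : f = f' := by
  refine RingQuot.ringQuot_ext' k f f' ?_
  ext i
  exact h i

/-- The automorphism of the Nichols algebra given by `h • x_i = χ_i(h) x_i`. -/
def nicholsAct (h : G) : D.Nichols →ₐ[k] D.Nichols :=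
  D.nicholsLift (fun i => (D.χ i h : k) • D.x i)
    (fun i => by rw [smul_pow, x_pow, smul_zero])
    (fun i j hij => by
      simp only [smul_mul_assoc, mul_smul_comm, D.x_mul_x hij, smul_smul]
      congr 1
      ring)

lemma nicholsAct_x (h : G) (i : Fin θ) : D.nicholsAct h (D.x i) = (D.χ i h : k) • D.x i := by
  rw [nicholsAct, nicholsLift_x]

lemma nicholsAct_one : D.nicholsAct 1 = AlgHom.id k _ :=
  nichols_algHom_ext fun i => by rw [nicholsAct_x]; simp

lemma nicholsAct_mul (a b : G) : D.nicholsAct (a * b) = (D.nicholsAct a).comp (D.nicholsAct b) :=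
  nichols_algHom_ext fun i => by
    rw [AlgHom.comp_apply, nicholsAct_x, nicholsAct_x, map_smul, nicholsAct_x, smul_smul]
    simp [mul_comm]

instance : MulSemiringAction G D.Nichols where
  smul h v := D.nicholsAct h v
  one_smul v := DFunLike.congr_fun D.nicholsAct_one v
  mul_smul a b v := DFunLike.congr_fun (D.nicholsAct_mul a b) v
  smul_zero h := map_zero (D.nicholsAct h)
  smul_add h := map_add (D.nicholsAct h)
  smul_one h := map_one (D.nicholsAct h)
  smul_mul h := map_mul (D.nicholsAct h)

lemma smul_def (h : G) (v : D.Nichols) : h • v = D.nicholsAct h v := rfl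

@[simp] lemma smul_x (h : G) (i : Fin θ) : h • D.x i = (D.χ i h : k) • D.x i :=
  D.nicholsAct_x h i

instance : SMulCommClass G k D.Nichols :=
  ⟨fun h c v => map_smul (D.nicholsAct h) c v⟩

section Coaction

variable {K : Type*} [Group K] (γ : Fin θ → K) (hγ : ∀ i (h : K), γ i * h = h * γ i)

/-- The coaction `δ(x_i) = γ_i ⊗ x_i` of a group algebra on the Nichols algebra. -/
def nicholsCoaction : D.Nichols →ₐ[k] MonoidAlgebra k K ⊗[k] D.Nichols :=
  D.nicholsLift (fun i => MonoidAlgebra.of k K (γ i) ⊗ₜ D.x i)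
    (fun i => by rw [Algebra.TensorProduct.tmul_pow, x_pow, TensorProduct.tmul_zero])
    (fun i j hij => by
      rw [Algebra.TensorProduct.tmul_mul_tmul, Algebra.TensorProduct.tmul_mul_tmul,
        D.x_mul_x hij, ← map_mul, ← map_mul, hγ i, TensorProduct.tmul_smul])

@[simp] lemma nicholsCoaction_x (i : Fin θ) :
    D.nicholsCoaction γ hγ (D.x i) = MonoidAlgebra.of k K (γ i) ⊗ₜ D.x i := by
  simp [nicholsCoaction]

lemma span_homogeneous_nichols : Submodule.span k {r : D.Nichols | ∃ g : K,
    D.nicholsCoaction γ hγ r = MonoidAlgebra.of k K g ⊗ₜ[k] r} = ⊤ := by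
  set S := {r : D.Nichols | ∃ g : K,
    D.nicholsCoaction γ hγ r = MonoidAlgebra.of k K g ⊗ₜ[k] r} with hS
  have hone : (1 : D.Nichols) ∈ S :=
    ⟨1, by rw [map_one, map_one, Algebra.TensorProduct.one_def]⟩
  have hmul : ∀ a ∈ S, ∀ b ∈ S, a * b ∈ S := by
    rintro a ⟨g, hg⟩ b ⟨h, hh⟩
    exact ⟨g * h, by rw [map_mul, hg, hh, Algebra.TensorProduct.tmul_mul_tmul, map_mul]⟩
  rw [eq_top_iff]
  rintro v -
  obtain ⟨w, rfl⟩ := RingQuot.mkAlgHom_surjective k D.NicholsRel v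
  induction w using FreeAlgebra.induction with
  | grade0 c =>
    rw [Algebra.algebraMap_eq_smul_one, map_smul, map_one]
    exact Submodule.smul_mem _ _ (Submodule.subset_span hone)
  | grade1 i => exact Submodule.subset_span ⟨γ i, D.nicholsCoaction_x γ hγ i⟩
  | mul a b ha hb =>
    rw [map_mul]
    generalize (RingQuot.mkAlgHom k D.NicholsRel) a = a at *
    generalize (RingQuot.mkAlgHom k D.NicholsRel) b = b at *
    have key : Submodule.span k S * Submodule.span k S ≤ Submodule.span k S := by
      rw [Submodule.span_mul_span]
      refine Submodule.span_mono ?_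
      rintro _ ⟨a, ha, b, hb, rfl⟩
      exact hmul a ha b hb
    exact key (Submodule.mul_mem_mul ha hb)
  | add a b ha hb => rw [map_add]; exact Submodule.add_mem _ ha hb

lemma nicholsCoaction_smul (h : G) (v : D.Nichols) :
    D.nicholsCoaction γ hγ (h • v) =
      Algebra.TensorProduct.map (AlgHom.id k _) (D.nicholsAct h) (D.nicholsCoaction γ hγ v) := by
  have : (D.nicholsCoaction γ hγ).comp (D.nicholsAct h) =
      (Algebra.TensorProduct.map (AlgHom.id k _) (D.nicholsAct h)).comp
        (D.nicholsCoaction γ hγ) := by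
    refine nichols_algHom_ext fun i => ?_
    simp [← smul_def, TensorProduct.tmul_smul]
  exact DFunLike.congr_fun this v

lemma nicholsCoaction_conj (h : K) (v : D.Nichols) :
    Algebra.TensorProduct.map (MonoidAlgebra.mapDomainAlgHom k k (MulAut.conj h).toMonoidHom)
      (AlgHom.id k D.Nichols) (D.nicholsCoaction γ hγ v) = D.nicholsCoaction γ hγ v := by
  have : (Algebra.TensorProduct.map
      (MonoidAlgebra.mapDomainAlgHom k k (MulAut.conj h).toMonoidHom)
      (AlgHom.id k D.Nichols)).comp (D.nicholsCoaction γ hγ) = D.nicholsCoaction γ hγ := by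
    refine nichols_algHom_ext fun i => ?_
    simp [← hγ]
  exact DFunLike.congr_fun this v

end Coaction

/-- `𝔅(V)` as an algebra in Yetter-Drinfeld modules over `G`, with `δ(x_i) = g_i ⊗ x_i`. -/
instance : YDAlgebra k G D.Nichols where
  coaction := D.nicholsCoaction D.g D.g_central
  span_homogeneous := D.span_homogeneous_nichols D.g D.g_central
  coaction_smul h r := by
    rw [nicholsCoaction_smul]
    nth_rw 1 [← D.nicholsCoaction_conj D.g D.g_central h r]
    generalize D.nicholsCoaction D.g D.g_central r = z
    induction z with
    | zero => simp
    | add a b ha hb => simp only [map_add, ha, hb]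
    | tmul a b => rfl

lemma gΓ_central (i : Fin θ) (h : D.Γ) : D.gΓ i * h = h * D.gΓ i :=
  Subtype.ext (D.g_central i h)

/-- `𝔅(V)` as an algebra in Yetter-Drinfeld modules over `Γ`, by restriction. -/
instance : YDAlgebra k D.Γ D.Nichols where
  coaction := D.nicholsCoaction D.gΓ D.gΓ_central
  span_homogeneous := D.span_homogeneous_nichols D.gΓ D.gΓ_central
  coaction_smul h r := by
    rw [Subgroup.smul_def, nicholsCoaction_smul]
    nth_rw 1 [← D.nicholsCoaction_conj D.gΓ D.gΓ_central h r]
    generalize D.nicholsCoaction D.gΓ D.gΓ_central r = z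
    induction z with
    | zero => simp
    | add a b ha hb => simp only [map_add, ha, hb]
    | tmul a b => rfl

/-- The counit of `𝔅(V)`. -/
def nicholsCounit : D.Nichols →ₐ[k] k :=
  D.nicholsLift (fun _ => 0) (fun i => zero_pow (by have := D.one_lt_N i; omega))
    (fun i j _ => by simp)

section Comul

variable {K : Type*} [Group K] [MulSemiringAction K D.Nichols] [SMulCommClass K k D.Nichols]
  [YDAlgebra k K D.Nichols]

/-- The braided comultiplication of `𝔅(V)`, an algebra map to the braided tensor square with
`Δ(x_i) = x_i ⊗ 1 + 1 ⊗ x_i`. -/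
def nicholsComulAux (γ : Fin θ → K)
    (h1 : ∀ i, IsHomogeneousYD k K D.Nichols (γ i) (D.x i))
    (h2 : ∀ i j, γ i • D.x j = D.q i j • D.x j) :
    D.Nichols →ₐ[k] BraidedTensor k K D.Nichols :=
  D.nicholsLift (fun i => BraidedTensor.equiv k K _ (D.x i ⊗ₜ 1 + 1 ⊗ₜ D.x i))
    (fun i => by
      rw [map_add]
      refine add_pow_orderOf_eq_zero ?_ ?_ ?_
      · rw [BraidedTensor.equiv_mul_equiv (h1 i),
          BraidedTensor.equiv_mul_equiv IsHomogeneousYD.one, h2, one_smul]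
        simp only [one_mul, mul_one, ← map_smul, TensorProduct.smul_tmul']
      · have : ∀ n, (BraidedTensor.equiv k K D.Nichols (D.x i ⊗ₜ 1)) ^ n =
            BraidedTensor.equiv k K D.Nichols ((D.x i ^ n : D.Nichols) ⊗ₜ 1) := by
          intro n
          induction n with
          | zero => simp [BraidedTensor.one_def]
          | succ n ih =>
            rw [pow_succ, ih, BraidedTensor.equiv_mul_equiv IsHomogeneousYD.one]
            simp [pow_succ]
        rw [this, show orderOf (D.q i i) = D.N i from rfl, x_pow]
        simp
      · have : ∀ n, (BraidedTensor.equiv k K D.Nichols (1 ⊗ₜ D.x i)) ^ n =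
            BraidedTensor.equiv k K D.Nichols (1 ⊗ₜ (D.x i ^ n : D.Nichols)) := by
          intro n
          induction n with
          | zero => simp [BraidedTensor.one_def]
          | succ n ih =>
            rw [pow_succ', ih, BraidedTensor.equiv_mul_equiv (h1 i)]
            simp [pow_succ']
        rw [this, show orderOf (D.q i i) = D.N i from rfl, x_pow]
        simp)
    (fun i j hij => by
      simp only [map_add, add_mul, mul_add]
      rw [BraidedTensor.equiv_mul_equiv IsHomogeneousYD.one,
        BraidedTensor.equiv_mul_equiv IsHomogeneousYD.one,
        BraidedTensor.equiv_mul_equiv IsHomogeneousYD.one,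
        BraidedTensor.equiv_mul_equiv IsHomogeneousYD.one,
        BraidedTensor.equiv_mul_equiv (h1 i), BraidedTensor.equiv_mul_equiv (h1 i),
        BraidedTensor.equiv_mul_equiv (h1 j), BraidedTensor.equiv_mul_equiv (h1 j)]
      simp only [h2, one_smul, smul_one, one_mul, mul_one, D.x_mul_x hij, ← map_smul, ← map_add,
        smul_add, ← TensorProduct.smul_tmul', TensorProduct.tmul_smul, smul_smul, D.q_mul_q hij]
      congr 1
      abel)

end Comul

/-- The braided comultiplication of `𝔅(V)` over `G`. -/
def nicholsComulG : D.Nichols →ₐ[k] BraidedTensor k G D.Nichols :=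
  D.nicholsComulAux D.g (fun i => D.nicholsCoaction_x D.g D.g_central i)
    (fun i j => D.smul_x (D.g i) j)

/-- The braided comultiplication of `𝔅(V)` over `Γ`. -/
def nicholsComul : D.Nichols →ₐ[k] BraidedTensor k D.Γ D.Nichols :=
  D.nicholsComulAux D.gΓ (fun i => D.nicholsCoaction_x D.gΓ D.gΓ_central i)
    (fun i j => D.smul_x (D.g i) j)

/-! ### The bosonization `𝔅(V) # kG` -/

/-- The bosonization `𝔅(V) # kG`. -/
def NicholsSmash : Type _ := SkewMonoidAlgebra D.Nichols G

instance : Ring D.NicholsSmash := inferInstanceAs (Ring (SkewMonoidAlgebra D.Nichols G))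
instance : Algebra k D.NicholsSmash := inferInstanceAs (Algebra k (SkewMonoidAlgebra D.Nichols G))

instance : CoalgebraStruct k D.NicholsSmash where
  comul := bosonComul (K := G) (R := D.Nichols) D.nicholsComulG.toLinearMap
  counit := bosonCounit (K := G) (R := D.Nichols) D.nicholsCounit.toLinearMap

/-! ### The braided Hopf algebra `𝔅(V) ⊗ kG` over `Γ` -/

/-- The algebra `𝔅(V) ⊗ kG` with product `(v ⊗ s)(v' ⊗ s') = v (s • v') ⊗ s s'`. -/
def BG : Type _ := SkewMonoidAlgebra D.Nichols G

instance : Ring D.BG := inferInstanceAs (Ring (SkewMonoidAlgebra D.Nichols G))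
instance : Algebra k D.BG := inferInstanceAs (Algebra k (SkewMonoidAlgebra D.Nichols G))

/-- The linear map `v ↦ v ⊗ s`. -/
def singleBG (s : G) : D.Nichols →ₗ[k] D.BG :=
  SkewMonoidAlgebra.lsingle (M := D.Nichols) k s

/-- The linear map on `𝔅(V) ⊗ kG` with `v ⊗ s ↦ f_s(v)`. -/
def liftBG {M : Type*} [AddCommGroup M] [Module k M] (f : G → D.Nichols →ₗ[k] M) :
    D.BG →ₗ[k] M :=
  Finsupp.lsum k f ∘ₗ
    (SkewMonoidAlgebra.coeffLinearEquiv (k := D.Nichols) (G := G) (S := k)).toLinearMap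

@[simp] lemma liftBG_single {M : Type*} [AddCommGroup M] [Module k M]
    (f : G → D.Nichols →ₗ[k] M) (s : G) (v : D.Nichols) :
    D.liftBG f (D.singleBG s v) = f s v := by
  change Finsupp.lsum k f (Finsupp.single s v) = f s v
  simp

lemma singleBG_mul (s t : G) (v w : D.Nichols) :
    D.singleBG s v * D.singleBG t w = D.singleBG (s * t) (v * s • w) :=
  SkewMonoidAlgebra.single_mul_single

lemma one_BG : (1 : D.BG) = D.singleBG 1 1 := rfl

lemma BG_induction' {p : D.BG → Prop} (h0 : p 0) (hadd : ∀ a b, p a → p b → p (a + b))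
    (h : ∀ (s : G) (v : D.Nichols), p (D.singleBG s v)) (a : D.BG) : p a :=
  SkewMonoidAlgebra.induction_on (k := D.Nichols) (G := G) a h0 h hadd

/-- The map `v ⊗ s ↦ (h • v) ⊗ s`. -/
def actBG (h : D.Γ) : D.BG →ₗ[k] D.BG :=
  D.liftBG fun s => D.singleBG s ∘ₗ (D.nicholsAct (h : G)).toLinearMap

@[simp] lemma actBG_single (h : D.Γ) (s : G) (v : D.Nichols) :
    D.actBG h (D.singleBG s v) = D.singleBG s (h • v) := by
  simp [actBG, Subgroup.smul_def, smul_def]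

lemma actBG_mul (h : D.Γ) (a b : D.BG) : D.actBG h (a * b) = D.actBG h a * D.actBG h b := by
  refine D.BG_induction' (p := fun a => D.actBG h (a * b) = D.actBG h a * D.actBG h b)
    (by simp) (fun a a' ha ha' => by simp only [add_mul, map_add, ha, ha']) (fun s v => ?_) a
  refine D.BG_induction' (p := fun b => D.actBG h (D.singleBG s v * b) =
    D.actBG h (D.singleBG s v) * D.actBG h b)
    (by simp) (fun a a' ha ha' => by simp only [mul_add, map_add, ha, ha']) (fun t w => ?_) b
  simp only [singleBG_mul, actBG_single, smul_mul']
  congr 2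
  rw [Subgroup.smul_def, Subgroup.smul_def, ← mul_smul, ← mul_smul, D.Γ_comm]

/-- The action `h • (v ⊗ s) = (h • v) ⊗ s` of `Γ` on `𝔅(V) ⊗ kG`. -/
instance : MulSemiringAction D.Γ D.BG where
  smul h a := D.actBG h a
  one_smul a := D.BG_induction' (p := fun a => D.actBG 1 a = a) (by simp)
    (fun a b ha hb => by simp only [map_add, ha, hb]) (fun s v => by simp) a
  mul_smul g h a := D.BG_induction' (p := fun a => D.actBG (g * h) a = D.actBG g (D.actBG h a))
    (by simp) (fun a b ha hb => by simp only [map_add, ha, hb])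
    (fun s v => by simp [mul_smul]) a
  smul_zero h := map_zero (D.actBG h)
  smul_add h := map_add (D.actBG h)
  smul_one h := by
    change D.actBG h 1 = 1
    rw [one_BG, actBG_single, smul_one]
  smul_mul h := D.actBG_mul h

@[simp] lemma smul_singleBG (h : D.Γ) (s : G) (v : D.Nichols) :
    h • D.singleBG s v = D.singleBG s (h • v) := D.actBG_single h s v

instance : SMulCommClass D.Γ k D.BG := ⟨fun h c a => map_smul (D.actBG h) c a⟩

/-- The embedding `v ↦ v ⊗ 1`. -/
def toBG : D.Nichols →ₐ[k] D.BG where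
  __ := (SkewMonoidAlgebra.singleOneRingHom : D.Nichols →+* SkewMonoidAlgebra D.Nichols G)
  commutes' _ := rfl

lemma toBG_apply (v : D.Nichols) : D.toBG v = D.singleBG 1 v := rfl

/-- The embedding `s ↦ 1 ⊗ s`. -/
def ofBG : G →* D.BG := SkewMonoidAlgebra.of D.Nichols G

lemma ofBG_apply (s : G) : D.ofBG s = D.singleBG s 1 :=
  SkewMonoidAlgebra.of_apply (k := D.Nichols) (G := G) s

/-- The coaction `δ(v ⊗ s) = v₍₋₁₎ ⊗ v₍₀₎ ⊗ s` of `k[Γ]` on `𝔅(V) ⊗ kG`. -/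
def coactionBG : D.BG →ₐ[k] MonoidAlgebra k D.Γ ⊗[k] D.BG :=
  SkewMonoidAlgebra.liftNCAlgHom (A := D.Nichols) (G := G)
    ((Algebra.TensorProduct.map (AlgHom.id k _) D.toBG).comp
      (D.nicholsCoaction D.gΓ D.gΓ_central))
    ((Algebra.TensorProduct.includeRight (R := k) (A := MonoidAlgebra k D.Γ)
      (B := D.BG)).toMonoidHom.comp D.ofBG)
    (by
      intro v s
      simp only [AlgHom.comp_apply, nicholsCoaction_smul]
      generalize D.nicholsCoaction D.gΓ D.gΓ_central v = z
      induction z with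
      | zero => simp
      | add a b ha hb => simp only [map_add, add_mul, mul_add, ha, hb]
      | tmul a b =>
        simp [toBG_apply, ofBG_apply, ← smul_def, singleBG_mul])

lemma coactionBG_single {g : D.Γ} {v : D.Nichols} (s : G)
    (h : IsHomogeneousYD k D.Γ D.Nichols g v) :
    D.coactionBG (D.singleBG s v) = MonoidAlgebra.of k D.Γ g ⊗ₜ[k] D.singleBG s v := by
  have h' : D.nicholsCoaction D.gΓ D.gΓ_central v = MonoidAlgebra.of k D.Γ g ⊗ₜ v := h
  have : D.coactionBG (D.singleBG s v) =
      (Algebra.TensorProduct.map (AlgHom.id k _) D.toBG)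
        (D.nicholsCoaction D.gΓ D.gΓ_central v) * (1 ⊗ₜ D.ofBG s) :=
    SkewMonoidAlgebra.liftNC_single _ _ _ _
  rw [this, h']
  simp [toBG_apply, ofBG_apply, singleBG_mul]

lemma BG_induction {p : D.BG → Prop} (h0 : p 0) (hadd : ∀ a b, p a → p b → p (a + b))
    (h : ∀ (s : G) (g : D.Γ) (v : D.Nichols), IsHomogeneousYD k D.Γ D.Nichols g v →
      p (D.singleBG s v)) (a : D.BG) : p a := by
  refine D.BG_induction' h0 hadd (fun s v => ?_) a
  have hv : v ∈ Submodule.span k {r : D.Nichols | ∃ g : D.Γ,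
      IsHomogeneousYD k D.Γ D.Nichols g r} := by
    rw [show Submodule.span k {r : D.Nichols | ∃ g : D.Γ,
      IsHomogeneousYD k D.Γ D.Nichols g r} = ⊤ from
        YDAlgebra.span_homogeneous (k := k) (K := D.Γ) (R := D.Nichols)]
    trivial
  induction hv using Submodule.closure_induction with
  | zero => simpa using h0
  | add x y _ _ hx hy => rw [map_add]; exact hadd _ _ hx hy
  | smul_mem c x hx =>
    obtain ⟨g, hg⟩ := hx
    refine h s g (c • x) ?_
    unfold IsHomogeneousYD at *
    rw [map_smul, hg, TensorProduct.tmul_smul]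

/-- `𝔅(V) ⊗ kG` as an algebra in Yetter-Drinfeld modules over `Γ`. -/
instance : YDAlgebra k D.Γ D.BG where
  coaction := D.coactionBG
  span_homogeneous := by
    rw [eq_top_iff]
    rintro a -
    refine D.BG_induction (Submodule.zero_mem _) (fun a b => Submodule.add_mem _) ?_ a
    exact fun s g v hv => Submodule.subset_span ⟨g, D.coactionBG_single s hv⟩
  coaction_smul h r := by
    refine D.BG_induction (p := fun r => D.coactionBG (h • r) = TensorProduct.map
      (MonoidAlgebra.mapDomainAlgHom k k (MulAut.conj h).toMonoidHom).toLinearMap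
      (DistribSMul.toLinearMap k D.BG h) (D.coactionBG r)) ?_ ?_ ?_ r
    · simp only [smul_zero, map_zero]
    · intro a b ha hb
      simp only [smul_add, map_add, ha, hb]
    · intro s g v hv
      have hhv : IsHomogeneousYD k D.Γ D.Nichols g (h • v) := by
        have h1 : D.nicholsCoaction D.gΓ D.gΓ_central v = MonoidAlgebra.of k D.Γ g ⊗ₜ v := hv
        have h2 := D.nicholsCoaction_smul D.gΓ D.gΓ_central h v
        rw [h1] at h2
        exact h2
      have h4 : h * g * h⁻¹ = g := by
        rw [show h * g = g * h from Subtype.ext (D.Γ_comm h g), mul_inv_cancel_right]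
      rw [smul_singleBG, D.coactionBG_single s hhv, D.coactionBG_single s hv]
      simp [h4]

/-- The braided comultiplication `Δ(v ⊗ s) = v₁ ⊗ s ⊗ v₂ ⊗ s` of `𝔅(V) ⊗ kG`. -/
def comulBG : D.BG →ₗ[k] BraidedTensor k D.Γ D.BG :=
  (BraidedTensor.equiv k D.Γ D.BG).toLinearMap ∘ₗ
  D.liftBG fun s => TensorProduct.map (D.singleBG s) (D.singleBG s) ∘ₗ
    (BraidedTensor.equiv k D.Γ D.Nichols).symm.toLinearMap ∘ₗ D.nicholsComul.toLinearMap

/-- The counit `ε(v ⊗ s) = ε(v)` of `𝔅(V) ⊗ kG`. -/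
def counitBG : D.BG →ₗ[k] k := D.liftBG fun _ => D.nicholsCounit.toLinearMap

/-- The underlying algebra `(𝔅(V) ⊗ kG) # kΓ` of the bosonization; the element
`(v ⊗ s) # h` is `SkewMonoidAlgebra.single h (D.singleBG s v)`. -/
abbrev BGSmash : Type _ := SkewMonoidAlgebra D.BG D.Γ

/-- The relations `(1 ⊗ h) # 1 = (1 ⊗ 1) # h` for `h ∈ Γ`. -/
inductive GlueRel : D.BGSmash → D.BGSmash → Prop
  | glue (h : D.Γ) : GlueRel
      (SkewMonoidAlgebra.single 1 (D.singleBG (h : G) 1))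
      (SkewMonoidAlgebra.single h (1 : D.BG))

/-- The algebra underlying `A(V, G, 𝒟)`: the quotient of `(𝔅(V) ⊗ kG) # kΓ` by the two-sided ideal
generated by the elements `(1 ⊗ h) # 1 - (1 ⊗ 1) # h`, `h ∈ Γ`. -/
def A : Type _ := RingQuot D.GlueRel

instance : Ring D.A := inferInstanceAs (Ring (RingQuot D.GlueRel))
instance : Algebra k D.A := inferInstanceAs (Algebra k (RingQuot D.GlueRel))

/-- The quotient map `(𝔅(V) ⊗ kG) # kΓ → A(V, G, 𝒟)`. -/
def toA : D.BGSmash →ₐ[k] D.A := RingQuot.mkAlgHom k D.GlueRel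

/-! ### Families of scalars and their twists -/

/-- A family `𝒟` of scalars: `a_{ij}` for `i ≠ j`, and `ξ_i`. The diagonal entries of `a` are
never used. -/
@[nolint unusedArguments]
structure ScalarFamily (_D : QLSDatum k G θ) where
  a : Fin θ → Fin θ → k
  ξ : Fin θ → k

namespace ScalarFamily

variable {D} (F : D.ScalarFamily)

/-- Compatibility: `a_{ij} = 0` if `g_i g_j ≠ 1`, and `ξ_i = 0` if `g_i ^ N_i ≠ 1`. -/
def IsCompatible : Prop :=
  (∀ i j, i ≠ j → D.g i * D.g j ≠ 1 → F.a i j = 0) ∧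
    ∀ i, D.g i ^ D.N i ≠ 1 → F.ξ i = 0

/-- Invariance under a subset `S` of `G`: `χ_i(g) χ_j(g) a_{ij} = a_{ij}` and
`χ_i(g) ^ N_i ξ_i = ξ_i` for all `g ∈ S`. -/
def IsInvariant (S : Set G) : Prop :=
  ∀ g ∈ S, (∀ i j, i ≠ j → (D.χ i g : k) * D.χ j g * F.a i j = F.a i j) ∧
    ∀ i, (D.χ i g : k) ^ D.N i * F.ξ i = F.ξ i

/-- `𝒟` is q-symmetric if `a_{ij} = - q_{ij} a_{ji}` for `i ≠ j`. -/
def IsQSymmetric : Prop := ∀ i j, i ≠ j → F.a i j = -(D.q i j * F.a j i)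

/-- The family of scalars `b_{ij} = q_{ij} a_{ji} - a_{ij}` and `ξ_i`. -/
def hat : D.ScalarFamily where
  a i j := D.q i j * F.a j i - F.a i j
  ξ := F.ξ

/-- `J_{ξ_i} = 1 ⊗ 1 + ∑_{0 < n < N_i} ξ_i / ((N_i - n)!_{q_i} (n)!_{q_i}) x_i^{N_i - n} ⊗ x_i^n`. -/
def Jξ (i : Fin θ) : BraidedTensor k D.Γ D.Nichols :=
  BraidedTensor.equiv k D.Γ D.Nichols (1 ⊗ₜ 1 + ∑ n ∈ Finset.Ioo 0 (D.N i),
    (F.ξ i / (qFactorial (D.q i i) (D.N i - n) * qFactorial (D.q i i) n)) •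
      ((D.x i ^ (D.N i - n) : D.Nichols) ⊗ₜ[k] (D.x i ^ n : D.Nichols)))

/-- `exp_{q_{ij}}(B_{ij})` with `B_{ij} = a_{ij} x_i ⊗ x_j`. Here `B_{ij} ^ N_i = 0`, and `q_{ij}` has
order `N_i` if `g_i g_j = 1`. -/
def expB (i j : Fin θ) : BraidedTensor k D.Γ D.Nichols :=
  qExp (D.q i j) (D.N i)
    (BraidedTensor.equiv k D.Γ D.Nichols (F.a i j • (D.x i ⊗ₜ[k] D.x j)))

/-- The twist `J_𝒟 = ∏_i J_{ξ_i} ∏_{i ≠ j} exp_{q_{ij}}(B_{ij})` in the braided tensor square of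
`𝔅(V)`. -/
def J : BraidedTensor k D.Γ D.Nichols :=
  ((List.finRange θ).map F.Jξ).prod *
    ((List.finRange θ).map fun i =>
      ((List.finRange θ).map fun j => if i = j then 1 else F.expB i j).prod).prod

/-- The twist `J¹ ⊗ 1 ⊗ J² ⊗ 1` in the braided tensor square of `𝔅(V) ⊗ kG`. -/
def JBG : BraidedTensor k D.Γ D.BG :=
  BraidedTensor.equiv k D.Γ D.BG (TensorProduct.map D.toBG.toLinearMap D.toBG.toLinearMap
    ((BraidedTensor.equiv k D.Γ D.Nichols).symm F.J))

/-- The comultiplication `Δ^J(h) = J⁻¹ Δ(h) J` of the twisted braided Hopf algebra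
`(𝔅(V) ⊗ kG)^J`. -/
def twistedComul : D.BG →ₗ[k] BraidedTensor k D.Γ D.BG :=
  LinearMap.mulRight k F.JBG ∘ₗ LinearMap.mulLeft k (Ring.inverse F.JBG) ∘ₗ D.comulBG

/-- The comultiplication of the bosonization `(𝔅(V) ⊗ kG)^J # kΓ`. -/
def smashComul : D.BGSmash →ₗ[k] D.BGSmash ⊗[k] D.BGSmash := bosonComul F.twistedComul

/-- The counit of the bosonization `(𝔅(V) ⊗ kG)^J # kΓ`. -/
def smashCounit (_F : D.ScalarFamily) : D.BGSmash →ₗ[k] k := bosonCounit D.counitBG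

/-- The given coalgebra structure on the algebra `D.A` is the quotient of that of
`(𝔅(V) ⊗ kG)^J # kΓ`. Since the quotient map is surjective there is at most one such coalgebra
structure; together with it, `D.A` is `A(V, G, 𝒟)`. -/
structure IsQuotientCoalgebra [CoalgebraStruct k D.A] : Prop where
  comul_toA (z : D.BGSmash) : CoalgebraStruct.comul (R := k) (D.toA z) =
    TensorProduct.map D.toA.toLinearMap D.toA.toLinearMap (F.smashComul z)
  counit_toA (z : D.BGSmash) : CoalgebraStruct.counit (R := k) (D.toA z) = F.smashCounit z

end ScalarFamily

end QLSDatum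

end

/-!
Write `H = 𝔅(V) # kG`. As an algebra, the quotient `A(V, G, 𝒟)` is `H` itself, the class of
`(v ⊗ s) # h` being `v # sh`; its comultiplication is `Δ` twisted by the image `𝒥 ∈ H ⊗ H` of
`J_𝒟`. The proof works with `H` throughout.

The twist is an exponential. If `a_{ij} ≠ 0` for some `i ≠ j`, then compatibility and
`Γ`-invariance force `q_{ii} = q_{ij} = q_{ji} = q_{jj} = -1` and `N_i = N_j = 2`. Hence not only
the factors of `J_𝒟` for the `ξ_i` but also the `q`-exponentials are of the form `1 + y` with
`y² = 0`; the images of these `y` in `H ⊗ H` commute, and `𝒥 = exp R` with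
`R = ∑ ξ_i T_i + ∑ a_{ij} B_{ij}`. Each summand commutes with `Δ` on the subalgebra `K` generated
by the `x_i` and `Γ`, lies in `K ⊗ K`, and satisfies the linearised form of the cocycle identity
(`T_mem_infTwist`, `IsLinked.mem_infTwist`). Exponentiating such elements gives twists
(`isTwist_nilExpUnit`), whence a bialgebra, which is the quotient coalgebra of the statement by
`IsAdmissible.map_smashComul`. The antipode exists because the kernel of the bialgebra map
`H → kG` is a nilpotent ideal: modulo it the identity is convolution invertible
(`isHopfAlgebra_of_isNilpotent_ker`).

Suppose that `𝒟̂` is `G`-invariant. Split `a` into its symmetric and alternating parts under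
exchange of `i` and `j`. The former and the `ξ_i` contribute to `R` an element which commutes with
`Δ(H)`, so they do not change `Δ` at all; the contribution of the latter is the coboundary
`Δ(w) - w ⊗ 1 - 1 ⊗ w` of `w = ½ ∑ c_{ij} x_i x_j`, so conjugation by `exp w` undoes it. Hence
`A(V, G, 𝒟) ≅ H` (`IsAdmissible.nonempty_bialgEquiv`), and `H` is pointed since it is filtered by
degree with `kG` in degree `0` (`isPointed_of_filtration`).

Conversely let `A(V, G, 𝒟)` be pointed. Simple modules over the dual algebra are one-dimensional,
so every `s ∈ G` lifts to a group-like element `v` (`IsPointed.exists_isGroupLikeElem`), that is,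
`Δ(v) 𝒥 = 𝒥 (v ⊗ v)`. Products of functionals reading off the coefficients of powers of the `x_i`
detect a single scalar of the family in `𝒥`; applied to this equation they give the invariance of
that scalar under `s` (`IsAdmissible.map_comul_add`). For the `a_{ij}` only the difference of the
equations for `(i, j)` and `(j, i)` is free of unknown coefficients of `Δ(v)`, which is why the
combination `b_{ij}` enters. In the q-symmetric case `b_{ij} = -2 a_{ij}`.
-/

noncomputable section

/-! ### The algebra `𝔅(V) # kG` -/

namespace QLSDatum

variable {k G : Type*} [Field k] [Group G] {θ : ℕ} (D : QLSDatum k G θ)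

lemma nichols_induction {p : D.Nichols → Prop} (one : p 1)
    (add : ∀ a b, p a → p b → p (a + b)) (smul : ∀ (c : k) a, p a → p (c • a))
    (x_mul : ∀ i a, p a → p (D.x i * a)) (v : D.Nichols) : p v := by
  let m : FreeAlgebra k (Fin θ) →ₐ[k] D.Nichols := RingQuot.mkAlgHom k D.NicholsRel
  obtain ⟨w, rfl⟩ : ∃ w, m w = v := RingQuot.mkAlgHom_surjective k D.NicholsRel v
  suffices H : ∀ v, p v → p (m w * v) by
    have := H 1 one
    rwa [mul_one] at this
  induction w using FreeAlgebra.induction with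
  | grade0 c =>
    intro v hv
    rw [AlgHom.commutes, ← Algebra.smul_def]
    exact smul c v hv
  | grade1 i => exact x_mul i
  | mul a b ha hb =>
    intro v hv
    rw [map_mul, mul_assoc]
    exact ha _ (hb _ hv)
  | add a b ha hb =>
    intro v hv
    rw [map_add, add_mul]
    exact add _ _ (ha _ hv) (hb _ hv)

lemma q_ne_zero (i j : Fin θ) : D.q i j ≠ 0 := (D.χ j (D.g i)).ne_zero

/-- The embedding `v ↦ v # 1` of the Nichols algebra into its bosonization. -/
def ofNichols : D.Nichols →ₐ[k] D.NicholsSmash where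
  __ := (SkewMonoidAlgebra.singleOneRingHom : D.Nichols →+* SkewMonoidAlgebra D.Nichols G)
  commutes' _ := rfl

/-- The group element `1 # s` of the bosonization. -/
def grp : G →* D.NicholsSmash := SkewMonoidAlgebra.of D.Nichols G

/-- The generator `x_i # 1` of the bosonization. -/
def gen (i : Fin θ) : D.NicholsSmash := D.ofNichols (D.x i)

/-- The linear map `v ↦ v # s`. -/
def smashSingle (s : G) : D.Nichols →ₗ[k] D.NicholsSmash :=
  SkewMonoidAlgebra.lsingle (M := D.Nichols) k s

lemma ofNichols_mul_grp (v : D.Nichols) (s : G) :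
    D.ofNichols v * D.grp s = D.smashSingle s v := by
  have : (SkewMonoidAlgebra.single 1 v * SkewMonoidAlgebra.single s 1 :
    SkewMonoidAlgebra D.Nichols G) = SkewMonoidAlgebra.single s v := by
      rw [SkewMonoidAlgebra.single_mul_single]; simp
  exact this

lemma smashSingle_mul (s t : G) (v w : D.Nichols) :
    D.smashSingle s v * D.smashSingle t w = D.smashSingle (s * t) (v * s • w) :=
  SkewMonoidAlgebra.single_mul_single

lemma smashSingle_one (v : D.Nichols) : D.smashSingle 1 v = D.ofNichols v := rfl

lemma smashSingle_one_right (s : G) : D.smashSingle s 1 = D.grp s :=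
  (SkewMonoidAlgebra.of_apply (k := D.Nichols) (G := G) s).symm

lemma grp_mul_gen (s : G) (i : Fin θ) :
    D.grp s * D.gen i = (D.χ i s : k) • (D.gen i * D.grp s) := by
  rw [← smashSingle_one_right, gen, ← smashSingle_one, smashSingle_mul, smashSingle_mul]
  simp

lemma gen_pow (i : Fin θ) : D.gen i ^ D.N i = 0 := by
  rw [gen, ← map_pow, x_pow, map_zero]

lemma gen_pow_of_le {i : Fin θ} {n : ℕ} (h : D.N i ≤ n) : D.gen i ^ n = 0 :=
  pow_eq_zero_of_le h (D.gen_pow i)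

lemma gen_mul_gen {i j : Fin θ} (h : i ≠ j) :
    D.gen i * D.gen j = D.q i j • (D.gen j * D.gen i) := by
  rw [gen, gen, ← map_mul, D.x_mul_x h, map_smul, map_mul]

lemma smash_induction_single {p : D.NicholsSmash → Prop} (zero : p 0)
    (add : ∀ a b, p a → p b → p (a + b))
    (single : ∀ (s : G) (v : D.Nichols), p (D.smashSingle s v)) (a : D.NicholsSmash) : p a :=
  SkewMonoidAlgebra.induction_on (k := D.Nichols) (G := G) a zero single add

/-- The bosonization is spanned by the elements `x_{i₁} ⋯ x_{iₙ} s`. -/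
lemma smash_induction {p : D.NicholsSmash → Prop} (zero : p 0)
    (add : ∀ a b, p a → p b → p (a + b)) (smul : ∀ (c : k) a, p a → p (c • a))
    (grp : ∀ s, p (D.grp s)) (gen_mul : ∀ i a, p a → p (D.gen i * a))
    (a : D.NicholsSmash) : p a := by
  refine D.smash_induction_single zero add (fun s v => ?_) a
  induction v using D.nichols_induction with
  | one => rw [smashSingle_one_right]; exact grp s
  | add a b ha hb => rw [map_add]; exact add _ _ ha hb
  | smul c a ha => rw [map_smul]; exact smul _ _ ha
  | x_mul i a ha =>
    rw [← ofNichols_mul_grp, map_mul, mul_assoc, ofNichols_mul_grp]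
    exact gen_mul i _ ha

/-- Algebra maps out of the bosonization. -/
def smashLift {A : Type*} [Ring A] [Algebra k A] (f : D.Nichols →ₐ[k] A) (u : G →* A)
    (h : ∀ s i, u s * f (D.x i) = (D.χ i s : k) • (f (D.x i) * u s)) : D.NicholsSmash →ₐ[k] A :=
  SkewMonoidAlgebra.liftNCAlgHom (A := D.Nichols) (G := G) f u (by
    intro v s
    induction v using D.nichols_induction with
    | one => simp
    | add a b ha hb => simp only [smul_add, map_add, add_mul, mul_add, ha, hb]
    | smul c a ha => 
      rw [smul_comm s c a, map_smul f c (s • a), map_smul f c a, smul_mul_assoc, mul_smul_comm, ha]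
    | x_mul i a ha =>
      rw [smul_mul', map_mul, mul_assoc, ha, smul_x, map_smul, map_mul, ← mul_assoc, ← mul_assoc,
        h, smul_mul_assoc, smul_mul_assoc])

section smashLift

variable {A : Type*} [Ring A] [Algebra k A] (f : D.Nichols →ₐ[k] A) (u : G →* A)
    (h : ∀ s i, u s * f (D.x i) = (D.χ i s : k) • (f (D.x i) * u s))

lemma smashLift_single (s : G) (v : D.Nichols) :
    D.smashLift f u h (D.smashSingle s v) = f v * u s :=
  SkewMonoidAlgebra.liftNC_single _ _ _ _

@[simp] lemma smashLift_ofNichols (v : D.Nichols) :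
    D.smashLift f u h (D.ofNichols v) = f v := by
  rw [← smashSingle_one, smashLift_single]; simp

@[simp] lemma smashLift_gen (i : Fin θ) : D.smashLift f u h (D.gen i) = f (D.x i) :=
  D.smashLift_ofNichols f u h _

@[simp] lemma smashLift_grp (s : G) : D.smashLift f u h (D.grp s) = u s := by
  rw [← smashSingle_one_right, smashLift_single]; simp

end smashLift

variable {D} in
lemma smash_algHom_ext {A : Type*} [Ring A] [Algebra k A] {f f' : D.NicholsSmash →ₐ[k] A}
    (hx : ∀ i, f (D.gen i) = f' (D.gen i)) (hg : ∀ s, f (D.grp s) = f' (D.grp s)) : f = f' := by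
  ext a
  induction a using D.smash_induction with
  | zero => simp
  | add a b ha hb => simp only [map_add, ha, hb]
  | smul c a ha => simp only [map_smul, ha]
  | grp s => exact hg s
  | gen_mul i a ha => simp only [map_mul, hx, ha]

end QLSDatum

/-! ### The comultiplication of a bosonization -/

section Boson

variable {k K R : Type*} [Field k] [Group K] [Ring R] [Algebra k R] [MulSemiringAction K R]
  [SMulCommClass K k R] [YDAlgebra k K R]

variable (k K R) in
/-- The linear map underlying `bosonHom`. -/
def bosonHomAux : BraidedTensor k K R →ₗ[k] SkewMonoidAlgebra R K ⊗[k] SkewMonoidAlgebra R K :=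
  TensorProduct.map (smashMk k K R) (SkewMonoidAlgebra.lsingle k 1) ∘ₗ
    (TensorProduct.assoc k R (MonoidAlgebra k K) R).symm.toLinearMap ∘ₗ
    (YDAlgebra.coaction : R →ₐ[k] MonoidAlgebra k K ⊗[k] R).toLinearMap.lTensor R ∘ₗ
    (BraidedTensor.equiv k K R).symm.toLinearMap

lemma bosonHomAux_equiv {g : K} {b : R} (hb : IsHomogeneousYD k K R g b) (a : R) :
    bosonHomAux k K R (BraidedTensor.equiv k K R (a ⊗ₜ b)) =
      SkewMonoidAlgebra.single g a ⊗ₜ SkewMonoidAlgebra.single 1 b := by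
  unfold IsHomogeneousYD at hb
  simp only [bosonHomAux, LinearMap.comp_apply, LinearEquiv.coe_coe, LinearEquiv.symm_apply_apply,
    LinearMap.lTensor_tmul, AlgHom.toLinearMap_apply, hb, TensorProduct.assoc_symm_tmul,
    TensorProduct.map_tmul, smashMk_tmul_of, SkewMonoidAlgebra.lsingle_apply]

/-- Induction on the braided tensor square, spanned by the `a ⊗ b` with `b` homogeneous. -/
lemma BraidedTensor.induction_equiv {p : BraidedTensor k K R → Prop}
    (h : ∀ (g : K) (a b : R), IsHomogeneousYD k K R g b → p (BraidedTensor.equiv k K R (a ⊗ₜ b)))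
    (h0 : p 0) (hadd : ∀ x y, p x → p y → p (x + y)) (x : BraidedTensor k K R) : p x := by
  obtain ⟨x, rfl⟩ := (BraidedTensor.equiv k K R).surjective x
  refine BraidedTensor.induction (k := k) (K := K) (R := R)
    (p := fun x => p (BraidedTensor.equiv k K R x)) h ?_ ?_ x
  · rwa [map_zero]
  · intro x y hx hy
    rw [map_add]
    exact hadd _ _ hx hy

variable (k K R) in
/-- The algebra map `a ⊗ b ↦ (a # b₍₋₁₎) ⊗ (b₍₀₎ # 1)` from the braided tensor square of `R` to the
ordinary tensor square of its bosonization. -/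
def bosonHom : BraidedTensor k K R →ₐ[k] SkewMonoidAlgebra R K ⊗[k] SkewMonoidAlgebra R K :=
  AlgHom.ofLinearMap (bosonHomAux k K R)
    (by rw [BraidedTensor.one_def, bosonHomAux_equiv IsHomogeneousYD.one]; rfl)
    (by
      intro x y
      refine BraidedTensor.induction_equiv
        (p := fun x => bosonHomAux k K R (x * y) = bosonHomAux k K R x * bosonHomAux k K R y)
        ?_ ?_ ?_ x
      · intro g a b hb
        refine BraidedTensor.induction_equiv
          (p := fun y => bosonHomAux k K R (BraidedTensor.equiv k K R (a ⊗ₜ b) * y) =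
            bosonHomAux k K R (BraidedTensor.equiv k K R (a ⊗ₜ b)) * bosonHomAux k K R y)
          ?_ ?_ ?_ y
        · intro h c d hd
          rw [BraidedTensor.equiv_mul_equiv hb, bosonHomAux_equiv (hb.mul hd),
            bosonHomAux_equiv hb, bosonHomAux_equiv hd, Algebra.TensorProduct.tmul_mul_tmul,
            SkewMonoidAlgebra.single_mul_single, SkewMonoidAlgebra.single_mul_single]
          simp
        · simp
        · intro y y' hy hy'
          simp only [mul_add, map_add, hy, hy']
      · simp
      · intro x x' hx hx'
        simp only [add_mul, map_add, hx, hx'])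

lemma bosonHom_equiv {g : K} {b : R} (hb : IsHomogeneousYD k K R g b) (a : R) :
    bosonHom k K R (BraidedTensor.equiv k K R (a ⊗ₜ b)) =
      SkewMonoidAlgebra.single g a ⊗ₜ SkewMonoidAlgebra.single 1 b :=
  bosonHomAux_equiv hb a

lemma bosonComul_single (Δ : R →ₗ[k] BraidedTensor k K R) (h : K) (r : R) :
    bosonComul Δ (SkewMonoidAlgebra.single h r) = bosonHom k K R (Δ r) *
      (SkewMonoidAlgebra.single h (1 : R) ⊗ₜ SkewMonoidAlgebra.single h (1 : R)) := by
  have e : bosonComul Δ (SkewMonoidAlgebra.single h r) =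
      (TensorProduct.map
        (LinearMap.mulRight k (SkewMonoidAlgebra.single h (1 : R)) ∘ₗ smashMk k K R)
        (SkewMonoidAlgebra.lsingle k h) ∘ₗ
      (TensorProduct.assoc k R (MonoidAlgebra k K) R).symm.toLinearMap ∘ₗ
      (YDAlgebra.coaction : R →ₐ[k] MonoidAlgebra k K ⊗[k] R).toLinearMap.lTensor R ∘ₗ
      (BraidedTensor.equiv k K R).symm.toLinearMap ∘ₗ Δ) r := by
    change (Finsupp.lsum k _) (Finsupp.single h r) = _
    rw [Finsupp.lsum_single]
  rw [e]
  simp only [LinearMap.comp_apply]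
  generalize Δ r = z
  refine BraidedTensor.induction_equiv (p := fun z => TensorProduct.map
        (LinearMap.mulRight k (SkewMonoidAlgebra.single h (1 : R)) ∘ₗ smashMk k K R)
        (SkewMonoidAlgebra.lsingle k h)
      ((TensorProduct.assoc k R (MonoidAlgebra k K) R).symm.toLinearMap
      ((YDAlgebra.coaction : R →ₐ[k] MonoidAlgebra k K ⊗[k] R).toLinearMap.lTensor R
      ((BraidedTensor.equiv k K R).symm.toLinearMap z))) = bosonHom k K R z *
      (SkewMonoidAlgebra.single h (1 : R) ⊗ₜ SkewMonoidAlgebra.single h (1 : R))) ?_ ?_ ?_ z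
  · intro g a b hb
    rw [bosonHom_equiv hb]
    unfold IsHomogeneousYD at hb
    simp only [LinearEquiv.coe_coe, LinearEquiv.symm_apply_apply, LinearMap.lTensor_tmul,
      AlgHom.toLinearMap_apply, hb, TensorProduct.assoc_symm_tmul, TensorProduct.map_tmul,
      LinearMap.comp_apply, smashMk_tmul_of, SkewMonoidAlgebra.lsingle_apply,
      LinearMap.mulRight_apply, Algebra.TensorProduct.tmul_mul_tmul,
      SkewMonoidAlgebra.single_mul_single, smul_one, mul_one, one_mul]
  · simp
  · intro x y hx hy
    simp only [map_add, add_mul, hx, hy]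

set_option linter.unusedSectionVars false in
lemma bosonCounit_single (ε : R →ₗ[k] k) (h : K) (r : R) :
    bosonCounit (K := K) ε (SkewMonoidAlgebra.single h r) = ε r := by
  change (Finsupp.lsum k _) (Finsupp.single h r) = _
  rw [Finsupp.lsum_single]

end Boson

namespace QLSDatum

variable {k G : Type*} [Field k] [Group G] {θ : ℕ} (D : QLSDatum k G θ)

lemma comul_single_aux (s : G) (v : D.Nichols) :
    CoalgebraStruct.comul (R := k) (D.smashSingle s v) =
      (bosonHom k G D.Nichols (D.nicholsComulG v) : D.NicholsSmash ⊗[k] D.NicholsSmash) *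
        (D.grp s ⊗ₜ D.grp s) :=
  bosonComul_single (K := G) (R := D.Nichols) D.nicholsComulG.toLinearMap s v

lemma counit_single (s : G) (v : D.Nichols) :
    CoalgebraStruct.counit (R := k) (D.smashSingle s v) = D.nicholsCounit v :=
  bosonCounit_single (K := G) (R := D.Nichols) D.nicholsCounit.toLinearMap s v

/-- The algebra map `v ↦ Δ(v # 1)`. -/
def comulNichols : D.Nichols →ₐ[k] D.NicholsSmash ⊗[k] D.NicholsSmash :=
  (bosonHom k G D.Nichols :
    BraidedTensor k G D.Nichols →ₐ[k] D.NicholsSmash ⊗[k] D.NicholsSmash).comp D.nicholsComulG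

lemma nicholsComulG_x (i : Fin θ) : D.nicholsComulG (D.x i) =
    BraidedTensor.equiv k G _ (D.x i ⊗ₜ 1 + 1 ⊗ₜ D.x i) := by
  delta nicholsComulG nicholsComulAux
  exact nicholsLift_x _ _ _ _ _

lemma nicholsComul_x (i : Fin θ) : D.nicholsComul (D.x i) =
    BraidedTensor.equiv k D.Γ _ (D.x i ⊗ₜ 1 + 1 ⊗ₜ D.x i) := by
  delta nicholsComul nicholsComulAux
  exact nicholsLift_x _ _ _ _ _

lemma comulNichols_x (i : Fin θ) :
    D.comulNichols (D.x i) = D.gen i ⊗ₜ 1 + D.grp (D.g i) ⊗ₜ D.gen i := by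
  have h1 := bosonHom_equiv (k := k) (K := G) (R := D.Nichols) IsHomogeneousYD.one (D.x i)
  have h2 := bosonHom_equiv (k := k) (K := G) (R := D.Nichols)
    (g := D.g i) (b := D.x i) (D.nicholsCoaction_x D.g D.g_central i) 1
  have h3 := congrArg₂ (· + ·) h1 h2
  have h4 : D.comulNichols (D.x i) = bosonHom k G D.Nichols
      (BraidedTensor.equiv k G D.Nichols (D.x i ⊗ₜ 1 + 1 ⊗ₜ D.x i)) := by
    rw [← nicholsComulG_x]; rfl
  rw [map_add, map_add] at h4
  refine (h4.trans h3).trans ?_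
  rw [← smashSingle_one_right]
  rfl

/-- The diagonal map `s ↦ s ⊗ s`. -/
def grpDiag : G →* D.NicholsSmash ⊗[k] D.NicholsSmash where
  toFun s := D.grp s ⊗ₜ D.grp s
  map_one' := by simp [Algebra.TensorProduct.one_def]
  map_mul' s t := by simp

lemma grpDiag_apply (s : G) : D.grpDiag s = D.grp s ⊗ₜ D.grp s := rfl

/-- The comultiplication of the bosonization as an algebra map. -/
def comulHom : D.NicholsSmash →ₐ[k] D.NicholsSmash ⊗[k] D.NicholsSmash :=
  D.smashLift D.comulNichols D.grpDiag
    (by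
      intro s i
      have hc : D.grp s * D.grp (D.g i) = D.grp (D.g i) * D.grp s := by
        rw [← map_mul, ← map_mul, D.g_central]
      simp [grpDiag_apply, comulNichols_x, mul_add, add_mul, grp_mul_gen, hc,
        TensorProduct.smul_tmul',
        TensorProduct.tmul_smul])

lemma comulHom_apply (a : D.NicholsSmash) :
    CoalgebraStruct.comul (R := k) a = D.comulHom a := by
  induction a using D.smash_induction_single with
  | zero => simp
  | add a b ha hb => rw [map_add, map_add, ha, hb]
  | single s v => rw [comul_single_aux, comulHom, smashLift_single]; rfl

/-- The counit of the bosonization as an algebra map. -/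
def counitHom : D.NicholsSmash →ₐ[k] k :=
  D.smashLift D.nicholsCounit 1 (by simp [nicholsCounit])

lemma counitHom_apply (a : D.NicholsSmash) :
    CoalgebraStruct.counit (R := k) a = D.counitHom a := by
  induction a using D.smash_induction_single with
  | zero => simp
  | add a b ha hb => rw [map_add, map_add, ha, hb]
  | single s v => rw [counit_single, counitHom, smashLift_single]; simp

lemma comulHom_gen (i : Fin θ) :
    D.comulHom (D.gen i) = D.gen i ⊗ₜ 1 + D.grp (D.g i) ⊗ₜ D.gen i := by
  rw [comulHom, smashLift_gen, comulNichols_x]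

lemma comulHom_grp (s : G) : D.comulHom (D.grp s) = D.grp s ⊗ₜ D.grp s := by
  rw [comulHom, smashLift_grp]; rfl

lemma counitHom_gen (i : Fin θ) : D.counitHom (D.gen i) = 0 := by
  rw [counitHom, smashLift_gen, nicholsCounit, nicholsLift_x]

lemma counitHom_grp (s : G) : D.counitHom (D.grp s) = 1 := by
  rw [counitHom, smashLift_grp]; rfl

instance : Coalgebra k D.NicholsSmash where
  coassoc := by
    have : (Algebra.TensorProduct.assoc k k k D.NicholsSmash D.NicholsSmash
        D.NicholsSmash).toAlgHom.comp ((Algebra.TensorProduct.map D.comulHom (.id k _)).comp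
        D.comulHom) = (Algebra.TensorProduct.map (.id k _) D.comulHom).comp D.comulHom := by
      refine smash_algHom_ext (fun i => ?_) (fun s => ?_)
      · simp [comulHom_gen, comulHom_grp, TensorProduct.add_tmul, TensorProduct.tmul_add,
          Algebra.TensorProduct.one_def, add_assoc]
      · simp [comulHom_grp]
    have e : (CoalgebraStruct.comul : D.NicholsSmash →ₗ[k] _) = D.comulHom.toLinearMap :=
      LinearMap.ext D.comulHom_apply
    rw [e]
    exact congrArg AlgHom.toLinearMap this
  rTensor_counit_comp_comul := by
    have : (Algebra.TensorProduct.map D.counitHom (.id k _)).comp D.comulHom =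
        (Algebra.TensorProduct.lid k D.NicholsSmash).symm.toAlgHom := by
      refine smash_algHom_ext (fun i => ?_) (fun s => ?_)
      · simp [comulHom_gen, counitHom_gen, counitHom_grp]
      · simp [comulHom_grp, counitHom_grp]
    have e : (CoalgebraStruct.comul : D.NicholsSmash →ₗ[k] _) = D.comulHom.toLinearMap :=
      LinearMap.ext D.comulHom_apply
    have e' : (CoalgebraStruct.counit : D.NicholsSmash →ₗ[k] _) = D.counitHom.toLinearMap :=
      LinearMap.ext D.counitHom_apply
    rw [e, e']
    exact congrArg AlgHom.toLinearMap this
  lTensor_counit_comp_comul := by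
    have : (Algebra.TensorProduct.map (.id k _) D.counitHom).comp D.comulHom =
        (Algebra.TensorProduct.rid k k D.NicholsSmash).symm.toAlgHom := by
      refine smash_algHom_ext (fun i => ?_) (fun s => ?_)
      · simp [comulHom_gen, counitHom_gen]
      · simp [comulHom_grp, counitHom_grp]
    have e : (CoalgebraStruct.comul : D.NicholsSmash →ₗ[k] _) = D.comulHom.toLinearMap :=
      LinearMap.ext D.comulHom_apply
    have e' : (CoalgebraStruct.counit : D.NicholsSmash →ₗ[k] _) = D.counitHom.toLinearMap :=
      LinearMap.ext D.counitHom_apply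
    rw [e, e']
    exact congrArg AlgHom.toLinearMap this

instance : Bialgebra k D.NicholsSmash :=
  Bialgebra.mk' k D.NicholsSmash
    (by rw [counitHom_apply, map_one])
    (by intro a b; rw [counitHom_apply, map_mul, ← counitHom_apply, ← counitHom_apply])
    (by rw [comulHom_apply, map_one])
    (by intro a b; rw [comulHom_apply, map_mul, ← comulHom_apply, ← comulHom_apply])

@[simp] lemma comul_gen (i : Fin θ) : Coalgebra.comul (R := k) (D.gen i) =
    D.gen i ⊗ₜ 1 + D.grp (D.g i) ⊗ₜ D.gen i :=
  (D.comulHom_apply _).trans (D.comulHom_gen i)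

@[simp] lemma comul_grp (s : G) : Coalgebra.comul (R := k) (D.grp s) = D.grp s ⊗ₜ D.grp s :=
  (D.comulHom_apply _).trans (D.comulHom_grp s)

@[simp] lemma counit_gen (i : Fin θ) : Coalgebra.counit (R := k) (D.gen i) = 0 :=
  (D.counitHom_apply _).trans (D.counitHom_gen i)

@[simp] lemma counit_grp (s : G) : Coalgebra.counit (R := k) (D.grp s) = 1 :=
  (D.counitHom_apply _).trans (D.counitHom_grp s)

end QLSDatum

/-! ### Exponentials of nilpotent elements -/

section NilExp

variable (k : Type*) [Field k] [CharZero k] {A B : Type*} [Ring A] [Algebra k A] [Ring B]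
  [Algebra k B]

/-- The exponential of a nilpotent element of an algebra over a field of characteristic zero. -/
def nilExp (a : A) : A :=
  letI : Module ℚ A := Module.compHom A (algebraMap ℚ k)
  IsNilpotent.exp a

lemma nilExp_eq_sum {a : A} {n : ℕ} (h : a ^ n = 0) :
    nilExp k a = ∑ i ∈ Finset.range n, (i.factorial : k)⁻¹ • a ^ i := by
  let _ : Module ℚ A := Module.compHom A (algebraMap ℚ k)
  change IsNilpotent.exp a = _
  rw [IsNilpotent.exp_eq_sum h]
  refine Finset.sum_congr rfl fun i _ => ?_
  change (algebraMap ℚ k (i.factorial : ℚ)⁻¹) • a ^ i = _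
  rw [map_inv₀, map_natCast]

lemma nilExp_add {a b : A} (h : Commute a b) (ha : IsNilpotent a) (hb : IsNilpotent b) :
    nilExp k (a + b) = nilExp k a * nilExp k b :=
  letI : Module ℚ A := Module.compHom A (algebraMap ℚ k)
  IsNilpotent.exp_add_of_commute h ha hb

@[simp] lemma nilExp_zero : nilExp k (0 : A) = 1 :=
  letI : Module ℚ A := Module.compHom A (algebraMap ℚ k)
  IsNilpotent.exp_zero

lemma nilExp_mul_nilExp_neg {a : A} (ha : IsNilpotent a) : nilExp k a * nilExp k (-a) = 1 :=
  letI : Module ℚ A := Module.compHom A (algebraMap ℚ k)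
  IsNilpotent.exp_mul_exp_neg_self ha

lemma nilExp_neg_mul_nilExp {a : A} (ha : IsNilpotent a) : nilExp k (-a) * nilExp k a = 1 :=
  letI : Module ℚ A := Module.compHom A (algebraMap ℚ k)
  IsNilpotent.exp_neg_mul_exp_self ha

lemma map_nilExp (f : A →ₐ[k] B) {a : A} (ha : IsNilpotent a) :
    f (nilExp k a) = nilExp k (f a) :=
  letI : Module ℚ A := Module.compHom A (algebraMap ℚ k)
  letI : Module ℚ B := Module.compHom B (algebraMap ℚ k)
  IsNilpotent.map_exp ha f

lemma nilExp_of_mul_self {a : A} (h : a * a = 0) : nilExp k a = 1 + a := by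
  rw [nilExp_eq_sum k (n := 2) (by rw [pow_two, h])]
  simp [Finset.sum_range_succ]

lemma commute_nilExp {c a : A} (h : Commute c a) (ha : IsNilpotent a) :
    Commute c (nilExp k a) := by
  obtain ⟨n, hn⟩ := ha
  rw [nilExp_eq_sum k hn]
  exact Commute.sum_right _ _ _ fun i _ => (h.pow_right i).smul_right _

/-- The exponential of a nilpotent element as a unit. -/
def nilExpUnit {a : A} (ha : IsNilpotent a) : Aˣ where
  val := nilExp k a
  inv := nilExp k (-a)
  val_inv := nilExp_mul_nilExp_neg k ha
  inv_val := nilExp_neg_mul_nilExp k ha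

@[simp] lemma coe_nilExpUnit {a : A} (ha : IsNilpotent a) :
    (nilExpUnit k ha : A) = nilExp k a := rfl

/-- If `f(a w) = g(w)` and `g(a w) = 0` for all `w`, then only the constant and the linear term of
the exponential of `a` contribute to `f (exp(a) w)`. -/
lemma map_nilExp_mul {M : Type*} [AddCommGroup M] [Module k M] {f g : A →ₗ[k] M} {a : A}
    (ha : IsNilpotent a) (hf : ∀ w, f (a * w) = g w) (hg : ∀ w, g (a * w) = 0) (w : A) :
    f (nilExp k a * w) = f w + g w := by
  obtain ⟨n, hn⟩ := ha
  rw [nilExp_eq_sum k (n := n + 2) (by rw [pow_add, hn, zero_mul]), Finset.sum_range_succ',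
    Finset.sum_range_succ']
  have h0 : ∀ i, f (a ^ (i + 2) * w) = 0 := fun i => by
    rw [pow_succ', mul_assoc, hf, pow_succ', mul_assoc, hg]
  simp only [add_assoc, one_add_one_eq_two, Nat.reduceAdd] at *
  simp [add_mul, Finset.sum_mul, h0, hf, add_comm (f w)]

end NilExp

/-! ### Twisting bialgebras -/

section Twist

variable {k : Type*} [Field k] {H : Type*} [Ring H] [Bialgebra k H]

open Coalgebra Bialgebra

/-- Conjugation `z ↦ u⁻¹ z u` by a unit. -/
def conjUnit {B : Type*} [Ring B] [Algebra k B] (u : Bˣ) : B →ₐ[k] B :=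
  AlgHom.ofLinearMap (LinearMap.mulLeft k (u⁻¹ : Bˣ).val ∘ₗ LinearMap.mulRight k u.val)
    (by simp) (by intro x y; simp [mul_assoc])

@[simp] lemma conjUnit_apply {B : Type*} [Ring B] [Algebra k B] (u : Bˣ) (z : B) :
    conjUnit (k := k) u z = (u⁻¹ : Bˣ).val * z * u := by
  simp [conjUnit, mul_assoc]

variable (k) in
/-- The algebra map `Δ ⊗ id`. -/
def comulLeft : H ⊗[k] H →ₐ[k] (H ⊗[k] H) ⊗[k] H :=
  Algebra.TensorProduct.map (comulAlgHom k H) (.id k H)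

variable (k) in
/-- The algebra map `id ⊗ Δ`. -/
def comulRight : H ⊗[k] H →ₐ[k] H ⊗[k] (H ⊗[k] H) :=
  Algebra.TensorProduct.map (.id k H) (comulAlgHom k H)

variable (k H) in
/-- The associativity isomorphism of the threefold tensor product of `H`. -/
abbrev tensorAssoc : (H ⊗[k] H) ⊗[k] H ≃ₐ[k] H ⊗[k] (H ⊗[k] H) :=
  Algebra.TensorProduct.assoc k k k H H H

@[simp] lemma comulLeft_tmul (a b : H) : comulLeft k (a ⊗ₜ[k] b) = comul (R := k) a ⊗ₜ b := rfl

@[simp] lemma comulRight_tmul (a b : H) : comulRight k (a ⊗ₜ[k] b) = a ⊗ₜ comul (R := k) b := rfl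

/-- `J` is a (Drinfeld) twist:
`(Δ ⊗ id)(J) (J ⊗ 1) = (id ⊗ Δ)(J) (1 ⊗ J)` and `(ε ⊗ id)(J) = 1 = (id ⊗ ε)(J)`. -/
structure IsTwist (J : (H ⊗[k] H)ˣ) : Prop where
  cocycle : tensorAssoc k H (comulLeft k J.val * (J.val ⊗ₜ 1)) =
    comulRight k J.val * (1 ⊗ₜ J.val)
  counit_left : Algebra.TensorProduct.map (counitAlgHom k H) (.id k H) J.val = 1
  counit_right : Algebra.TensorProduct.map (.id k H) (counitAlgHom k H) J.val = 1

/-- The twisted comultiplication `h ↦ J⁻¹ Δ(h) J`. -/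
def twistComul (J : (H ⊗[k] H)ˣ) : H →ₐ[k] H ⊗[k] H := (conjUnit J).comp (comulAlgHom k H)

lemma twistComul_apply (J : (H ⊗[k] H)ˣ) (h : H) :
    twistComul J h = (J⁻¹ : (H ⊗[k] H)ˣ).val * comul (R := k) h * J := by
  simp [twistComul]

lemma map_twistComul_id (J : (H ⊗[k] H)ˣ) (z : H ⊗[k] H) :
    Algebra.TensorProduct.map (twistComul J) (.id k H) z =
      ((J⁻¹ : (H ⊗[k] H)ˣ).val ⊗ₜ 1) * comulLeft k z * (J.val ⊗ₜ 1) := by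
  induction z with
  | zero => simp
  | add x y hx hy => simp only [map_add, mul_add, add_mul, hx, hy]
  | tmul a b => simp [twistComul_apply]

lemma map_id_twistComul (J : (H ⊗[k] H)ˣ) (z : H ⊗[k] H) :
    Algebra.TensorProduct.map (.id k H) (twistComul J) z =
      (1 ⊗ₜ (J⁻¹ : (H ⊗[k] H)ˣ).val) * comulRight k z * (1 ⊗ₜ J.val) := by
  induction z with
  | zero => simp
  | add x y hx hy => simp only [map_add, mul_add, add_mul, hx, hy]
  | tmul a b => simp [twistComul_apply]

lemma tensorAssoc_comulLeft_comul (h : H) :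
    tensorAssoc k H (comulLeft k (comul (R := k) h)) = comulRight k (comul (R := k) h) :=
  Coalgebra.coassoc_apply h

lemma IsTwist.coassoc {J : (H ⊗[k] H)ˣ} (hJ : IsTwist J) (h : H) :
    tensorAssoc k H (Algebra.TensorProduct.map (twistComul J) (.id k H) (twistComul J h)) =
      Algebra.TensorProduct.map (.id k H) (twistComul J) (twistComul J h) := by
  -- Both sides are conjugates of `Δ²(h)`, by the two sides of the cocycle identity.
  have hc := hJ.cocycle
  set P : (H ⊗[k] (H ⊗[k] H)) := comulRight k J.val * (1 ⊗ₜ J.val) with hP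
  set P' : (H ⊗[k] (H ⊗[k] H)) := (1 ⊗ₜ (J⁻¹ : (H ⊗[k] H)ˣ).val) *
    comulRight k (J⁻¹ : (H ⊗[k] H)ˣ).val with hP'
  set Q' : (H ⊗[k] (H ⊗[k] H)) := tensorAssoc k H (((J⁻¹ : (H ⊗[k] H)ˣ).val ⊗ₜ 1) *
    comulLeft k (J⁻¹ : (H ⊗[k] H)ˣ).val) with hQ'
  have e1 : comulRight k (H := H) (J⁻¹ : (H ⊗[k] H)ˣ).val * comulRight k J.val = 1 := by
    rw [← map_mul, Units.inv_mul, map_one]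
  have e1' : comulRight k (H := H) J.val * comulRight k (J⁻¹ : (H ⊗[k] H)ˣ).val = 1 := by
    rw [← map_mul, Units.mul_inv, map_one]
  have e2 : comulLeft k (H := H) (J⁻¹ : (H ⊗[k] H)ˣ).val * comulLeft k J.val = 1 := by
    rw [← map_mul, Units.inv_mul, map_one]
  have hPP' : P * P' = 1 := by
    rw [hP, hP', mul_assoc, ← mul_assoc (1 ⊗ₜ[k] J.val), Algebra.TensorProduct.tmul_mul_tmul,
      Units.mul_inv, one_mul, ← Algebra.TensorProduct.one_def, one_mul, e1']
  have hQP : Q' * P = 1 := by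
    rw [hQ', ← hc, ← map_mul, mul_assoc, ← mul_assoc (comulLeft k _) (comulLeft k _), e2, one_mul,
      Algebra.TensorProduct.tmul_mul_tmul, Units.inv_mul, one_mul,
      ← Algebra.TensorProduct.one_def, map_one]
  have hQP' : Q' = P' := left_inv_eq_right_inv hQP hPP'
  rw [map_twistComul_id, map_id_twistComul, twistComul_apply, map_mul (comulLeft k),
    map_mul (comulLeft k), map_mul (comulRight k), map_mul (comulRight k)]
  have h1 : (J⁻¹ : (H ⊗[k] H)ˣ).val ⊗ₜ[k] (1 : H) * (comulLeft k (J⁻¹ : (H ⊗[k] H)ˣ).val *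
      comulLeft k (comul (R := k) h) * comulLeft k J.val) * J.val ⊗ₜ[k] (1 : H) =
      ((J⁻¹ : (H ⊗[k] H)ˣ).val ⊗ₜ[k] (1 : H) * comulLeft k (J⁻¹ : (H ⊗[k] H)ˣ).val) *
      comulLeft k (comul (R := k) h) * (comulLeft k J.val * J.val ⊗ₜ[k] (1 : H)) := by
    simp only [mul_assoc]
  rw [h1, map_mul (tensorAssoc k H), map_mul (tensorAssoc k H), hc, ← hQ', hQP', hP',
    tensorAssoc_comulLeft_comul, hP]
  simp only [mul_assoc]

/-- The bialgebra with algebra `A`, identified with `H` by `e`, and with comultiplication twisted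
by `J`. -/
abbrev twistBialgebra {A : Type*} [Ring A] [Algebra k A] (e : A ≃ₐ[k] H) {J : (H ⊗[k] H)ˣ}
    (hJ : IsTwist J) : Bialgebra k A :=
  Bialgebra.ofAlgHom
    ((Algebra.TensorProduct.map e.symm.toAlgHom e.symm.toAlgHom).comp
      ((twistComul J).comp e.toAlgHom))
    ((counitAlgHom k H).comp e.toAlgHom)
    (by
      ext a
      have h1 : ∀ z : H ⊗[k] H, Algebra.TensorProduct.assoc k k k A A A
          (Algebra.TensorProduct.map ((Algebra.TensorProduct.map e.symm.toAlgHom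
            e.symm.toAlgHom).comp ((twistComul J).comp e.toAlgHom)) (.id k A)
          (Algebra.TensorProduct.map e.symm.toAlgHom e.symm.toAlgHom z)) =
          Algebra.TensorProduct.map e.symm.toAlgHom
            (Algebra.TensorProduct.map e.symm.toAlgHom e.symm.toAlgHom)
            (tensorAssoc k H (Algebra.TensorProduct.map (twistComul J) (.id k H) z)) := by
        intro z
        induction z with
        | zero => simp
        | add x y hx hy => simp only [map_add, hx, hy]
        | tmul a b =>
          simp only [Algebra.TensorProduct.map_tmul, AlgHom.comp_apply, AlgHom.id_apply]
          have : e.toAlgHom (e.symm.toAlgHom a) = a := e.apply_symm_apply a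
          rw [this]
          generalize twistComul J a = y
          induction y with
          | zero => simp
          | add x y hx hy => simp only [map_add, TensorProduct.add_tmul, hx, hy]
          | tmul c d => simp
      have h2 : ∀ z : H ⊗[k] H, (Algebra.TensorProduct.map (.id k A)
          ((Algebra.TensorProduct.map e.symm.toAlgHom
            e.symm.toAlgHom).comp ((twistComul J).comp e.toAlgHom))
          (Algebra.TensorProduct.map e.symm.toAlgHom e.symm.toAlgHom z)) =
          Algebra.TensorProduct.map e.symm.toAlgHom
            (Algebra.TensorProduct.map e.symm.toAlgHom e.symm.toAlgHom)
            (Algebra.TensorProduct.map (.id k H) (twistComul J) z) := by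
        intro z
        induction z with
        | zero => simp
        | add x y hx hy => simp only [map_add, hx, hy]
        | tmul a b =>
          simp only [Algebra.TensorProduct.map_tmul, AlgHom.comp_apply, AlgHom.id_apply]
          have : e.toAlgHom (e.symm.toAlgHom b) = b := e.apply_symm_apply b
          rw [this]
      exact (h1 _).trans ((congrArg _ (hJ.coassoc (e a))).trans (h2 _).symm))
    (by
      ext a
      have h1 : ∀ z : H ⊗[k] H, Algebra.TensorProduct.map ((counitAlgHom k H).comp e.toAlgHom)
          (.id k A) (Algebra.TensorProduct.map e.symm.toAlgHom e.symm.toAlgHom z) =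
          Algebra.TensorProduct.map (.id k k) e.symm.toAlgHom
            (Algebra.TensorProduct.map (counitAlgHom k H) (.id k H) z) := by
        intro z
        induction z with
        | zero => simp
        | add x y hx hy => simp only [map_add, hx, hy]
        | tmul a b => simp
      refine (h1 _).trans ?_
      have h3 : Algebra.TensorProduct.map (counitAlgHom k H) (.id k H) (J⁻¹ : (H ⊗[k] H)ˣ).val =
          1 := by
        have := congrArg (Algebra.TensorProduct.map (counitAlgHom k H) (.id k H)) J.inv_mul
        rwa [map_mul, hJ.counit_left, mul_one, map_one] at this
      have h4 : Algebra.TensorProduct.map (counitAlgHom k H) (.id k H) (comul (R := k) (e a)) =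
        1 ⊗ₜ e a := Coalgebra.rTensor_counit_comul (e a)
      have h5 : Algebra.TensorProduct.map (counitAlgHom k H) (.id k H) (twistComul J (e a)) =
          1 ⊗ₜ e a := by
        rw [twistComul_apply, map_mul, map_mul, h3, h4, hJ.counit_left, one_mul, mul_one]
      exact (congrArg _ h5).trans (by simp))
    (by
      ext a
      have h1 : ∀ z : H ⊗[k] H, Algebra.TensorProduct.map (.id k A)
          ((counitAlgHom k H).comp e.toAlgHom)
          (Algebra.TensorProduct.map e.symm.toAlgHom e.symm.toAlgHom z) =
          Algebra.TensorProduct.map e.symm.toAlgHom (.id k k)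
            (Algebra.TensorProduct.map (.id k H) (counitAlgHom k H) z) := by
        intro z
        induction z with
        | zero => simp
        | add x y hx hy => simp only [map_add, hx, hy]
        | tmul a b => simp
      refine (h1 _).trans ?_
      have h3 : Algebra.TensorProduct.map (.id k H) (counitAlgHom k H) (J⁻¹ : (H ⊗[k] H)ˣ).val =
          1 := by
        have := congrArg (Algebra.TensorProduct.map (.id k H) (counitAlgHom k H)) J.inv_mul
        rwa [map_mul, hJ.counit_right, mul_one, map_one] at this
      have h4 : Algebra.TensorProduct.map (.id k H) (counitAlgHom k H) (comul (R := k) (e a)) =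
        e a ⊗ₜ 1 := Coalgebra.lTensor_counit_comul (e a)
      have h5 : Algebra.TensorProduct.map (.id k H) (counitAlgHom k H) (twistComul J (e a)) =
          e a ⊗ₜ 1 := by
        rw [twistComul_apply, map_mul, map_mul, h3, h4, hJ.counit_right, one_mul, mul_one]
      exact (congrArg _ h5).trans (by simp))

end Twist

/-! ### Existence of antipodes -/

section Antipode

variable {k : Type*} [Field k] {A : Type*} [Ring A] [Bialgebra k A]

open Coalgebra Bialgebra WithConv

/-- The convolution product of maps with values in `P` and in `Q` has values in `P * Q`. -/
lemma convMul_mem_mul {P Q : Submodule k A} {f g : WithConv (A →ₗ[k] A)}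
    (hf : ∀ a, f a ∈ P) (hg : ∀ a, g a ∈ Q) (a : A) : (f * g) a ∈ P * Q := by
  rw [LinearMap.convMul_apply]
  generalize comul (R := k) a = z
  induction z with
  | zero => simp
  | add x y hx hy => rw [map_add, map_add]; exact Submodule.add_mem _ hx hy
  | tmul a b => simpa using Submodule.mul_mem_mul (hf a) (hg b)

/-- A map whose values lie in a nilpotent subspace is nilpotent under convolution. -/
lemma isNilpotent_of_forall_mem {P : Submodule k A} (hP : IsNilpotent P)
    {f : WithConv (A →ₗ[k] A)} (hf : ∀ a, f a ∈ P) : IsNilpotent f := by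
  obtain ⟨n, hn⟩ := hP
  have hpow : ∀ n a, (f ^ (n + 1)) a ∈ P ^ (n + 1) := by
    intro n
    induction n with
    | zero => simpa using hf
    | succ n ih =>
      intro a
      rw [pow_succ f, pow_succ P]
      exact convMul_mem_mul ih hf a
  refine ⟨n + 1, ?_⟩
  ext a
  have := hpow n a
  rw [pow_succ, hn, zero_mul] at this
  exact this

/-- A bialgebra has an antipode if it maps onto a Hopf algebra with a nilpotent kernel. -/
lemma isHopfAlgebra_of_isNilpotent_ker {B : Type*} [Ring B] [HopfAlgebra k B] (p : A →ₐc[k] B)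
    (hp : Function.Surjective p) (hker : IsNilpotent (LinearMap.ker (p : A →ₗ[k] B))) :
    IsHopfAlgebra k A := by
  obtain ⟨ι, hι⟩ := (p : A →ₗ[k] B).exists_rightInverse_of_surjective
    (LinearMap.range_eq_top.mpr hp)
  -- a linear lift of the antipode of `B`
  let σ : A →ₗ[k] A := ι ∘ₗ HopfAlgebra.antipode k ∘ₗ (p : A →ₗ[k] B)
  have hσ : ∀ a, p (σ a) = HopfAlgebra.antipode k (p a) := fun a =>
    LinearMap.congr_fun hι (HopfAlgebra.antipode k (p a))
  let id' : WithConv (A →ₗ[k] A) := toConv LinearMap.id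
  let s : WithConv (A →ₗ[k] A) := toConv σ
  have h1 : ∀ a, (s * id' - 1) a ∈ LinearMap.ker (p : A →ₗ[k] B) := by
    intro a
    have h2 : ∀ z : A ⊗[k] A, p (LinearMap.mul' k A (TensorProduct.map σ LinearMap.id z)) =
        LinearMap.mul' k B ((HopfAlgebra.antipode k).rTensor B
          (TensorProduct.map (p : A →ₗ[k] B) (p : A →ₗ[k] B) z)) := by
      intro z
      induction z with
      | zero => simp
      | add x y hx hy => simp only [map_add, hx, hy]
      | tmul a b => simp [hσ]
    have h3 : p ((s * id') a) = algebraMap k B (counit (R := k) a) := by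
      rw [LinearMap.convMul_apply]
      refine (h2 _).trans ?_
      have := CoalgHomClass.map_comp_comul_apply p a
      rw [this, HopfAlgebra.mul_antipode_rTensor_comul_apply, CoalgHomClass.counit_comp_apply]
    have h4 : (s * id' - 1) a = (s * id') a - algebraMap k A (counit (R := k) a) := rfl
    rw [LinearMap.mem_ker, h4, map_sub]
    change p _ - p _ = 0
    rw [h3, AlgHomClass.commutes, sub_self]
  have h1' : ∀ a, (id' * s - 1) a ∈ LinearMap.ker (p : A →ₗ[k] B) := by
    intro a
    have h2 : ∀ z : A ⊗[k] A, p (LinearMap.mul' k A (TensorProduct.map LinearMap.id σ z)) =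
        LinearMap.mul' k B ((HopfAlgebra.antipode k).lTensor B
          (TensorProduct.map (p : A →ₗ[k] B) (p : A →ₗ[k] B) z)) := by
      intro z
      induction z with
      | zero => simp
      | add x y hx hy => simp only [map_add, hx, hy]
      | tmul a b => simp [hσ]
    have h3 : p ((id' * s) a) = algebraMap k B (counit (R := k) a) := by
      rw [LinearMap.convMul_apply]
      refine (h2 _).trans ?_
      have := CoalgHomClass.map_comp_comul_apply p a
      rw [this, HopfAlgebra.mul_antipode_lTensor_comul_apply, CoalgHomClass.counit_comp_apply]
    have h4 : (id' * s - 1) a = (id' * s) a - algebraMap k A (counit (R := k) a) := rfl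
    rw [LinearMap.mem_ker, h4, map_sub]
    change p _ - p _ = 0
    rw [h3, AlgHomClass.commutes, sub_self]
  have hu : IsUnit (s * id') := by
    have := (isNilpotent_of_forall_mem hker h1).isUnit_add_one
    rwa [sub_add_cancel] at this
  have hu' : IsUnit (id' * s) := by
    have := (isNilpotent_of_forall_mem hker h1').isUnit_add_one
    rwa [sub_add_cancel] at this
  obtain ⟨u, hu⟩ := hu
  obtain ⟨v, hv⟩ := hu'
  have hl : (u⁻¹).val * s * id' = 1 := by rw [mul_assoc, ← hu, Units.inv_mul]
  have hr : id' * (s * (v⁻¹).val) = 1 := by rw [← mul_assoc, ← hv, Units.mul_inv]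
  have hlr := left_inv_eq_right_inv hl hr
  refine ⟨Bialgebra.counit_one, Bialgebra.counit_mul, Bialgebra.comul_one, Bialgebra.comul_mul,
    ((u⁻¹).val * s).ofConv, ?_, ?_⟩
  · exact congrArg WithConv.ofConv hl
  · rw [hlr]
    exact congrArg WithConv.ofConv hr

end Antipode

/-! ### Pointed coalgebras -/

section Pointed

variable {k : Type*} [Field k] {C : Type*} [AddCommGroup C] [Module k C] [Coalgebra k C]

open Coalgebra WithConv

lemma IsSubcoalgebra.map {C' : Type*} [AddCommGroup C'] [Module k C'] [Coalgebra k C']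
    {D : Submodule k C} (hD : IsSubcoalgebra k C D) (f : C →ₗc[k] C') :
    IsSubcoalgebra k C' (D.map (f : C →ₗ[k] C')) := by
  rintro _ ⟨x, hx, rfl⟩
  obtain ⟨z, hz⟩ := hD x hx
  have h1 : comul (R := k) ((f : C →ₗ[k] C') x) = TensorProduct.map (f : C →ₗ[k] C')
    (f : C →ₗ[k] C') (comul (R := k) x) := (CoalgHomClass.map_comp_comul_apply f x).symm
  have h2 : ∀ z : D ⊗[k] D, TensorProduct.map (f : C →ₗ[k] C') (f : C →ₗ[k] C')
      (TensorProduct.map D.subtype D.subtype z) =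
      TensorProduct.map (D.map (f : C →ₗ[k] C')).subtype (D.map (f : C →ₗ[k] C')).subtype
        (TensorProduct.map ((f : C →ₗ[k] C').submoduleMap D)
          ((f : C →ₗ[k] C').submoduleMap D) z) := by
    intro z
    induction z with
    | zero => simp
    | add x y hx hy => simp only [map_add, hx, hy]
    | tmul a b => rfl
  exact ⟨_, (h2 z).symm.trans ((congrArg _ hz).trans h1.symm)⟩

/-- Pointedness is invariant under isomorphism. -/
lemma IsPointed.of_equiv {C' : Type*} [AddCommGroup C'] [Module k C'] [Coalgebra k C']
    (h : IsPointed k C) (e : C ≃ₗc[k] C') : IsPointed k C' := by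
  intro D hD
  have hee : ∀ E : Submodule k C', (E.map (e.symm : C' →ₗ[k] C)).map (e : C →ₗ[k] C') = E := by
    intro E
    ext x
    constructor
    · rintro ⟨_, ⟨y, hy, rfl⟩, rfl⟩
      have : (e : C →ₗ[k] C') ((e.symm : C' →ₗ[k] C) y) = y := e.apply_symm_apply y
      rwa [this]
    · intro hx
      exact ⟨_, ⟨x, hx, rfl⟩, e.apply_symm_apply x⟩
  have hee' : ∀ E : Submodule k C, (E.map (e : C →ₗ[k] C')).map (e.symm : C' →ₗ[k] C) = E := by
    intro E
    ext x
    constructor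
    · rintro ⟨_, ⟨y, hy, rfl⟩, rfl⟩
      have : (e.symm : C' →ₗ[k] C) ((e : C →ₗ[k] C') y) = y := e.symm_apply_apply y
      rwa [this]
    · intro hx
      exact ⟨_, ⟨x, hx, rfl⟩, e.symm_apply_apply x⟩
  have hs : IsSimpleSubcoalgebra k C (D.map (e.symm : C' →ₗ[k] C)) := by
    refine ⟨hD.1.map (e.symm : C' →ₗc[k] C), fun h0 => hD.2.1 ?_, fun E hE hle => ?_⟩
    · rw [← hee D, h0, Submodule.map_bot]
    · rcases hD.2.2 (E.map (e : C →ₗ[k] C')) (hE.map (e : C →ₗc[k] C'))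
        (by rw [← hee D]; exact Submodule.map_mono hle) with h | h
      · left; rw [← hee' E, h, Submodule.map_bot]
      · right; rw [← hee' E, h]
  have h1 := h _ hs
  have h2 : Module.finrank k (D.map (e.symm : C' →ₗ[k] C)) = Module.finrank k D :=
    ((Submodule.equivMapOfInjective (e.symm : C' →ₗ[k] C) e.symm.injective D).finrank_eq).symm
  rwa [h2] at h1

/-- For a subcoalgebra `D`, slicing the comultiplication of an element of `D` gives elements
of `D`. -/
lemma IsSubcoalgebra.lid_rTensor_mem {D : Submodule k C} (hD : IsSubcoalgebra k C D)
    (f : C →ₗ[k] k) {d : C} (hd : d ∈ D) :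
    TensorProduct.lid k C (f.rTensor C (comul (R := k) d)) ∈ D := by
  obtain ⟨z, hz⟩ := hD d hd
  rw [← hz]
  clear hz
  induction z with
  | zero => simp
  | add x y hx hy => simp only [map_add]; exact D.add_mem hx hy
  | tmul a b => simpa using D.smul_mem _ b.2

/-- A line spanned by a group-like element is a subcoalgebra. -/
lemma IsGroupLikeElem.isSubcoalgebra_span {u : C} (hu : IsGroupLikeElem k u) :
    IsSubcoalgebra k C (Submodule.span k {u}) := by
  intro x hx
  obtain ⟨c, rfl⟩ := Submodule.mem_span_singleton.mp hx
  have hmem := Submodule.mem_span_singleton_self (R := k) u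
  refine ⟨c • (⟨u, hmem⟩ ⊗ₜ ⟨u, hmem⟩), ?_⟩
  rw [map_smul, map_smul, hu.comul_eq_tmul_self]
  rfl

/-- A coalgebra is pointed if it has an exhaustive filtration `F` with
`Δ(F (n + 1)) ⊆ F n ⊗ C + C ⊗ F 0` such that `F 0` is spanned by group-like elements. -/
lemma isPointed_of_filtration (F : ℕ → Submodule k C) (hmono : Monotone F)
    (htop : ∀ c, ∃ n, c ∈ F n)
    (hcomul : ∀ n, ∀ c ∈ F (n + 1),
      TensorProduct.map (F n).mkQ (F 0).mkQ (comul (R := k) c) = 0)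
    (hF0 : F 0 ≤ Submodule.span k {u : C | IsGroupLikeElem k u}) : IsPointed k C := by
  classical
  intro D hD
  obtain ⟨hsub, hne, hsimple⟩ := hD
  have hex : ∃ n, D ⊓ F n ≠ ⊥ := by
    obtain ⟨d, hd, hd0⟩ := Submodule.exists_mem_ne_zero_of_ne_bot hne
    obtain ⟨n, hn⟩ := htop d
    exact ⟨n, fun h => hd0 ((Submodule.mem_bot k).mp (h ▸ ⟨hd, hn⟩))⟩
  have h0 : D ⊓ F 0 ≠ ⊥ := by
    -- if `D ∩ F m = 0`, then `D ⊗ D` embeds in the quotient in which `Δ(F (m + 1))` vanishes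
    rcases hn : Nat.find hex with _ | m
    · have := Nat.find_spec hex
      rwa [hn] at this
    exfalso
    have hm : D ⊓ F m = ⊥ := by
      by_contra h
      exact Nat.find_min hex (m := m) (by omega) h
    have hm0 : D ⊓ F 0 = ⊥ := by
      rw [eq_bot_iff, ← hm]
      exact inf_le_inf_left _ (hmono (Nat.zero_le m))
    have hsp := Nat.find_spec hex
    rw [hn] at hsp
    obtain ⟨d, ⟨hdD, hdF⟩, hd0⟩ := Submodule.exists_mem_ne_zero_of_ne_bot hsp
    obtain ⟨z, hz⟩ := hsub d hdD
    have hinj : ∀ E : Submodule k C, D ⊓ E = ⊥ → Function.Injective (E.mkQ ∘ₗ D.subtype) := by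
      intro E hE
      rw [← LinearMap.ker_eq_bot, eq_bot_iff]
      rintro ⟨x, hx⟩ hx'
      have hxE : x ∈ E := by
        simpa using hx'
      have : x ∈ D ⊓ E := ⟨hx, hxE⟩
      rw [hE] at this
      simpa using this
    have h1 := hcomul m d hdF
    rw [← hz, ← LinearMap.comp_apply, ← TensorProduct.map_comp] at h1
    have h2 : z = 0 := by
      refine TensorProduct.map_injective_of_flat_flat _ _ (hinj _ hm) (hinj _ hm0) ?_
      rw [h1, map_zero]
    rw [h2, map_zero] at hz
    apply hd0
    have := Coalgebra.rTensor_counit_comul (R := k) d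
    rw [← hz, map_zero] at this
    have h3 := congrArg (TensorProduct.lid k C) this
    simpa using h3.symm
  obtain ⟨d, ⟨hdD, hdF⟩, hd0⟩ := Submodule.exists_mem_ne_zero_of_ne_bot h0
  -- expand `d` in group-like elements and isolate one of them
  have hli : LinearIndepOn k id {u : C | IsGroupLikeElem k u} := linearIndepOn_isGroupLikeElem
  have hli' : LinearIndependent k (fun u : {u : C | IsGroupLikeElem k u} => (u : C)) := hli
  have hdspan : d ∈ Submodule.span k
      (Set.range fun u : {u : C | IsGroupLikeElem k u} => (u : C)) := by
    rw [Subtype.range_coe]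
    exact hF0 hdF
  obtain ⟨c, hc⟩ := (Finsupp.mem_span_range_iff_exists_finsupp).mp hdspan
  have hc0 : c ≠ 0 := by
    rintro rfl
    exact hd0 (by rw [← hc]; simp)
  obtain ⟨u, hu⟩ := Finsupp.support_nonempty_iff.mpr hc0
  have hcu : c u ≠ 0 := Finsupp.mem_support_iff.mp hu
  obtain ⟨f, hf⟩ := LinearMap.exists_extend ((Finsupp.lapply u : _ →ₗ[k] k) ∘ₗ hli'.repr)
  have hfv : ∀ v : {u : C | IsGroupLikeElem k u}, f v = if v = u then 1 else 0 := by
    intro v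
    have hv : (v : C) ∈ Submodule.span k (Set.range
      fun u : {u : C | IsGroupLikeElem k u} => (u : C)) := Submodule.subset_span ⟨v, rfl⟩
    have h1 := LinearMap.congr_fun hf ⟨v, hv⟩
    have h2 : hli'.repr ⟨v, hv⟩ = Finsupp.single v 1 := hli'.repr_eq_single v _ rfl
    simp only [LinearMap.comp_apply, h2, Finsupp.lapply_apply, Finsupp.single_apply] at h1
    exact h1
  have huD : (u : C) ∈ D := by
    have h1 := hsub.lid_rTensor_mem f hdD
    have h2 : TensorProduct.lid k C (f.rTensor C (comul (R := k) d)) = c u • (u : C) := by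
      rw [← hc, Finsupp.sum, map_sum, map_sum, map_sum, Finset.sum_eq_single u]
      · simp [u.2.comul_eq_tmul_self, hfv]
      · intro v _ hvu
        simp [v.2.comul_eq_tmul_self, hfv, hvu]
      · intro h
        exact absurd hu h
    rw [h2] at h1
    exact (D.smul_mem_iff hcu).mp h1
  have hu0 : (u : C) ≠ 0 := u.2.ne_zero
  rcases hsimple _ u.2.isSubcoalgebra_span
    ((Submodule.span_singleton_le_iff_mem _ _).mpr huD) with h | h
  · exact absurd (Submodule.span_singleton_eq_bot.mp h) hu0
  · rw [← h]
    exact finrank_span_singleton hu0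

/-- A one-dimensional subcoalgebra is spanned by a group-like element. -/
lemma IsSubcoalgebra.exists_isGroupLikeElem {D : Submodule k C} (hD : IsSubcoalgebra k C D)
    (h1 : Module.finrank k D = 1) : ∃ u ∈ D, IsGroupLikeElem k u := by
  obtain ⟨⟨d, hd⟩, hd0, hspan⟩ := finrank_eq_one_iff'.mp h1
  obtain ⟨z, hz⟩ := hD d hd
  have hz' : ∃ c : k, comul (R := k) d = c • (d ⊗ₜ d) := by
    rw [← hz]
    clear hz
    induction z with
    | zero => exact ⟨0, by simp⟩
    | add x y hx hy =>
      obtain ⟨a, ha⟩ := hx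
      obtain ⟨b, hb⟩ := hy
      exact ⟨a + b, by rw [map_add, ha, hb, add_smul]⟩
    | tmul x y =>
      obtain ⟨a, rfl⟩ := hspan x
      obtain ⟨b, rfl⟩ := hspan y
      refine ⟨a * b, ?_⟩
      simp [TensorProduct.smul_tmul', TensorProduct.tmul_smul, smul_smul, mul_comm]
  obtain ⟨c, hc⟩ := hz'
  have hd0' : d ≠ 0 := fun h => hd0 (Subtype.ext h)
  have hcounit : c * counit (R := k) d = 1 := by
    have h2 := Coalgebra.rTensor_counit_comul (R := k) d
    rw [hc, map_smul, LinearMap.rTensor_tmul] at h2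
    have h3 := congrArg (TensorProduct.lid k C) h2
    simp only [map_smul, TensorProduct.lid_tmul, smul_smul, one_smul] at h3
    have h4 : (c * counit (R := k) d - 1) • d = 0 := by rw [sub_smul, h3, one_smul, sub_self]
    exact sub_eq_zero.mp ((smul_eq_zero.mp h4).resolve_right hd0')
  refine ⟨c • d, D.smul_mem c hd, ?_, ?_⟩
  · rw [map_smul, smul_eq_mul, hcounit]
  · rw [map_smul, hc, TensorProduct.smul_tmul', TensorProduct.tmul_smul]

/-- A nonzero finite-dimensional subcoalgebra contains a simple subcoalgebra. -/
lemma IsSubcoalgebra.exists_isSimpleSubcoalgebra [FiniteDimensional k C] {D : Submodule k C}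
    (hD : IsSubcoalgebra k C D) (hne : D ≠ ⊥) :
    ∃ E ≤ D, IsSimpleSubcoalgebra k C E := by
  classical
  let P : ℕ → Prop := fun n =>
    ∃ E ≤ D, IsSubcoalgebra k C E ∧ E ≠ ⊥ ∧ Module.finrank k E = n
  have hP : ∃ n, P n := ⟨_, D, le_rfl, hD, hne, rfl⟩
  obtain ⟨E, hED, hE, hE0, hEn⟩ := Nat.find_spec hP
  refine ⟨E, hED, hE, hE0, fun E' hE' hle => ?_⟩
  by_cases h0 : E' = ⊥
  · exact Or.inl h0
  · right
    have h1 : Nat.find hP ≤ Module.finrank k E' :=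
      Nat.find_min' hP ⟨E', hle.trans hED, hE', h0, rfl⟩
    exact Submodule.eq_of_le_of_finrank_le hle (by omega)

/-- Linear functionals separate the points of `C ⊗ C`. -/
lemma tensor_eq_zero_of_forall_functional {V W : Type*} [AddCommGroup V] [Module k V]
    [AddCommGroup W] [Module k W] {z : V ⊗[k] W}
    (h : ∀ (f : V →ₗ[k] k) (g : W →ₗ[k] k), TensorProduct.lid k k (TensorProduct.map f g z) = 0) :
    z = 0 := by
  let b := Module.Free.chooseBasis k V
  let b' := Module.Free.chooseBasis k W
  refine (b.tensorProduct b').repr.map_eq_zero_iff.mp (Finsupp.ext fun ij => ?_)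
  have h1 := h (b.coord ij.1) (b'.coord ij.2)
  rw [Finsupp.zero_apply, ← h1]
  clear h1 h
  induction z with
  | zero => simp
  | add x y hx hy => simp only [map_add, Finsupp.add_apply, hx, hy]
  | tmul v w =>
    obtain ⟨i, j⟩ := ij
    simp [Module.Basis.tensorProduct_repr_tmul_apply, mul_comm]

/-- The annihilator in a coalgebra of a two-sided ideal of its convolution algebra is a
subcoalgebra. -/
lemma isSubcoalgebra_of_ideal [FiniteDimensional k C] (I : Submodule k (C →ₗ[k] k))
    (hl : ∀ f ∈ I, ∀ g : C →ₗ[k] k, (toConv f * toConv g).ofConv ∈ I)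
    (hr : ∀ f ∈ I, ∀ g : C →ₗ[k] k, (toConv g * toConv f).ofConv ∈ I) :
    IsSubcoalgebra k C (Submodule.dualCoannihilator I) := by
  intro x hx
  set D := Submodule.dualCoannihilator I with hD
  obtain ⟨π, hπ⟩ := D.subtype.exists_leftInverse_of_injective (by simp)
  have hπ' : ∀ d ∈ D, (π d : C) = d := fun d hd =>
    congrArg Subtype.val (LinearMap.congr_fun hπ ⟨d, hd⟩)
  have hI : ∀ f : C →ₗ[k] k, f ∘ₗ (LinearMap.id - D.subtype ∘ₗ π) ∈ I := by
    intro f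
    rw [← Subspace.dualCoannihilator_dualAnnihilator_eq (W := I)]
    rw [Submodule.mem_dualAnnihilator]
    intro d hd
    have := hπ' d hd
    simp [this]
  set P := D.subtype ∘ₗ π with hP
  have hconv : ∀ (f g : C →ₗ[k] k) (z : C ⊗[k] C), TensorProduct.lid k k
      (TensorProduct.map f g z) = LinearMap.mul' k k (TensorProduct.map f g z) := by
    intro f g z
    induction z with
    | zero => simp
    | add x y hx hy => simp only [map_add, hx, hy]
    | tmul v w => simp
  have hmem : ∀ f ∈ I, f x = 0 := fun f hf => (Submodule.mem_dualCoannihilator x).mp hx f hf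
  have h1 : TensorProduct.map (LinearMap.id - P) LinearMap.id (comul (R := k) x) = 0 := by
    refine tensor_eq_zero_of_forall_functional fun f g => ?_
    rw [hconv, ← LinearMap.comp_apply (TensorProduct.map f g), ← TensorProduct.map_comp]
    exact hmem _ (hl _ (hI f) g)
  have h2 : TensorProduct.map LinearMap.id (LinearMap.id - P) (comul (R := k) x) = 0 := by
    refine tensor_eq_zero_of_forall_functional fun f g => ?_
    rw [hconv, ← LinearMap.comp_apply (TensorProduct.map f g), ← TensorProduct.map_comp]
    exact hmem _ (hr _ (hI g) f)
  have h1' : comul (R := k) x = TensorProduct.map P LinearMap.id (comul (R := k) x) := by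
    have h3 : TensorProduct.map (LinearMap.id - P + P) (LinearMap.id : C →ₗ[k] C)
        (comul (R := k) x) = TensorProduct.map P LinearMap.id (comul (R := k) x) := by
      rw [TensorProduct.map_add_left, LinearMap.add_apply, h1, zero_add]
    rwa [sub_add_cancel, TensorProduct.map_id] at h3
  have h2' : comul (R := k) x = TensorProduct.map LinearMap.id P (comul (R := k) x) := by
    have h3 : TensorProduct.map (LinearMap.id : C →ₗ[k] C) (LinearMap.id - P + P)
        (comul (R := k) x) = TensorProduct.map LinearMap.id P (comul (R := k) x) := by
      rw [TensorProduct.map_add_right, LinearMap.add_apply, h2, zero_add]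
    rwa [sub_add_cancel, TensorProduct.map_id] at h3
  refine ⟨TensorProduct.map π π (comul (R := k) x), ?_⟩
  rw [← LinearMap.comp_apply, ← TensorProduct.map_comp, ← hP]
  have h3 : TensorProduct.map P P = TensorProduct.map P LinearMap.id ∘ₗ
      TensorProduct.map (LinearMap.id : C →ₗ[k] C) P := by
    rw [← TensorProduct.map_comp, LinearMap.comp_id, LinearMap.id_comp]
  rw [h3, LinearMap.comp_apply, ← h2', ← h1']

/-- Burnside's theorem: over an algebraically closed field, a finite-dimensional algebra acts on a
finite-dimensional simple module through all linear endomorphisms. -/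
lemma lsmul_surjective_of_isSimpleModule [IsAlgClosed k] {R S : Type*} [Ring R] [Algebra k R]
    [AddCommGroup S] [Module k S] [Module R S] [IsScalarTower k R S] [IsSimpleModule R S]
    [FiniteDimensional k S] :
    Function.Surjective (Algebra.lsmul k k S : R →ₐ[k] Module.End k S) := by
  have : Nontrivial S := IsSimpleModule.nontrivial R S
  have hsc : ∀ φ : Module.End R S, ∃ c : k, ∀ s, φ s = c • s := by
    intro φ
    obtain ⟨c, hc⟩ := Module.End.exists_eigenvalue (φ.restrictScalars k)
    obtain ⟨v, hv⟩ := hc.exists_hasEigenvector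
    refine ⟨c, ?_⟩
    let ψ : Module.End R S := φ -
      { toFun := fun s => c • s
        map_add' := smul_add c
        map_smul' := fun r s => (smul_comm r c s).symm }
    have hψv : ψ v = 0 := by
      have h1 := hv.apply_eq_smul
      have h2 : φ v = c • v := h1
      change φ v - c • v = 0
      rw [h2, sub_self]
    rcases ψ.bijective_or_eq_zero with h | h
    · exact absurd (h.1 (hψv.trans (map_zero ψ).symm)) hv.2
    · intro s
      have : φ s - c • s = 0 := LinearMap.congr_fun h s
      exact sub_eq_zero.mp this
  intro f
  let f' : Module.End (Module.End R S) S :=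
    { toFun := f
      map_add' := map_add f
      map_smul' := fun φ s => by
        obtain ⟨c, hc⟩ := hsc φ
        change f (φ s) = φ (f s)
        rw [hc, hc, map_smul] }
  obtain ⟨t, ht⟩ := (Module.Finite.fg_top : (⊤ : Submodule k S).FG)
  obtain ⟨r, hr⟩ := jacobson_density (R := R) f' t
  refine ⟨r, LinearMap.ext fun s => ?_⟩
  have hs : s ∈ Submodule.span k (t : Set S) := by rw [ht]; trivial
  induction hs using Submodule.span_induction with
  | mem m hm => exact (hr m hm).symm
  | zero => simp
  | add a b _ _ ha hb => rw [map_add, map_add, ha, hb]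
  | smul c a _ ha => rw [map_smul, map_smul, ha]

/-- In a finite-dimensional pointed coalgebra over an algebraically closed field, every nonzero
idempotent of the convolution algebra is `1` on some group-like element. -/
lemma IsPointed.exists_isGroupLikeElem [IsAlgClosed k] [FiniteDimensional k C]
    (hC : IsPointed k C) (e : C →ₗ[k] k) (he : toConv e * toConv e = toConv e) (he0 : e ≠ 0) :
    ∃ u : C, IsGroupLikeElem k u ∧ e u = 1 := by
  let R := WithConv (C →ₗ[k] k)
  let e' : R := toConv e
  have he' : e' * e' = e' := he
  have : FiniteDimensional k R := Module.Finite.equiv (WithConv.linearEquiv k (C →ₗ[k] k)).symm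
  -- a simple module on which `e` acts as nonzero
  have hspan : Ideal.span {1 - e'} ≠ ⊤ := by
    rw [Ne, Ideal.eq_top_iff_one, Ideal.mem_span_singleton']
    rintro ⟨r, hr⟩
    apply he0
    have h1 : e' = 0 := by
      calc e' = r * (1 - e') * e' := by rw [hr, one_mul]
        _ = 0 := by rw [mul_assoc, sub_mul, one_mul, he', sub_self, mul_zero]
    exact congrArg ofConv h1
  obtain ⟨M, hM, hle⟩ := Ideal.exists_le_maximal _ hspan
  have hsimple : IsSimpleModule R (R ⧸ M) := isSimpleModule_iff_isCoatom.mpr hM.out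
  have hfd : FiniteDimensional k (R ⧸ M) :=
    Module.Finite.of_surjective ((Submodule.mkQ M).restrictScalars k) (Submodule.mkQ_surjective M)
  let ρ : R →ₐ[k] Module.End k (R ⧸ M) := Algebra.lsmul k k (R ⧸ M)
  have hρ : Function.Surjective ρ := lsmul_surjective_of_isSimpleModule
  have hρe : ρ e' ≠ 0 := by
    intro h
    have h1 : e' • (Submodule.Quotient.mk 1 : R ⧸ M) = 0 := LinearMap.congr_fun h _
    rw [← Submodule.Quotient.mk_smul, Submodule.Quotient.mk_eq_zero, smul_eq_mul, mul_one] at h1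
    have h2 : 1 - e' ∈ M := hle (Ideal.subset_span rfl)
    exact hM.ne_top ((Ideal.eq_top_iff_one M).mpr (by simpa using M.add_mem h2 h1))
  -- its coefficient coalgebra
  let I : Submodule k (C →ₗ[k] k) := LinearMap.ker (ρ.toLinearMap ∘ₗ
    (WithConv.linearEquiv k (C →ₗ[k] k)).symm.toLinearMap)
  have hI : ∀ f, f ∈ I ↔ ρ (toConv f) = 0 := fun f => Iff.rfl
  have hsub : IsSubcoalgebra k C (Submodule.dualCoannihilator I) := by
    refine isSubcoalgebra_of_ideal I (fun f hf g => ?_) (fun f hf g => ?_)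
    · rw [hI] at hf ⊢
      rw [toConv_ofConv, map_mul, hf, zero_mul]
    · rw [hI] at hf ⊢
      rw [toConv_ofConv, map_mul, hf, mul_zero]
  have hne : Submodule.dualCoannihilator I ≠ ⊥ := by
    intro h
    have h1 := Subspace.dualCoannihilator_dualAnnihilator_eq (W := I)
    rw [h, Submodule.dualAnnihilator_bot] at h1
    exact hρe ((hI e).mp (h1 ▸ Submodule.mem_top))
  obtain ⟨E, hED, hE⟩ := hsub.exists_isSimpleSubcoalgebra hne
  obtain ⟨u, huE, hu⟩ := hE.1.exists_isGroupLikeElem (hC E hE)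
  -- evaluation at `u` factors through the simple ring of endomorphisms of the module
  let χ : R →+* k :=
    { toFun := fun f => f u
      map_one' := hu.counit_eq_one
      map_mul' := fun f g => (LinearMap.convMul_apply f g u).trans (by
        rw [hu.comul_eq_tmul_self]; rfl)
      map_zero' := rfl
      map_add' := fun _ _ => rfl }
  have hker : RingHom.ker (ρ : R →+* Module.End k (R ⧸ M)) ≤ RingHom.ker χ := by
    intro f hf
    exact (Submodule.mem_dualCoannihilator u).mp (hED huE) f.ofConv hf
  let χ' : Module.End k (R ⧸ M) →+* k :=
    RingHom.liftOfSurjective (ρ : R →+* Module.End k (R ⧸ M)) hρ ⟨χ, hker⟩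
  have hχ' : ∀ f, χ' (ρ f) = χ f := fun f =>
    RingHom.liftOfRightInverse_comp_apply _ _ _ ⟨χ, hker⟩ f
  have : Nontrivial (R ⧸ M) := IsSimpleModule.nontrivial R _
  have : Nonempty (Fin (Module.finrank k (R ⧸ M))) :=
    Fin.pos_iff_nonempty.mp Module.finrank_pos
  have : IsSimpleRing (Module.End k (R ⧸ M)) :=
    IsSimpleRing.of_ringEquiv (algEquivMatrix (Module.finBasis k (R ⧸ M))).symm.toRingEquiv
      inferInstance
  have hinj : Function.Injective χ' := RingHom.injective χ'
  have hne0 : e u ≠ 0 := by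
    intro h
    apply hρe
    apply hinj
    rw [hχ', map_zero]
    exact h
  refine ⟨u, hu, ?_⟩
  have hidem : e u * e u = e u := by
    have := map_mul χ e' e'
    rw [he'] at this
    exact this.symm
  exact mul_left_cancel₀ hne0 (by rw [hidem, mul_one])

end Pointed

/-! ### Infinitesimal twists -/

lemma Finset.Nat.sum_antidiagonal_assoc {M : Type*} [AddCommMonoid M] (n : ℕ)
    (f : ℕ → ℕ → ℕ → M) :
    ∑ pc ∈ Finset.HasAntidiagonal.antidiagonal n,
        ∑ ab ∈ Finset.HasAntidiagonal.antidiagonal pc.1, f ab.1 ab.2 pc.2 =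
      ∑ ap ∈ Finset.HasAntidiagonal.antidiagonal n,
        ∑ bc ∈ Finset.HasAntidiagonal.antidiagonal ap.2, f ap.1 bc.1 bc.2 := by
  rw [Finset.sum_sigma', Finset.sum_sigma']
  refine Finset.sum_nbij'
    (fun x => ⟨(x.2.1, x.2.2 + x.1.2), (x.2.2, x.1.2)⟩)
    (fun x => ⟨(x.1.1 + x.2.1, x.2.2), (x.1.1, x.2.1)⟩) ?_ ?_ ?_ ?_ ?_
  · rintro ⟨⟨p, c⟩, a, b⟩ h
    simp only [Finset.mem_sigma, Finset.HasAntidiagonal.mem_antidiagonal] at h ⊢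
    obtain ⟨h1 : p + c = n, h2 : a + b = p⟩ := h
    exact ⟨by change a + (b + c) = n; omega, trivial⟩
  · rintro ⟨⟨p, c⟩, a, b⟩ h
    simp only [Finset.mem_sigma, Finset.HasAntidiagonal.mem_antidiagonal] at h ⊢
    obtain ⟨h1 : p + c = n, h2 : a + b = c⟩ := h
    exact ⟨by change p + a + b = n; omega, trivial⟩
  · rintro ⟨⟨p, c⟩, a, b⟩ h
    simp only [Finset.mem_sigma, Finset.HasAntidiagonal.mem_antidiagonal] at h
    obtain ⟨h1, rfl⟩ := h
    rfl
  · rintro ⟨⟨p, c⟩, a, b⟩ h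
    simp only [Finset.mem_sigma, Finset.HasAntidiagonal.mem_antidiagonal] at h
    obtain ⟨h1, rfl⟩ := h
    rfl
  · rintro ⟨⟨p, c⟩, a, b⟩ h
    rfl

lemma mul_pow_of_mul_eq_smul {k A : Type*} [Field k] [Ring A] [Algebra k A] {c : k} {u v : A}
    (h : v * u = c • (u * v)) (n : ℕ) : v * u ^ n = c ^ n • (u ^ n * v) := by
  induction n with
  | zero => simp
  | succ n ih =>
    rw [pow_succ, ← mul_assoc, ih, smul_mul_assoc, mul_assoc, h, mul_smul_comm, smul_smul,
      ← pow_succ, ← mul_assoc]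

lemma pow_mul_of_mul_eq_smul {k A : Type*} [Field k] [Ring A] [Algebra k A] {c : k} {u v : A}
    (h : v * u = c • (u * v)) (n : ℕ) : v ^ n * u = c ^ n • (u * v ^ n) := by
  induction n with
  | zero => simp
  | succ n ih =>
    rw [pow_succ', mul_assoc, ih, mul_smul_comm, ← mul_assoc, h, smul_mul_assoc, smul_smul,
      ← pow_succ, mul_assoc]

namespace QLSDatum

open Coalgebra Bialgebra

variable {k G : Type*} [Field k] [Group G] {θ : ℕ} (D : QLSDatum k G θ)

/-- The tensor square of the bosonization. -/
abbrev SmashSq : Type _ := D.NicholsSmash ⊗[k] D.NicholsSmash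

/-- The subalgebra `𝔅(V) # kΓ`. -/
def subΓ : Subalgebra k D.NicholsSmash :=
  Algebra.adjoin k (Set.range D.gen ∪ D.grp '' (D.Γ : Set G))

lemma gen_mem_subΓ (i : Fin θ) : D.gen i ∈ D.subΓ :=
  Algebra.subset_adjoin (Or.inl ⟨i, rfl⟩)

lemma grp_mem_subΓ {h : G} (hh : h ∈ D.Γ) : D.grp h ∈ D.subΓ :=
  Algebra.subset_adjoin (Or.inr ⟨h, hh, rfl⟩)

lemma g_mem_Γ (i : Fin θ) : D.g i ∈ D.Γ := (D.gΓ i).2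

variable {D} in
lemma subΓ_le {S : Subalgebra k D.NicholsSmash} (hx : ∀ i, D.gen i ∈ S)
    (hg : ∀ h ∈ D.Γ, D.grp h ∈ S) : D.subΓ ≤ S := by
  refine Algebra.adjoin_le ?_
  rintro _ (⟨i, rfl⟩ | ⟨h, hh, rfl⟩)
  · exact hx i
  · exact hg h hh

/-- The linearization of the notion of a twist whose values commute with the comultiplication of
`𝔅(V) # kΓ`: an additive two-cocycle in the tensor square of `𝔅(V) # kΓ`, commuting with the
image of the comultiplication of that subalgebra. -/
def infTwist : Submodule k D.SmashSq where
  carrier := {X | (∀ y ∈ D.subΓ, Commute X (comul (R := k) y)) ∧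
    X ∈ Submodule.span k {z | ∃ a ∈ D.subΓ, ∃ b ∈ D.subΓ, a ⊗ₜ[k] b = z} ∧
    tensorAssoc k D.NicholsSmash (comulLeft k X + X ⊗ₜ 1) = comulRight k X + 1 ⊗ₜ X ∧
    Algebra.TensorProduct.map (counitAlgHom k D.NicholsSmash) (.id k D.NicholsSmash) X = 0 ∧
    Algebra.TensorProduct.map (.id k D.NicholsSmash) (counitAlgHom k D.NicholsSmash) X = 0}
  zero_mem' := ⟨fun y _ => Commute.zero_left _, Submodule.zero_mem _, by simp, map_zero _,
    map_zero _⟩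
  add_mem' := by
    rintro X Y ⟨h1, h2, h3, h4, h5⟩ ⟨h1', h2', h3', h4', h5'⟩
    refine ⟨fun y hy => (h1 y hy).add_left (h1' y hy), Submodule.add_mem _ h2 h2', ?_, ?_, ?_⟩
    · have e : comulLeft k (X + Y) + (X + Y) ⊗ₜ[k] (1 : D.NicholsSmash) =
          (comulLeft k X + X ⊗ₜ 1) + (comulLeft k Y + Y ⊗ₜ 1) := by
        rw [map_add, TensorProduct.add_tmul]; abel
      rw [e, map_add, h3, h3', map_add, TensorProduct.tmul_add]
      abel
    · rw [map_add, h4, h4', add_zero]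
    · rw [map_add, h5, h5', add_zero]
  smul_mem' := by
    rintro c X ⟨h1, h2, h3, h4, h5⟩
    refine ⟨fun y hy => (h1 y hy).smul_left c, Submodule.smul_mem _ c h2, ?_, ?_, ?_⟩
    · rw [map_smul, ← TensorProduct.smul_tmul', ← smul_add, map_smul, h3, map_smul,
        TensorProduct.tmul_smul, smul_add]
    · rw [map_smul, h4, smul_zero]
    · rw [map_smul, h5, smul_zero]

section

variable {D} {X : D.SmashSq}

lemma mem_infTwist_commute (hX : X ∈ D.infTwist) {y : D.NicholsSmash} (hy : y ∈ D.subΓ) :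
    Commute X (comul (R := k) y) := hX.1 y hy

/-- The exponential of a nilpotent infinitesimal twist is a twist. -/
lemma isTwist_nilExpUnit [CharZero k] (hX : X ∈ D.infTwist) (hn : IsNilpotent X) :
    IsTwist (nilExpUnit k hn) := by
  obtain ⟨h1, h2, h3, h4, h5⟩ := hX
  let iL : D.SmashSq →ₐ[k] D.SmashSq ⊗[k] D.NicholsSmash := Algebra.TensorProduct.includeLeft
  let iR : D.SmashSq →ₐ[k] D.NicholsSmash ⊗[k] D.SmashSq := Algebra.TensorProduct.includeRight
  have hcL : Commute (comulLeft k X) (iL X) := by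
    refine Submodule.span_induction (p := fun Z _ => Commute (comulLeft k Z) (iL X))
      ?_ ?_ ?_ ?_ h2
    · rintro _ ⟨a, ha, b, hb, rfl⟩
      have := (h1 a ha).symm.eq
      change comul (R := k) a ⊗ₜ b * X ⊗ₜ 1 = X ⊗ₜ 1 * comul (R := k) a ⊗ₜ b
      rw [Algebra.TensorProduct.tmul_mul_tmul, Algebra.TensorProduct.tmul_mul_tmul, this,
        one_mul, mul_one]
    · rw [map_zero]; exact Commute.zero_left _
    · intro a b _ _ ha hb
      rw [map_add]; exact ha.add_left hb
    · intro c a _ ha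
      rw [map_smul]; exact ha.smul_left c
  have hcR : Commute (comulRight k X) (iR X) := by
    refine Submodule.span_induction (p := fun Z _ => Commute (comulRight k Z) (iR X))
      ?_ ?_ ?_ ?_ h2
    · rintro _ ⟨a, ha, b, hb, rfl⟩
      have := (h1 b hb).symm.eq
      change a ⊗ₜ comul (R := k) b * 1 ⊗ₜ X = 1 ⊗ₜ X * a ⊗ₜ comul (R := k) b
      rw [Algebra.TensorProduct.tmul_mul_tmul, Algebra.TensorProduct.tmul_mul_tmul, this,
        one_mul, mul_one]
    · rw [map_zero]; exact Commute.zero_left _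
    · intro a b _ _ ha hb
      rw [map_add]; exact ha.add_left hb
    · intro c a _ ha
      rw [map_smul]; exact ha.smul_left c
  have hL : nilExp k X ⊗ₜ[k] (1 : D.NicholsSmash) = nilExp k (iL X) := map_nilExp k iL hn
  have hR : (1 : D.NicholsSmash) ⊗ₜ[k] nilExp k X = nilExp k (iR X) := map_nilExp k iR hn
  refine ⟨?_, ?_, ?_⟩
  · rw [coe_nilExpUnit, hL, hR, map_nilExp k _ hn, map_nilExp k _ hn,
      ← nilExp_add k hcL (hn.map _) (hn.map _), ← nilExp_add k hcR (hn.map _) (hn.map _)]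
    have hadd : IsNilpotent (comulLeft k X + iL X) :=
      hcL.isNilpotent_add (hn.map _) (hn.map _)
    refine (map_nilExp k (tensorAssoc k D.NicholsSmash).toAlgHom hadd).trans ?_
    exact congrArg _ h3
  · rw [coe_nilExpUnit, map_nilExp k _ hn, h4, nilExp_zero]
  · rw [coe_nilExpUnit, map_nilExp k _ hn, h5, nilExp_zero]

end

/-! ### The braided tensor square of the Nichols algebra inside the tensor square of the
bosonization -/

/-- The element `x_i ⊗ 1`. -/
def genL (i : Fin θ) : D.SmashSq := D.gen i ⊗ₜ 1

/-- The element `g_i ⊗ x_i`, the image of the element `1 ⊗ x_i` of the braided tensor square. -/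
def genR (i : Fin θ) : D.SmashSq := D.grp (D.g i) ⊗ₜ D.gen i

lemma comul_gen_eq (i : Fin θ) : comul (R := k) (D.gen i) = D.genL i + D.genR i := D.comul_gen i

lemma genL_mul_genL {i j : Fin θ} (h : i ≠ j) :
    D.genL i * D.genL j = D.q i j • (D.genL j * D.genL i) := by
  simp [genL, D.gen_mul_gen h, TensorProduct.smul_tmul']

lemma genR_mul_genR {i j : Fin θ} (h : i ≠ j) :
    D.genR i * D.genR j = D.q i j • (D.genR j * D.genR i) := by
  rw [genR, genR, Algebra.TensorProduct.tmul_mul_tmul, Algebra.TensorProduct.tmul_mul_tmul,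
    D.gen_mul_gen h, ← map_mul, D.g_central i, map_mul, TensorProduct.tmul_smul]

lemma genR_mul_genL (i j : Fin θ) :
    D.genR i * D.genL j = D.q i j • (D.genL j * D.genR i) := by
  rw [genR, genL, Algebra.TensorProduct.tmul_mul_tmul, Algebra.TensorProduct.tmul_mul_tmul,
    grp_mul_gen, TensorProduct.smul_tmul', one_mul, mul_one]
  rfl

lemma grpDiag_mul_genL (s : G) (i : Fin θ) :
    D.grpDiag s * D.genL i = (D.χ i s : k) • (D.genL i * D.grpDiag s) := by
  simp [grpDiag_apply, genL, grp_mul_gen, TensorProduct.smul_tmul']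

lemma grpDiag_mul_genR (s : G) (i : Fin θ) :
    D.grpDiag s * D.genR i = (D.χ i s : k) • (D.genR i * D.grpDiag s) := by
  rw [grpDiag_apply, genR, Algebra.TensorProduct.tmul_mul_tmul,
    Algebra.TensorProduct.tmul_mul_tmul, grp_mul_gen, TensorProduct.tmul_smul, ← map_mul,
    ← map_mul, D.g_central]

lemma genL_pow (i : Fin θ) (n : ℕ) : D.genL i ^ n = (D.gen i ^ n) ⊗ₜ 1 := by
  rw [genL, Algebra.TensorProduct.tmul_pow, one_pow]

lemma genR_pow (i : Fin θ) (n : ℕ) :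
    D.genR i ^ n = (D.grp (D.g i) ^ n) ⊗ₜ (D.gen i ^ n) := by
  rw [genR, Algebra.TensorProduct.tmul_pow]

lemma genL_pow_of_le {i : Fin θ} {n : ℕ} (h : D.N i ≤ n) : D.genL i ^ n = 0 := by
  rw [genL_pow, D.gen_pow_of_le h, TensorProduct.zero_tmul]

lemma genR_pow_of_le {i : Fin θ} {n : ℕ} (h : D.N i ≤ n) : D.genR i ^ n = 0 := by
  rw [genR_pow, D.gen_pow_of_le h, TensorProduct.tmul_zero]

/-! ### The terms `∑_{0 < n < N_i} x_i^{N_i - n} ⊗ x_i^n / ((N_i - n)! n!)` -/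

/-- The `q`-divided power `y ^ n / n!_q`. It is zero when `n!_q = 0`, by the convention
`0⁻¹ = 0`. -/
def qDivPow {A : Type*} [Ring A] [Algebra k A] (q : k) (y : A) (n : ℕ) : A :=
  (qFactorial q n)⁻¹ • y ^ n

section qDivPow

variable {A B : Type*} [Ring A] [Algebra k A] [Ring B] [Algebra k B]

lemma qDivPow_zero (q : k) (y : A) : qDivPow q y 0 = 1 := by simp [qDivPow, qFactorial]

lemma qDivPow_eq_zero {q : k} {y : A} (hy : y ^ orderOf q = 0) {n : ℕ} (h : orderOf q ≤ n) :
    qDivPow q y n = 0 := by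
  rw [qDivPow, pow_eq_zero_of_le h hy, smul_zero]

lemma mul_qDivPow {q : k} {y : A} (hy : y ^ orderOf q = 0) (n : ℕ) :
    y * qDivPow q y n = qNumber q (n + 1) • qDivPow q y (n + 1) := by
  rw [qDivPow, qDivPow, qFactorial_succ, mul_smul_comm, ← pow_succ', smul_smul, mul_inv]
  rcases Nat.lt_or_ge (n + 1) (orderOf q) with h | h
  · have h0 := qNumber_ne_zero (q := q) (n := n + 1) (by omega) h
    congr 1
    field_simp
  · rw [pow_eq_zero_of_le h hy, smul_zero, smul_zero]

lemma qDivPow_mul {q : k} {y : A} (hy : y ^ orderOf q = 0) (n : ℕ) :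
    qDivPow q y n * y = qNumber q (n + 1) • qDivPow q y (n + 1) := by
  rw [← mul_qDivPow hy, qDivPow, smul_mul_assoc, mul_smul_comm, ← pow_succ, ← pow_succ']

lemma qDivPow_mul_qDivPow_eq_zero {q : k} {y : A} (hy : y ^ orderOf q = 0) {a b : ℕ}
    (h : orderOf q ≤ a + b) : qDivPow q y a * qDivPow q y b = 0 := by
  rw [qDivPow, qDivPow, smul_mul_smul_comm, ← pow_add, pow_eq_zero_of_le h hy, smul_zero]

lemma mul_qDivPow_of_mul_eq_smul {c q : k} {u v : A} (h : v * u = c • (u * v)) (n : ℕ) :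
    v * qDivPow q u n = c ^ n • (qDivPow q u n * v) := by
  rw [qDivPow, mul_smul_comm, mul_pow_of_mul_eq_smul h, smul_mul_assoc, smul_comm]

lemma qDivPow_mul_of_mul_eq_smul {c q : k} {u v : A} (h : v * u = c • (u * v)) (n : ℕ) :
    qDivPow q v n * u = c ^ n • (u * qDivPow q v n) := by
  rw [qDivPow, smul_mul_assoc, pow_mul_of_mul_eq_smul h, mul_smul_comm, smul_comm]

end qDivPow

/-- The sum `∑_{a + b = p} (x_i^a / a!) g_i^b ⊗ x_i^b / b!`, which is `Δ(x_i^p / p!)` for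
`p < N_i`. -/
def coprodDivPow (i : Fin θ) (p : ℕ) : D.SmashSq :=
  ∑ ab ∈ Finset.HasAntidiagonal.antidiagonal p,
    qDivPow (D.q i i) (D.genL i) ab.1 * qDivPow (D.q i i) (D.genR i) ab.2

lemma genL_pow_orderOf (i : Fin θ) : D.genL i ^ orderOf (D.q i i) = 0 :=
  D.genL_pow_of_le le_rfl

lemma genR_pow_orderOf (i : Fin θ) : D.genR i ^ orderOf (D.q i i) = 0 :=
  D.genR_pow_of_le le_rfl

lemma qDivPow_genL_mul_genR (i : Fin θ) (a b : ℕ) :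
    qDivPow (D.q i i) (D.genL i) a * qDivPow (D.q i i) (D.genR i) b =
      (qDivPow (D.q i i) (D.gen i) a * D.grp (D.g i) ^ b) ⊗ₜ
        qDivPow (D.q i i) (D.gen i) b := by
  simp only [qDivPow, genL_pow, genR_pow, smul_mul_assoc, mul_smul_comm,
    Algebra.TensorProduct.tmul_mul_tmul, one_mul, TensorProduct.tmul_smul,
    ← TensorProduct.smul_tmul']

/-- `Δ(x_i)` multiplies these elements as `x_i` multiplies the divided powers. For `p = N_i` this
and `coprodDivPow_mul_comul_gen` show that `T i` commutes with `Δ(x_i)`. -/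
lemma comul_gen_mul_coprodDivPow (i : Fin θ) (p : ℕ) :
    comul (R := k) (D.gen i) * D.coprodDivPow i p =
      qNumber (D.q i i) (p + 1) • D.coprodDivPow i (p + 1) := by
  set q := D.q i i with hqdef
  have e : ∀ ab ∈ Finset.HasAntidiagonal.antidiagonal (p + 1), qNumber q (p + 1) •
      (qDivPow q (D.genL i) ab.1 * qDivPow q (D.genR i) ab.2) =
      qNumber q ab.1 • (qDivPow q (D.genL i) ab.1 * qDivPow q (D.genR i) ab.2) +
      (q ^ ab.1 * qNumber q ab.2) •
        (qDivPow q (D.genL i) ab.1 * qDivPow q (D.genR i) ab.2) := by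
    intro ab hab
    rw [← Finset.HasAntidiagonal.mem_antidiagonal.mp hab, qNumber_add, add_smul]
  rw [coprodDivPow, coprodDivPow, Finset.smul_sum, Finset.sum_congr rfl e,
    Finset.sum_add_distrib, Finset.Nat.sum_antidiagonal_succ,
    Finset.Nat.sum_antidiagonal_succ']
  have z1 : qNumber q 0 = 0 := by simp [qNumber]
  simp only [z1, zero_smul, zero_add, mul_zero]
  rw [comul_gen_eq, add_mul, Finset.mul_sum, Finset.mul_sum]
  congr 1
  · refine Finset.sum_congr rfl fun ab _ => ?_
    rw [← mul_assoc, mul_qDivPow (D.genL_pow_orderOf i), smul_mul_assoc]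
  · refine Finset.sum_congr rfl fun ab _ => ?_
    rw [← mul_assoc, mul_qDivPow_of_mul_eq_smul (D.genR_mul_genL i i), smul_mul_assoc, mul_assoc,
      mul_qDivPow (D.genR_pow_orderOf i), mul_smul_comm, smul_smul]

lemma coprodDivPow_mul_comul_gen (i : Fin θ) (p : ℕ) :
    D.coprodDivPow i p * comul (R := k) (D.gen i) =
      qNumber (D.q i i) (p + 1) • D.coprodDivPow i (p + 1) := by
  set q := D.q i i with hqdef
  have e : ∀ ab ∈ Finset.HasAntidiagonal.antidiagonal (p + 1), qNumber q (p + 1) •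
      (qDivPow q (D.genL i) ab.1 * qDivPow q (D.genR i) ab.2) =
      (q ^ ab.2 * qNumber q ab.1) •
        (qDivPow q (D.genL i) ab.1 * qDivPow q (D.genR i) ab.2) +
      qNumber q ab.2 • (qDivPow q (D.genL i) ab.1 * qDivPow q (D.genR i) ab.2) := by
    intro ab hab
    rw [← Finset.HasAntidiagonal.mem_antidiagonal.mp hab, add_comm ab.1, qNumber_add,
      add_smul, add_comm]
  rw [coprodDivPow, coprodDivPow, Finset.smul_sum, Finset.sum_congr rfl e,
    Finset.sum_add_distrib, Finset.Nat.sum_antidiagonal_succ,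
    Finset.Nat.sum_antidiagonal_succ']
  have z1 : qNumber q 0 = 0 := by simp [qNumber]
  simp only [z1, zero_smul, zero_add, mul_zero]
  rw [comul_gen_eq, mul_add, Finset.sum_mul, Finset.sum_mul]
  congr 1
  · refine Finset.sum_congr rfl fun ab _ => ?_
    rw [mul_assoc, qDivPow_mul_of_mul_eq_smul (D.genR_mul_genL i i), mul_smul_comm, ← mul_assoc,
      qDivPow_mul (D.genL_pow_orderOf i), smul_mul_assoc, smul_smul]
  · refine Finset.sum_congr rfl fun ab _ => ?_
    rw [mul_assoc, qDivPow_mul (D.genR_pow_orderOf i), mul_smul_comm]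

lemma comul_qDivPow (i : Fin θ) {p : ℕ} (hp : p < D.N i) :
    comul (R := k) (qDivPow (D.q i i) (D.gen i) p) = D.coprodDivPow i p := by
  induction p with
  | zero => simp [qDivPow_zero, coprodDivPow]
  | succ p ih =>
    have h1 := D.comul_gen_mul_coprodDivPow i p
    rw [← ih (by omega), ← Bialgebra.comul_mul,
      mul_qDivPow (q := D.q i i) (D.gen_pow i), map_smul] at h1
    exact smul_right_injective _ (qNumber_ne_zero (q := D.q i i) (Nat.succ_pos p) hp) h1

/-- The element `∑_{0 < n < N_i} x_i^{N_i - n} g_i^n ⊗ x_i^n / ((N_i - n)! n!)`. The terms with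
`n = 0` and `n = N_i` of the sum `coprodDivPow` vanish, as `x_i ^ N_i = 0`. -/
def T (i : Fin θ) : D.SmashSq := D.coprodDivPow i (D.N i)

lemma T_eq_sum (i : Fin θ) : D.T i = ∑ ab ∈ Finset.HasAntidiagonal.antidiagonal (D.N i),
    (qDivPow (D.q i i) (D.gen i) ab.1 * D.grp (D.g i) ^ ab.2) ⊗ₜ
        qDivPow (D.q i i) (D.gen i) ab.2 := by
  rw [T, coprodDivPow]
  exact Finset.sum_congr rfl fun ab _ => D.qDivPow_genL_mul_genR i ab.1 ab.2

lemma T_mul_T (i : Fin θ) : D.T i * D.T i = 0 := by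
  rw [T, coprodDivPow, Finset.sum_mul]
  refine Finset.sum_eq_zero fun ab hab => ?_
  rw [Finset.mul_sum]
  refine Finset.sum_eq_zero fun cd hcd => ?_
  rw [Finset.HasAntidiagonal.mem_antidiagonal] at hab hcd
  have h1 : D.genR i * qDivPow (D.q i i) (D.genL i) cd.1 =
      D.q i i ^ cd.1 • (qDivPow (D.q i i) (D.genL i) cd.1 * D.genR i) :=
    mul_qDivPow_of_mul_eq_smul (D.genR_mul_genL i i) _
  have h2 := qDivPow_mul_of_mul_eq_smul (q := D.q i i) h1 ab.2
  rw [mul_assoc, ← mul_assoc (qDivPow _ (D.genR i) _), h2, smul_mul_assoc, mul_smul_comm,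
    ← mul_assoc, ← mul_assoc]
  -- `a + b = c + d = N_i` forces `a + c ≥ N_i` or `b + d ≥ N_i`
  rcases le_or_gt (D.N i) (ab.1 + cd.1) with h | h
  · rw [qDivPow_mul_qDivPow_eq_zero (D.genL_pow_orderOf i) h, zero_mul, zero_mul, smul_zero]
  · rw [mul_assoc, qDivPow_mul_qDivPow_eq_zero (D.genR_pow_orderOf i)
      (show orderOf (D.q i i) ≤ _ by change D.N i ≤ _; omega), mul_zero, smul_zero]

/-- An element that commutes up to a scalar with both `x_i ⊗ 1` and `g_i ⊗ x_i` commutes with `T i`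
up to the `N_i`-th power of the scalar. -/
lemma mul_T_of_mul_eq_smul {c : k} {i : Fin θ} {z : D.SmashSq}
    (hL : z * D.genL i = c • (D.genL i * z)) (hR : z * D.genR i = c • (D.genR i * z)) :
    z * D.T i = c ^ D.N i • (D.T i * z) := by
  rw [T, coprodDivPow, Finset.mul_sum, Finset.sum_mul, Finset.smul_sum]
  refine Finset.sum_congr rfl fun ab hab => ?_
  rw [← mul_assoc, mul_qDivPow_of_mul_eq_smul hL, smul_mul_assoc, mul_assoc,
    mul_qDivPow_of_mul_eq_smul hR, mul_smul_comm, smul_smul, ← pow_add,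
    Finset.HasAntidiagonal.mem_antidiagonal.mp hab, mul_assoc]

lemma commute_T_genL {i j : Fin θ} (h : i ≠ j) (hχ : ∀ s ∈ D.Γ, (D.χ i s : k) ^ D.N i = 1) :
    Commute (D.genL j) (D.T i) := by
  have hR : D.genL j * D.genR i = D.q j i • (D.genR i * D.genL j) := by
    rw [genR_mul_genL, smul_smul, D.q_mul_q h.symm, one_smul]
  have h1 := D.mul_T_of_mul_eq_smul (D.genL_mul_genL h.symm) hR
  have h2 : D.q j i ^ D.N i = 1 := hχ _ (D.g_mem_Γ j)
  rwa [h2, one_smul] at h1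

lemma commute_T_genR {i j : Fin θ} (h : i ≠ j) (hχ : ∀ s ∈ D.Γ, (D.χ i s : k) ^ D.N i = 1) :
    Commute (D.genR j) (D.T i) := by
  have h1 := D.mul_T_of_mul_eq_smul (D.genR_mul_genL j i) (D.genR_mul_genR h.symm)
  have h2 : D.q j i ^ D.N i = 1 := hχ _ (D.g_mem_Γ j)
  rwa [h2, one_smul] at h1

lemma grpDiag_mul_T (s : G) (i : Fin θ) :
    D.grpDiag s * D.T i = (D.χ i s : k) ^ D.N i • (D.T i * D.grpDiag s) :=
  D.mul_T_of_mul_eq_smul (D.grpDiag_mul_genL s i) (D.grpDiag_mul_genR s i)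

variable {D} in
lemma commute_comul_of_gen {X : D.SmashSq} (hx : ∀ i, Commute X (comul (R := k) (D.gen i)))
    (hg : ∀ s ∈ D.Γ, Commute X (D.grpDiag s)) {y : D.NicholsSmash} (hy : y ∈ D.subΓ) :
    Commute X (comul (R := k) y) := by
  have hle : D.subΓ ≤ (Subalgebra.centralizer k {X}).comap (comulAlgHom k D.NicholsSmash) := by
    refine subΓ_le (fun i => ?_) (fun h hh => ?_)
    · rw [Subalgebra.mem_comap, Subalgebra.mem_centralizer_iff]
      rintro _ rfl
      exact hx i
    · rw [Subalgebra.mem_comap, Subalgebra.mem_centralizer_iff]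
      rintro _ rfl
      have := hg h hh
      rw [grpDiag_apply, ← comul_grp] at this
      exact this
  have := hle hy
  rw [Subalgebra.mem_comap, Subalgebra.mem_centralizer_iff] at this
  exact this X rfl

lemma comulLeft_T_add (i : Fin θ) :
    comulLeft k (D.T i) + D.T i ⊗ₜ 1 = ∑ pc ∈ Finset.HasAntidiagonal.antidiagonal (D.N i),
      (D.coprodDivPow i pc.1 * D.grpDiag (D.g i) ^ pc.2) ⊗ₜ
        qDivPow (D.q i i) (D.gen i) pc.2 := by
  obtain ⟨M, hM⟩ : ∃ M, D.N i = M + 1 := ⟨D.N i - 1, by have := D.one_lt_N i; omega⟩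
  have h0 : qDivPow (D.q i i) (D.gen i) (M + 1) = 0 :=
    qDivPow_eq_zero (D.gen_pow i) (by rw [← hM]; exact le_rfl)
  have hD : D.coprodDivPow i (M + 1) = D.T i := by rw [T, hM]
  nth_rw 1 [T_eq_sum]
  rw [hM, Finset.Nat.sum_antidiagonal_succ', Finset.Nat.sum_antidiagonal_succ', h0, hD,
    zero_mul, TensorProduct.zero_tmul, zero_add, pow_zero, mul_one, qDivPow_zero, map_sum,
    add_comm]
  congr 1
  refine Finset.sum_congr rfl fun ab hab => ?_
  rw [Finset.HasAntidiagonal.mem_antidiagonal] at hab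
  rw [comulLeft_tmul, Bialgebra.comul_mul, comul_qDivPow D i (by omega), Bialgebra.comul_pow,
    comul_grp]
  rfl

lemma comulRight_T_add {i : Fin θ} (hN : D.g i ^ D.N i = 1) :
    comulRight k (D.T i) + 1 ⊗ₜ D.T i = ∑ ap ∈ Finset.HasAntidiagonal.antidiagonal (D.N i),
      (qDivPow (D.q i i) (D.gen i) ap.1 * D.grp (D.g i) ^ ap.2) ⊗ₜ D.coprodDivPow i ap.2 := by
  obtain ⟨M, hM⟩ : ∃ M, D.N i = M + 1 := ⟨D.N i - 1, by have := D.one_lt_N i; omega⟩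
  have h0 : qDivPow (D.q i i) (D.gen i) (M + 1) = 0 :=
    qDivPow_eq_zero (D.gen_pow i) (by rw [← hM]; exact le_rfl)
  have hD : D.coprodDivPow i (M + 1) = D.T i := by rw [T, hM]
  rw [hM] at hN
  have hN' : D.grp (D.g i) ^ (M + 1) = 1 := by rw [← map_pow, hN, map_one]
  nth_rw 1 [T_eq_sum]
  rw [hM, Finset.Nat.sum_antidiagonal_succ, Finset.Nat.sum_antidiagonal_succ, h0, hD,
    TensorProduct.tmul_zero, zero_add, hN', mul_one, qDivPow_zero, map_sum, add_comm]
  congr 1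
  refine Finset.sum_congr rfl fun ab hab => ?_
  rw [Finset.HasAntidiagonal.mem_antidiagonal] at hab
  rw [comulRight_tmul, comul_qDivPow D i (by omega)]

/-- The cocycle identity holds since both sides are
`∑_{a + b + c = N_i} x_i^a g_i^{b + c} ⊗ x_i^b g_i^c ⊗ x_i^c / (a! b! c!)`: the coproduct of
`x_i^n / n!` is known for `n < N_i`, and `T ⊗ 1` or `1 ⊗ T` is the term with exponent `0` in the
last or first factor. -/
lemma T_mem_infTwist {i : Fin θ} (hN : D.g i ^ D.N i = 1)
    (hχ : ∀ s ∈ D.Γ, (D.χ i s : k) ^ D.N i = 1) : D.T i ∈ D.infTwist := by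
  refine ⟨fun y hy => commute_comul_of_gen (fun j => ?_) (fun s hs => ?_) hy, ?_, ?_, ?_, ?_⟩
  · rcases eq_or_ne i j with rfl | h
    · exact (D.coprodDivPow_mul_comul_gen i _).trans (D.comul_gen_mul_coprodDivPow i _).symm
    · rw [comul_gen_eq]
      exact ((D.commute_T_genL h hχ).add_left (D.commute_T_genR h hχ)).symm
  · have := D.grpDiag_mul_T s i
    rw [hχ s hs, one_smul] at this
    exact this.symm
  · rw [T_eq_sum]
    have hmem : ∀ n, qDivPow (D.q i i) (D.gen i) n ∈ D.subΓ := fun n =>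
      Subalgebra.smul_mem _ (Subalgebra.pow_mem _ (D.gen_mem_subΓ i) n) _
    refine Submodule.sum_mem _ fun ab _ => Submodule.subset_span ⟨_, ?_, _, hmem ab.2, rfl⟩
    exact Subalgebra.mul_mem _ (hmem _) (Subalgebra.pow_mem _ (D.grp_mem_subΓ (D.g_mem_Γ i)) _)
  · rw [comulLeft_T_add, D.comulRight_T_add hN, map_sum]
    set e := qDivPow (D.q i i) (D.gen i)
    have h1 : ∀ pc ∈ Finset.HasAntidiagonal.antidiagonal (D.N i), tensorAssoc k D.NicholsSmash
        ((D.coprodDivPow i pc.1 * D.grpDiag (D.g i) ^ pc.2) ⊗ₜ e pc.2) =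
        ∑ ab ∈ Finset.HasAntidiagonal.antidiagonal pc.1,
          (e ab.1 * D.grp (D.g i) ^ (ab.2 + pc.2)) ⊗ₜ
          ((e ab.2 * D.grp (D.g i) ^ pc.2) ⊗ₜ e pc.2) := by
      intro pc _
      rw [coprodDivPow, Finset.sum_mul, TensorProduct.sum_tmul, map_sum]
      refine Finset.sum_congr rfl fun ab _ => ?_
      rw [qDivPow_genL_mul_genR, grpDiag_apply, Algebra.TensorProduct.tmul_pow,
        Algebra.TensorProduct.tmul_mul_tmul, Algebra.TensorProduct.assoc_tmul, pow_add, mul_assoc]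
    have h2 : ∀ ap ∈ Finset.HasAntidiagonal.antidiagonal (D.N i),
        (e ap.1 * D.grp (D.g i) ^ ap.2) ⊗ₜ D.coprodDivPow i ap.2 =
        ∑ bc ∈ Finset.HasAntidiagonal.antidiagonal ap.2,
          (e ap.1 * D.grp (D.g i) ^ (bc.1 + bc.2)) ⊗ₜ[k]
            ((e bc.1 * D.grp (D.g i) ^ bc.2) ⊗ₜ[k] e bc.2) := by
      intro ap _
      rw [coprodDivPow, TensorProduct.tmul_sum]
      refine Finset.sum_congr rfl fun bc hbc => ?_
      rw [qDivPow_genL_mul_genR, Finset.HasAntidiagonal.mem_antidiagonal.mp hbc]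
    rw [Finset.sum_congr rfl h1, Finset.sum_congr rfl h2]
    exact Finset.Nat.sum_antidiagonal_assoc (D.N i) fun a b c =>
      (e a * D.grp (D.g i) ^ (b + c)) ⊗ₜ[k] ((e b * D.grp (D.g i) ^ c) ⊗ₜ[k] e c)
  · rw [T_eq_sum, map_sum]
    refine Finset.sum_eq_zero fun ab hab => ?_
    rw [Finset.HasAntidiagonal.mem_antidiagonal] at hab
    rcases Nat.eq_zero_or_pos ab.1 with h | h
    · rw [qDivPow_eq_zero (D.gen_pow i) (n := ab.2) (show D.N i ≤ _ by omega),
        TensorProduct.tmul_zero, map_zero]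
    · simp [qDivPow, h.ne']
  · rw [T_eq_sum, map_sum]
    refine Finset.sum_eq_zero fun ab hab => ?_
    rw [Finset.HasAntidiagonal.mem_antidiagonal] at hab
    rcases Nat.eq_zero_or_pos ab.2 with h | h
    · rw [qDivPow_eq_zero (D.gen_pow i) (n := ab.1) (show D.N i ≤ _ by omega), zero_mul,
        TensorProduct.zero_tmul, map_zero]
    · simp [qDivPow, h.ne']

/-! ### The terms `x_i ⊗ x_j` -/

/-- The element `x_i g_j ⊗ x_j`, the image of the element `x_i ⊗ x_j` of the braided tensor
square. -/
def B (i j : Fin θ) : D.SmashSq := D.genL i * D.genR j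

lemma B_eq (i j : Fin θ) : D.B i j = (D.gen i * D.grp (D.g j)) ⊗ₜ D.gen j := by
  rw [B, genL, genR, Algebra.TensorProduct.tmul_mul_tmul, one_mul]

/-- The conditions `g_i g_j = 1` and `χ_i χ_j = 1` on `Γ`, for `i ≠ j`, under which `x_i ⊗ x_j` is
an invariant and coinvariant element of the braided tensor square. -/
structure IsLinked (i j : Fin θ) : Prop where
  ne : i ≠ j
  g_mul_g : D.g i * D.g j = 1
  χ_mul_χ : ∀ s ∈ D.Γ, (D.χ i s : k) * D.χ j s = 1

namespace IsLinked

variable {D} {i j : Fin θ} (h : D.IsLinked i j)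
include h

lemma symm : D.IsLinked j i :=
  ⟨h.ne.symm, by rw [← D.g_central]; exact h.g_mul_g,
    fun s hs => by rw [mul_comm]; exact h.χ_mul_χ s hs⟩

/-- One has `q_{ij} = q_{ii}⁻¹ = q_{ji}` and `q_{ij} q_{ji} = 1`, hence `q_{ij} = ±1`; the sign is
negative because `q_{ii} ≠ 1`. -/
lemma q_eq : D.q i j = -1 := by
  have h1 : D.q i i * D.q i j = 1 := h.χ_mul_χ _ (D.g_mem_Γ i)
  have h2 : D.q i i * D.q j i = 1 := by
    have : (D.χ i (D.g i) : k) * D.χ i (D.g j) = 1 := by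
      rw [← Units.val_mul, ← map_mul, h.g_mul_g, map_one, Units.val_one]
    exact this
  have h3 : D.q i j = D.q j i := mul_left_cancel₀ (D.q_ne_zero i i) (h1.trans h2.symm)
  have h4 := D.q_mul_q h.ne
  rw [← h3] at h4
  rcases mul_self_eq_one_iff.mp h4 with h5 | h5
  · rw [h5, mul_one] at h1
    have := D.one_lt_N i
    rw [N, h1, orderOf_one] at this
    exact absurd this (lt_irrefl _)
  · exact h5

lemma q_self : D.q i i = -1 := by
  have h1 : D.q i i * D.q i j = 1 := h.χ_mul_χ _ (D.g_mem_Γ i)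
  rw [h.q_eq, mul_neg_one] at h1
  rw [← h1, neg_neg]

lemma N_eq [CharZero k] : D.N i = 2 := by
  rw [N, h.q_self]
  exact orderOf_eq_prime (by norm_num) (by norm_num)

lemma q_mul_q (l : Fin θ) : D.q l i * D.q l j = 1 := h.χ_mul_χ _ (D.g_mem_Γ l)

lemma genL_mul_self [CharZero k] : D.genL i * D.genL i = 0 := by
  rw [← pow_two]; exact D.genL_pow_of_le h.N_eq.le

lemma genR_mul_self [CharZero k] : D.genR i * D.genR i = 0 := by
  rw [← pow_two]; exact D.genR_pow_of_le h.N_eq.le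

lemma commute_genL [CharZero k] (l : Fin θ) : Commute (D.genL l) (D.B i j) := by
  rw [Commute, SemiconjBy, B]
  rcases eq_or_ne l i with rfl | hl
  · rw [← mul_assoc, h.genL_mul_self, zero_mul, mul_assoc, genR_mul_genL, mul_smul_comm,
      ← mul_assoc, h.genL_mul_self, zero_mul, smul_zero]
  · rw [← mul_assoc, D.genL_mul_genL hl, smul_mul_assoc, mul_assoc, mul_assoc, genR_mul_genL,
      mul_smul_comm]
    congr 1
    rcases eq_or_ne l j with rfl | hl'
    · rw [h.symm.q_eq, h.symm.q_self]
    · have h1 := h.q_mul_q l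
      have h2 := D.q_mul_q hl'
      rw [mul_comm] at h1
      exact mul_left_cancel₀ (D.q_ne_zero l j) (h1.trans h2.symm)

lemma commute_genR [CharZero k] (l : Fin θ) : Commute (D.genR l) (D.B i j) := by
  rw [Commute, SemiconjBy, B]
  rcases eq_or_ne l j with rfl | hl
  · rw [← mul_assoc, genR_mul_genL, smul_mul_assoc, mul_assoc, h.symm.genR_mul_self,
      mul_zero, smul_zero]
  · rw [← mul_assoc, genR_mul_genL, smul_mul_assoc, mul_assoc, D.genR_mul_genR hl, mul_smul_comm,
      smul_smul, h.q_mul_q, one_smul, mul_assoc]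

lemma commute_B [CharZero k] (l m : Fin θ) : Commute (D.B l m) (D.B i j) :=
  (h.commute_genL l).mul_left (h.commute_genR m)

lemma commute_T [CharZero k] (l : Fin θ) : Commute (D.T l) (D.B i j) := by
  rw [T, coprodDivPow]
  refine Commute.sum_left _ _ _ fun ab _ => Commute.mul_left ?_ ?_
  · exact ((h.commute_genL l).pow_left _).smul_left _
  · exact ((h.commute_genR l).pow_left _).smul_left _

lemma mem_infTwist [CharZero k] : D.B i j ∈ D.infTwist := by
  refine ⟨fun y hy => commute_comul_of_gen (fun l => ?_) (fun s hs => ?_) hy, ?_, ?_, ?_, ?_⟩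
  · rw [comul_gen_eq]
    exact ((h.commute_genL l).add_left (h.commute_genR l)).symm
  · refine Commute.symm ?_
    rw [Commute, SemiconjBy, B, ← mul_assoc, grpDiag_mul_genL, smul_mul_assoc, mul_assoc,
      grpDiag_mul_genR, mul_smul_comm, smul_smul, h.χ_mul_χ s hs, one_smul, mul_assoc]
  · rw [B_eq]
    exact Submodule.subset_span ⟨_, Subalgebra.mul_mem _ (D.gen_mem_subΓ i)
      (D.grp_mem_subΓ (D.g_mem_Γ j)), _, D.gen_mem_subΓ j, rfl⟩
  · have hg : D.grp (D.g i) * D.grp (D.g j) = 1 := by rw [← map_mul, h.g_mul_g, map_one]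
    rw [B_eq]
    simp only [comulLeft_tmul, comulRight_tmul, Bialgebra.comul_mul, comul_gen, comul_grp, add_mul,
      Algebra.TensorProduct.tmul_mul_tmul, one_mul, hg, TensorProduct.add_tmul,
      TensorProduct.tmul_add, map_add, Algebra.TensorProduct.assoc_tmul]
    abel
  · rw [B_eq]; simp
  · rw [B_eq]; simp

end IsLinked

lemma grpDiag_mul_B (s : G) (i j : Fin θ) :
    D.grpDiag s * D.B i j = ((D.χ i s : k) * D.χ j s) • (D.B i j * D.grpDiag s) := by
  rw [B, ← mul_assoc, grpDiag_mul_genL, smul_mul_assoc, mul_assoc,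
    grpDiag_mul_genR, mul_smul_comm, smul_smul, mul_assoc]

end QLSDatum

/-! ### Commuting nilpotent elements -/

section NilSpan

variable {k A : Type*} [Field k] [Ring A] [Algebra k A] {S : Set A}

lemma commute_of_mem_span (hS : ∀ x ∈ S, ∀ y ∈ S, Commute x y) {x y : A}
    (hx : x ∈ Submodule.span k S) (hy : y ∈ Submodule.span k S) : Commute x y := by
  have h : ∀ y ∈ S, Commute x y := by
    intro y hy
    induction hx using Submodule.span_induction with
    | mem x hx => exact hS x hx y hy
    | zero => exact Commute.zero_left _
    | add a b _ _ ha hb => exact ha.add_left hb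
    | smul c a _ ha => exact ha.smul_left c
  induction hy using Submodule.span_induction with
  | mem y hy => exact h y hy
  | zero => exact Commute.zero_right _
  | add a b _ _ ha hb => exact ha.add_right hb
  | smul c a _ ha => exact ha.smul_right c

lemma isNilpotent_of_mem_span (hS : ∀ x ∈ S, ∀ y ∈ S, Commute x y)
    (hn : ∀ x ∈ S, IsNilpotent x) {x : A} (hx : x ∈ Submodule.span k S) : IsNilpotent x := by
  induction hx using Submodule.span_induction with
  | mem x hx => exact hn x hx
  | zero => exact IsNilpotent.zero
  | add a b ha' hb' ha hb => exact (commute_of_mem_span hS ha' hb').isNilpotent_add ha hb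
  | smul c a _ ha => exact ha.smul c

lemma nilExp_list_sum [CharZero k] {P : Submodule k A} (hP : ∀ x ∈ P, ∀ y ∈ P, Commute x y)
    (hn : ∀ x ∈ P, IsNilpotent x) {ι : Type*} {f : ι → A} (L : List ι) (hL : ∀ i ∈ L, f i ∈ P) :
    (L.map f).sum ∈ P ∧ nilExp k (L.map f).sum = (L.map fun i => nilExp k (f i)).prod := by
  induction L with
  | nil => simp
  | cons i L ih =>
    obtain ⟨h1, h2⟩ := ih fun j hj => hL j (List.mem_cons_of_mem _ hj)
    have hi := hL i List.mem_cons_self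
    rw [List.map_cons, List.sum_cons, List.map_cons, List.prod_cons, ← h2]
    exact ⟨P.add_mem hi h1, nilExp_add k (hP _ hi _ h1) (hn _ hi) (hn _ h1)⟩

end NilSpan

namespace QLSDatum

open Coalgebra Bialgebra

variable {k G : Type*} [Field k] [Group G] {θ : ℕ} (D : QLSDatum k G θ)

/-! ### The logarithm of the twist -/

/-- The conditions `g_i ^ N_i = 1` and `χ_i ^ N_i = 1` on `Γ`, under which `T i` is an invariant and
coinvariant element of the braided tensor square. -/
structure IsLiftable (i : Fin θ) : Prop where
  g_pow : D.g i ^ D.N i = 1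
  χ_pow : ∀ s ∈ D.Γ, (D.χ i s : k) ^ D.N i = 1

/-- The elements `T i` and `B i j` that can occur in a twist. -/
def twistTerms : Set D.SmashSq :=
  {X | ∃ i, D.IsLiftable i ∧ D.T i = X} ∪ {X | ∃ i j, D.IsLinked i j ∧ D.B i j = X}

/-- The space in which the logarithms of the twists lie. Its elements commute and are nilpotent. -/
def twistSpan : Submodule k D.SmashSq := Submodule.span k D.twistTerms

lemma commute_T_T {i j : Fin θ} (hi : D.IsLiftable i) : Commute (D.T i) (D.T j) := by
  rcases eq_or_ne i j with rfl | h
  · exact Commute.refl _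
  · change Commute _ (D.coprodDivPow j (D.N j))
    rw [coprodDivPow]
    exact Commute.sum_right _ _ _ fun ab _ =>
      (((D.commute_T_genL h hi.χ_pow).symm.pow_right _).smul_right _).mul_right
        (((D.commute_T_genR h hi.χ_pow).symm.pow_right _).smul_right _)

section

variable [CharZero k]

lemma twistTerms_commute : ∀ X ∈ D.twistTerms, ∀ Y ∈ D.twistTerms, Commute X Y := by
  rintro _ (⟨i, hi, rfl⟩ | ⟨i, j, hij, rfl⟩) _ (⟨l, hl, rfl⟩ | ⟨l, m, hlm, rfl⟩)
  · exact D.commute_T_T hi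
  · exact hlm.commute_T i
  · exact (hij.commute_T l).symm
  · exact hlm.commute_B i j

lemma IsLinked.B_mul_B {D : QLSDatum k G θ} {i j : Fin θ} (h : D.IsLinked i j) :
    D.B i j * D.B i j = 0 := by
  nth_rw 1 [B]
  rw [mul_assoc, (h.commute_genR j).eq, B, mul_assoc (D.genL i), h.symm.genR_mul_self, mul_zero,
    mul_zero]

lemma isNilpotent_of_mul_self {A : Type*} [Ring A] {a : A} (h : a * a = 0) : IsNilpotent a :=
  ⟨2, by rw [pow_two, h]⟩

lemma twistTerms_isNilpotent : ∀ X ∈ D.twistTerms, IsNilpotent X := by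
  rintro _ (⟨i, hi, rfl⟩ | ⟨i, j, hij, rfl⟩)
  · exact isNilpotent_of_mul_self (D.T_mul_T i)
  · exact isNilpotent_of_mul_self hij.B_mul_B

variable {D}

lemma twistSpan_commute {X Y : D.SmashSq} (hX : X ∈ D.twistSpan) (hY : Y ∈ D.twistSpan) :
    Commute X Y :=
  commute_of_mem_span D.twistTerms_commute hX hY

lemma twistSpan_isNilpotent {X : D.SmashSq} (hX : X ∈ D.twistSpan) : IsNilpotent X :=
  isNilpotent_of_mem_span D.twistTerms_commute D.twistTerms_isNilpotent hX

variable (D) in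
lemma twistSpan_le_infTwist : D.twistSpan ≤ D.infTwist := by
  refine Submodule.span_le.mpr ?_
  rintro _ (⟨i, hi, rfl⟩ | ⟨i, j, hij, rfl⟩)
  · exact D.T_mem_infTwist hi.g_pow hi.χ_pow
  · exact hij.mem_infTwist

end

variable {D}

namespace ScalarFamily

variable (F : D.ScalarFamily)

/-- Compatibility and `Γ`-invariance, as a condition on the support of a family of scalars. -/
structure IsAdmissible : Prop where
  isLinked : ∀ i j, i ≠ j → F.a i j ≠ 0 → D.IsLinked i j
  isLiftable : ∀ i, F.ξ i ≠ 0 → D.IsLiftable i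

lemma isAdmissible (hc : F.IsCompatible) (hΓ : F.IsInvariant (D.Γ : Set G)) :
    F.IsAdmissible where
  isLinked i j hij h := ⟨hij, by_contra fun hg => h (hc.1 i j hij hg), fun s hs => by
    have := (hΓ s hs).1 i j hij
    exact mul_right_cancel₀ h (this.trans (one_mul _).symm)⟩
  isLiftable i h := ⟨by_contra fun hg => h (hc.2 i hg), fun s hs => by
    have := (hΓ s hs).2 i
    exact mul_right_cancel₀ h (this.trans (one_mul _).symm)⟩

/-- The term of the logarithm of the twist at `x_i ⊗ x_j`. -/
def bTerm (i j : Fin θ) : D.SmashSq := if i = j then 0 else F.a i j • D.B i j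

/-- The logarithm `∑_i ξ_i T_i + ∑_{i ≠ j} a_{ij} B_{ij}` of the twist. -/
def logJ : D.SmashSq := ∑ i, F.ξ i • D.T i + ∑ i, ∑ j, F.bTerm i j

variable {F}

lemma IsAdmissible.T_mem (hF : F.IsAdmissible) (i : Fin θ) : F.ξ i • D.T i ∈ D.twistSpan := by
  rcases eq_or_ne (F.ξ i) 0 with h | h
  · rw [h, zero_smul]; exact Submodule.zero_mem _
  · exact Submodule.smul_mem _ _ (Submodule.subset_span (Or.inl ⟨i, hF.isLiftable i h, rfl⟩))

lemma IsAdmissible.bTerm_mem (hF : F.IsAdmissible) (i j : Fin θ) :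
    F.bTerm i j ∈ D.twistSpan := by
  rw [bTerm]
  split_ifs with hij
  · exact Submodule.zero_mem _
  rcases eq_or_ne (F.a i j) 0 with h | h
  · rw [h, zero_smul]; exact Submodule.zero_mem _
  · exact Submodule.smul_mem _ _
      (Submodule.subset_span (Or.inr ⟨i, j, hF.isLinked i j hij h, rfl⟩))

lemma IsAdmissible.logJ_mem (hF : F.IsAdmissible) : F.logJ ∈ D.twistSpan :=
  Submodule.add_mem _ (Submodule.sum_mem _ fun i _ => hF.T_mem i)
    (Submodule.sum_mem _ fun i _ => Submodule.sum_mem _ fun j _ => hF.bTerm_mem i j)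

section

variable [CharZero k]

lemma IsAdmissible.bTerm_mul_self (hF : F.IsAdmissible) (i j : Fin θ) :
    F.bTerm i j * F.bTerm i j = 0 := by
  rw [bTerm]
  split_ifs with hij
  · exact zero_mul _
  rcases eq_or_ne (F.a i j) 0 with h | h
  · rw [h, zero_smul, zero_mul]
  · rw [smul_mul_smul_comm, (hF.isLinked i j hij h).B_mul_B, smul_zero]

/-- The twist as an element of the tensor square of the bosonization. -/
def IsAdmissible.twist (hF : F.IsAdmissible) : D.SmashSqˣ :=
  nilExpUnit k (twistSpan_isNilpotent hF.logJ_mem)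

lemma IsAdmissible.isTwist (hF : F.IsAdmissible) : IsTwist hF.twist :=
  isTwist_nilExpUnit (D.twistSpan_le_infTwist hF.logJ_mem) _

lemma IsAdmissible.nilExp_logJ (hF : F.IsAdmissible) : nilExp k F.logJ =
    ((List.finRange θ).map fun i => 1 + F.ξ i • D.T i).prod *
    ((List.finRange θ).map fun i =>
      ((List.finRange θ).map fun j => 1 + F.bTerm i j).prod).prod := by
  have hc : ∀ x ∈ D.twistSpan, ∀ y ∈ D.twistSpan, Commute x y := fun _ hx _ hy =>
    twistSpan_commute hx hy
  have hn : ∀ x ∈ D.twistSpan, IsNilpotent x := fun _ hx => twistSpan_isNilpotent hx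
  have h1 := nilExp_list_sum (k := k) hc hn (List.finRange θ) (f := fun i => F.ξ i • D.T i)
    fun i _ => hF.T_mem i
  have h2 := fun i => nilExp_list_sum (k := k) hc hn (List.finRange θ)
    (f := fun j => F.bTerm i j) fun j _ => hF.bTerm_mem i j
  have h3 := nilExp_list_sum (k := k) hc hn (List.finRange θ)
    (f := fun i => ((List.finRange θ).map fun j => F.bTerm i j).sum) fun i _ => (h2 i).1
  rw [logJ, Fin.sum_univ_def]
  simp only [Fin.sum_univ_def]
  rw [nilExp_add k (hc _ h1.1 _ h3.1) (hn _ h1.1) (hn _ h3.1), h1.2, h3.2]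
  simp only [(h2 _).2]
  congr 3
  · funext i
    exact nilExp_of_mul_self k (by rw [smul_mul_smul_comm, D.T_mul_T, smul_zero])
  · funext i
    congr 2
    funext j
    exact nilExp_of_mul_self k (hF.bTerm_mul_self i j)

lemma IsAdmissible.commute_twist_grpDiag (hF : F.IsAdmissible) {s : G} (hs : s ∈ D.Γ) :
    Commute (D.grpDiag s) hF.twist.val := by
  refine commute_nilExp k ?_ (twistSpan_isNilpotent hF.logJ_mem)
  rw [grpDiag_apply, ← comul_grp]
  exact (mem_infTwist_commute (D.twistSpan_le_infTwist hF.logJ_mem) (D.grp_mem_subΓ hs)).symm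

end

end ScalarFamily

/-! ### The algebra `A(V, G, 𝒟)` -/

variable (D)

/-- The algebra map `𝔅(V) ⊗ kG → 𝔅(V) # kG` which is the identity on the underlying spaces. -/
def bgToSmash : D.BG →ₐ[k] D.NicholsSmash := AlgHom.id k (SkewMonoidAlgebra D.Nichols G)

lemma bgToSmash_single (s : G) (v : D.Nichols) :
    D.bgToSmash (D.singleBG s v) = D.smashSingle s v := rfl

/-- The algebra map `(v ⊗ s) # h ↦ v # s h`. -/
def foldSmash : D.BGSmash →ₐ[k] D.NicholsSmash :=
  SkewMonoidAlgebra.liftNCAlgHom (A := D.BG) (G := D.Γ) D.bgToSmash (D.grp.comp D.Γ.subtype) (by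
    intro b h
    refine D.BG_induction' (p := fun b => D.bgToSmash (h • b) * (D.grp.comp D.Γ.subtype) h =
      (D.grp.comp D.Γ.subtype) h * D.bgToSmash b) ?_ ?_ ?_ b
    · simp
    · intro a b ha hb
      simp only [smul_add, map_add, add_mul, mul_add, ha, hb]
    · intro s v
      rw [smul_singleBG, bgToSmash_single, bgToSmash_single, MonoidHom.comp_apply,
        Subgroup.subtype_apply, ← smashSingle_one_right, smashSingle_mul, smashSingle_mul,
        smul_one, mul_one, one_mul, D.Γ_comm, Subgroup.smul_def])

lemma foldSmash_single (h : D.Γ) (b : D.BG) :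
    D.foldSmash (SkewMonoidAlgebra.single h b) = D.bgToSmash b * D.grp h :=
  SkewMonoidAlgebra.liftNC_single _ _ _ _

lemma bgSmash_induction {p : D.BGSmash → Prop} (h0 : p 0)
    (hadd : ∀ a b, p a → p b → p (a + b))
    (h : ∀ (h : D.Γ) (s : G) (v : D.Nichols),
      p (SkewMonoidAlgebra.single h (D.singleBG s v))) (z : D.BGSmash) : p z := by
  refine SkewMonoidAlgebra.induction_on (k := D.BG) (G := D.Γ) z h0 (fun t b => ?_) hadd
  refine D.BG_induction' (p := fun b => p (SkewMonoidAlgebra.single t b)) ?_ ?_ (h t) b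
  · rwa [SkewMonoidAlgebra.single_zero]
  · intro a b ha hb
    rw [SkewMonoidAlgebra.single_add]
    exact hadd _ _ ha hb

/-- The algebra map `b ↦ b # 1`. -/
def bgToBGSmash : D.BG →ₐ[k] D.BGSmash where
  __ := (SkewMonoidAlgebra.singleOneRingHom : D.BG →+* SkewMonoidAlgebra D.BG D.Γ)
  commutes' _ := rfl

/-- The algebra map `A(V, G, 𝒟) → 𝔅(V) # kG` induced by `foldSmash`. -/
def aToSmash : D.A →ₐ[k] D.NicholsSmash :=
  RingQuot.liftAlgHom k ⟨D.foldSmash, by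
    rintro _ _ ⟨h⟩
    rw [foldSmash_single, foldSmash_single, bgToSmash_single, smashSingle_one_right,
      Subgroup.coe_one, map_one, map_one, mul_one, one_mul]⟩

lemma aToSmash_toA (z : D.BGSmash) : D.aToSmash (D.toA z) = D.foldSmash z :=
  RingQuot.liftAlgHom_mkAlgHom_apply _ _ _ _

lemma toA_glue (h : D.Γ) : D.toA (SkewMonoidAlgebra.single 1 (D.singleBG (h : G) 1)) =
    D.toA (SkewMonoidAlgebra.single h (1 : D.BG)) :=
  RingQuot.mkAlgHom_rel k (GlueRel.glue h)

/-- The algebra map `v # s ↦ (v ⊗ s) # 1`, inverse to `aToSmash`. -/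
def smashToA : D.NicholsSmash →ₐ[k] D.A := D.toA.comp D.bgToBGSmash

lemma smashToA_single (s : G) (v : D.Nichols) : D.smashToA (D.smashSingle s v) =
    D.toA (SkewMonoidAlgebra.single 1 (D.singleBG s v)) := rfl

lemma smashToA_foldSmash (z : D.BGSmash) : D.smashToA (D.foldSmash z) = D.toA z := by
  refine D.bgSmash_induction (p := fun z => D.smashToA (D.foldSmash z) = D.toA z) ?_ ?_ ?_ z
  · simp
  · intro a b ha hb
    rw [map_add, map_add, map_add, ha, hb]
  · intro h s v
    rw [foldSmash_single, map_mul, bgToSmash_single, ← smashSingle_one_right, smashToA_single,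
      smashToA_single, toA_glue, ← map_mul, SkewMonoidAlgebra.single_mul_single, one_mul,
      smul_one, mul_one]

/-- As an algebra, `A(V, G, 𝒟)` is `𝔅(V) # kG`. -/
def aEquiv : D.A ≃ₐ[k] D.NicholsSmash :=
  AlgEquiv.ofAlgHom D.aToSmash D.smashToA
    (by
      ext a
      induction a using D.smash_induction_single with
      | zero => simp
      | add a b ha hb => rw [map_add, map_add, ha, hb]
      | single s v =>
        change D.aToSmash (D.smashToA (D.smashSingle s v)) = _
        rw [smashToA_single, aToSmash_toA, foldSmash_single, bgToSmash_single, Subgroup.coe_one,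
          map_one, mul_one]
        rfl)
    (by
      ext a
      obtain ⟨z, rfl⟩ := RingQuot.mkAlgHom_surjective k D.GlueRel a
      change D.smashToA (D.aToSmash (D.toA z)) = D.toA z
      rw [aToSmash_toA, smashToA_foldSmash])

lemma aEquiv_toA (z : D.BGSmash) : D.aEquiv (D.toA z) = D.foldSmash z := D.aToSmash_toA z

lemma aEquiv_symm_foldSmash (z : D.BGSmash) : D.aEquiv.symm (D.foldSmash z) = D.toA z :=
  D.smashToA_foldSmash z

/-! ### The comultiplication of `A(V, G, 𝒟)` -/

/-- The algebra map from the braided tensor square of `𝔅(V) ⊗ kG` to the tensor square of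
`𝔅(V) # kG`. -/
def bgSqToSmashSq : BraidedTensor k D.Γ D.BG →ₐ[k] D.SmashSq :=
  (Algebra.TensorProduct.map D.foldSmash D.foldSmash).comp (bosonHom k D.Γ D.BG)

lemma bgSqToSmashSq_single {g : D.Γ} {w : D.Nichols} (hw : IsHomogeneousYD k D.Γ D.Nichols g w)
    (s t : G) (v : D.Nichols) :
    D.bgSqToSmashSq (BraidedTensor.equiv k D.Γ D.BG (D.singleBG s v ⊗ₜ D.singleBG t w)) =
      (D.smashSingle s v * D.grp g) ⊗ₜ D.smashSingle t w := by
  have h : IsHomogeneousYD k D.Γ D.BG g (D.singleBG t w) := D.coactionBG_single t hw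
  rw [bgSqToSmashSq, AlgHom.comp_apply, bosonHom_equiv h, Algebra.TensorProduct.map_tmul,
    foldSmash_single, foldSmash_single, bgToSmash_single, bgToSmash_single, Subgroup.coe_one,
    map_one, mul_one]

/-- The algebra map from the braided tensor square of `𝔅(V)` to that of `𝔅(V) ⊗ kG`. -/
def toBGSq : BraidedTensor k D.Γ D.Nichols →ₐ[k] BraidedTensor k D.Γ D.BG :=
  AlgHom.ofLinearMap ((BraidedTensor.equiv k D.Γ D.BG).toLinearMap ∘ₗ
      TensorProduct.map D.toBG.toLinearMap D.toBG.toLinearMap ∘ₗ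
      (BraidedTensor.equiv k D.Γ D.Nichols).symm.toLinearMap)
    (by simp [BraidedTensor.one_def])
    (by
      intro x y
      set f := (BraidedTensor.equiv k D.Γ D.BG).toLinearMap ∘ₗ
        TensorProduct.map D.toBG.toLinearMap D.toBG.toLinearMap ∘ₗ
        (BraidedTensor.equiv k D.Γ D.Nichols).symm.toLinearMap with hf
      have hfe : ∀ a b, f (BraidedTensor.equiv k D.Γ D.Nichols (a ⊗ₜ b)) =
          BraidedTensor.equiv k D.Γ D.BG (D.singleBG 1 a ⊗ₜ D.singleBG 1 b) := fun a b => by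
        simp [hf, toBG_apply]
      refine BraidedTensor.induction_equiv (p := fun x => f (x * y) = f x * f y) ?_ ?_ ?_ x
      · intro g a b hb
        obtain ⟨y, rfl⟩ := (BraidedTensor.equiv k D.Γ D.Nichols).surjective y
        induction y with
        | zero => simp
        | add y y' hy hy' => simp only [map_add, mul_add, hy, hy']
        | tmul c d =>
          have h : IsHomogeneousYD k D.Γ D.BG g (D.singleBG 1 b) := D.coactionBG_single 1 hb
          rw [BraidedTensor.equiv_mul_equiv hb, hfe, hfe, hfe, BraidedTensor.equiv_mul_equiv h,
            smul_singleBG, singleBG_mul, singleBG_mul, one_smul, one_smul, one_mul]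
      · simp
      · intro x x' hx hx'
        simp only [add_mul, map_add, hx, hx'])

lemma toBGSq_equiv (a b : D.Nichols) : D.toBGSq (BraidedTensor.equiv k D.Γ D.Nichols (a ⊗ₜ b)) =
    BraidedTensor.equiv k D.Γ D.BG (D.singleBG 1 a ⊗ₜ D.singleBG 1 b) := rfl

lemma ScalarFamily.toBGSq_J (F : D.ScalarFamily) : D.toBGSq F.J = F.JBG := rfl

/-- The algebra map from the braided tensor square of `𝔅(V)` to the tensor square of
`𝔅(V) # kG`. -/
def nicholsSqToSmashSq : BraidedTensor k D.Γ D.Nichols →ₐ[k] D.SmashSq :=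
  D.bgSqToSmashSq.comp D.toBGSq

lemma nicholsSqToSmashSq_equiv {g : D.Γ} {w : D.Nichols}
    (hw : IsHomogeneousYD k D.Γ D.Nichols g w) (v : D.Nichols) :
    D.nicholsSqToSmashSq (BraidedTensor.equiv k D.Γ D.Nichols (v ⊗ₜ w)) =
      (D.ofNichols v * D.grp g) ⊗ₜ D.ofNichols w := by
  rw [nicholsSqToSmashSq, AlgHom.comp_apply, toBGSq_equiv, D.bgSqToSmashSq_single hw]
  rfl

lemma isHomogeneousYD_x (i : Fin θ) : IsHomogeneousYD k D.Γ D.Nichols (D.gΓ i) (D.x i) :=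
  D.nicholsCoaction_x D.gΓ D.gΓ_central i

lemma isHomogeneousYD_x_pow (i : Fin θ) (n : ℕ) :
    IsHomogeneousYD k D.Γ D.Nichols (D.gΓ i ^ n) (D.x i ^ n) := by
  induction n with
  | zero => simpa using IsHomogeneousYD.one
  | succ n ih => rw [pow_succ, pow_succ]; exact ih.mul (D.isHomogeneousYD_x i)

lemma nicholsSqToSmashSq_x_pow (i j : Fin θ) (m n : ℕ) :
    D.nicholsSqToSmashSq (BraidedTensor.equiv k D.Γ D.Nichols
      ((D.x i ^ m : D.Nichols) ⊗ₜ (D.x j ^ n : D.Nichols))) =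
      (D.gen i ^ m * D.grp (D.g j) ^ n) ⊗ₜ (D.gen j ^ n) := by
  rw [D.nicholsSqToSmashSq_equiv (D.isHomogeneousYD_x_pow j n), Subgroup.coe_pow, map_pow, map_pow,
    map_pow]
  rfl

lemma nicholsSqToSmashSq_comp_nicholsComul (v : D.Nichols) :
    D.nicholsSqToSmashSq (D.nicholsComul v) = comul (R := k) (D.ofNichols v) := by
  have : D.nicholsSqToSmashSq.comp D.nicholsComul = (comulAlgHom k D.NicholsSmash).comp
      D.ofNichols := by
    refine nichols_algHom_ext fun i => ?_
    have h1 := D.nicholsSqToSmashSq_x_pow i i 1 0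
    have h2 := D.nicholsSqToSmashSq_x_pow i i 0 1
    simp only [pow_one, pow_zero, mul_one, one_mul] at h1 h2
    rw [AlgHom.comp_apply, nicholsComul_x, map_add, map_add, h1, h2]
    exact (D.comul_gen i).symm
  exact DFunLike.congr_fun this v

/-- The braided comultiplication of `𝔅(V) ⊗ kG` becomes the comultiplication of the
bosonization. -/
lemma bgSqToSmashSq_comulBG (s : G) (v : D.Nichols) :
    D.bgSqToSmashSq (D.comulBG (D.singleBG s v)) = comul (R := k) (D.smashSingle s v) := by
  have h : ∀ z : BraidedTensor k D.Γ D.Nichols,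
      D.bgSqToSmashSq (BraidedTensor.equiv k D.Γ D.BG (TensorProduct.map (D.singleBG s)
        (D.singleBG s) ((BraidedTensor.equiv k D.Γ D.Nichols).symm z))) =
        D.nicholsSqToSmashSq z * D.grpDiag s := by
    intro z
    refine BraidedTensor.induction_equiv (p := fun z =>
      D.bgSqToSmashSq (BraidedTensor.equiv k D.Γ D.BG (TensorProduct.map (D.singleBG s)
        (D.singleBG s) ((BraidedTensor.equiv k D.Γ D.Nichols).symm z))) =
        D.nicholsSqToSmashSq z * D.grpDiag s) ?_ ?_ ?_ z
    · intro g a b hb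
      rw [LinearEquiv.symm_apply_apply, TensorProduct.map_tmul, D.bgSqToSmashSq_single hb,
        D.nicholsSqToSmashSq_equiv hb, grpDiag_apply, Algebra.TensorProduct.tmul_mul_tmul,
        ← ofNichols_mul_grp, ← ofNichols_mul_grp, mul_assoc, mul_assoc, ← map_mul, ← map_mul,
        D.Γ_comm]
    · simp
    · intro x y hx hy
      simp only [map_add, add_mul, hx, hy]
  have h1 : D.comulBG (D.singleBG s v) = BraidedTensor.equiv k D.Γ D.BG
      (TensorProduct.map (D.singleBG s) (D.singleBG s)
        ((BraidedTensor.equiv k D.Γ D.Nichols).symm (D.nicholsComul v))) := by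
    rw [comulBG, LinearMap.comp_apply, liftBG_single]
    rfl
  rw [h1, h, nicholsSqToSmashSq_comp_nicholsComul, ← ofNichols_mul_grp, Bialgebra.comul_mul,
    comul_grp, grpDiag_apply]

namespace ScalarFamily

variable {D} {F : D.ScalarFamily}

lemma isUnit_one_add {A : Type*} [Ring A] {X : A} (h : X * X = 0) : IsUnit (1 + X) :=
  ⟨⟨1 + X, 1 - X, by simp [mul_sub, add_mul, h], by simp [sub_mul, mul_add, h]⟩, rfl⟩

lemma smul_x_pow (s : G) (i : Fin θ) (n : ℕ) :
    s • (D.x i ^ n : D.Nichols) = (D.χ i s : k) ^ n • (D.x i ^ n : D.Nichols) := by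
  rw [smul_pow', smul_x, smul_pow]

variable (F) in
lemma isUnit_Jξ (i : Fin θ) : IsUnit (F.Jξ i) := by
  rw [Jξ, map_add, ← BraidedTensor.one_def]
  refine isUnit_one_add ?_
  rw [map_sum, Finset.sum_mul]
  refine Finset.sum_eq_zero fun a ha => ?_
  rw [Finset.mul_sum]
  refine Finset.sum_eq_zero fun b hb => ?_
  rw [Finset.mem_Ioo] at ha hb
  rw [map_smul, map_smul, smul_mul_smul_comm,
    BraidedTensor.equiv_mul_equiv (D.isHomogeneousYD_x_pow i a), Subgroup.smul_def,
    smul_x_pow, mul_smul_comm, ← pow_add, ← pow_add]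
  -- either the first or the second exponent is at least `N_i`
  rcases le_or_gt (D.N i) (a + b) with h | h
  · rw [pow_eq_zero_of_le h (D.x_pow i)]; simp
  · rw [pow_eq_zero_of_le (show D.N i ≤ D.N i - a + (D.N i - b) by omega) (D.x_pow i)]; simp

lemma qExp_zero {A : Type*} [Ring A] [Algebra k A] (q : k) {N : ℕ} (hN : 0 < N) :
    qExp q N (0 : A) = 1 := by
  obtain ⟨N, rfl⟩ : ∃ M, N = M + 1 := ⟨N - 1, by omega⟩
  rw [qExp, Finset.sum_range_succ',
    Finset.sum_eq_zero fun i _ => by rw [zero_pow (by omega), smul_zero]]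
  simp [qFactorial]

lemma qExp_two {A : Type*} [Ring A] [Algebra k A] (q : k) (x : A) : qExp q 2 x = 1 + x := by
  simp [qExp, Finset.sum_range_succ, qFactorial, qNumber]

/-- If `a_{ij} ≠ 0`, then `N_i = 2` and the `q`-exponential has two terms. -/
lemma IsAdmissible.expB_eq [CharZero k] (hF : F.IsAdmissible) {i j : Fin θ} (hij : i ≠ j) :
    F.expB i j = 1 + BraidedTensor.equiv k D.Γ D.Nichols (F.a i j • (D.x i ⊗ₜ[k] D.x j)) := by
  rw [expB]
  rcases eq_or_ne (F.a i j) 0 with h | h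
  · rw [h, zero_smul, map_zero, qExp_zero _ (by have := D.one_lt_N i; omega), add_zero]
  · rw [(hF.isLinked i j hij h).N_eq, qExp_two]

lemma IsAdmissible.isUnit_expB [CharZero k] (hF : F.IsAdmissible) {i j : Fin θ} (hij : i ≠ j) :
    IsUnit (F.expB i j) := by
  rw [hF.expB_eq hij]
  refine isUnit_one_add ?_
  rcases eq_or_ne (F.a i j) 0 with h | h
  · rw [h, zero_smul, map_zero, zero_mul]
  · have hx : D.x j * D.x j = 0 := by
      rw [← pow_two, ← (hF.isLinked i j hij h).symm.N_eq, D.x_pow]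
    rw [map_smul, smul_mul_smul_comm, BraidedTensor.equiv_mul_equiv (D.isHomogeneousYD_x j), hx,
      TensorProduct.tmul_zero, map_zero, smul_zero]

lemma isUnit_list_prod {A : Type*} [Monoid A] {L : List A} (h : ∀ a ∈ L, IsUnit a) :
    IsUnit L.prod := by
  induction L with
  | nil => simp
  | cons a L ih =>
    rw [List.prod_cons]
    exact (h a List.mem_cons_self).mul (ih fun b hb => h b (List.mem_cons_of_mem _ hb))

lemma IsAdmissible.isUnit_J [CharZero k] (hF : F.IsAdmissible) : IsUnit F.J := by
  refine IsUnit.mul (isUnit_list_prod ?_) (isUnit_list_prod ?_)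
  · intro a ha
    obtain ⟨i, -, rfl⟩ := List.mem_map.mp ha
    exact F.isUnit_Jξ i
  · intro a ha
    obtain ⟨i, -, rfl⟩ := List.mem_map.mp ha
    refine isUnit_list_prod fun a ha => ?_
    obtain ⟨j, -, rfl⟩ := List.mem_map.mp ha
    split_ifs with hij
    · exact isUnit_one
    · exact hF.isUnit_expB hij

variable (F) in
lemma nicholsSqToSmashSq_Jξ (i : Fin θ) : D.nicholsSqToSmashSq (F.Jξ i) = 1 + F.ξ i • D.T i := by
  rw [Jξ, map_add, map_add, ← BraidedTensor.one_def, map_one, T_eq_sum, map_sum, map_sum,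
    ← Finset.Nat.sum_antidiagonal_swap, Finset.Nat.sum_antidiagonal_eq_sum_range_succ_mk,
    Finset.smul_sum]
  congr 1
  have h0 : ∀ n, D.N i ≤ n → qDivPow (D.q i i) (D.gen i) n = 0 := fun n hn =>
    qDivPow_eq_zero (D.gen_pow i) hn
  refine (Finset.sum_congr rfl fun n hn => ?_).trans
    (Finset.sum_subset (s₁ := Finset.Ioo 0 (D.N i)) ?_ ?_)
  · rw [map_smul, map_smul, nicholsSqToSmashSq_x_pow]
    simp only [Prod.swap, qDivPow, smul_mul_assoc, TensorProduct.tmul_smul,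
      ← TensorProduct.smul_tmul', smul_smul]
    congr 1
    rw [div_eq_mul_inv, mul_inv]
    ring
  · intro n hn
    rw [Finset.mem_Ioo] at hn
    exact Finset.mem_range.mpr (by omega)
  · intro n hn hn'
    rw [Finset.mem_range] at hn
    rw [Finset.mem_Ioo] at hn'
    simp only [Prod.swap]
    rcases Nat.eq_zero_or_pos n with rfl | h
    · rw [h0 (D.N i - 0) le_rfl, zero_mul, TensorProduct.zero_tmul, smul_zero]
    · rw [h0 n (by omega), TensorProduct.tmul_zero, smul_zero]

/-- The image of `J_𝒟` in the tensor square of `𝔅(V) # kG` is the exponential of `logJ`. -/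
lemma IsAdmissible.nicholsSqToSmashSq_J [CharZero k] (hF : F.IsAdmissible) :
    D.nicholsSqToSmashSq F.J = hF.twist.val := by
  refine Eq.trans ?_ hF.nilExp_logJ.symm
  rw [J, map_mul, map_list_prod, map_list_prod, List.map_map, List.map_map]
  congr 3
  · funext i
    exact F.nicholsSqToSmashSq_Jξ i
  · funext i
    rw [Function.comp_apply, map_list_prod, List.map_map]
    congr 2
    funext j
    rw [Function.comp_apply, bTerm]
    split_ifs with hij
    · rw [map_one, add_zero]
    · rw [hF.expB_eq hij, map_add, map_one, map_smul, map_smul, B_eq]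
      have := D.nicholsSqToSmashSq_x_pow i j 1 1
      simp only [pow_one] at this
      rw [this]

lemma IsAdmissible.bgSqToSmashSq_inverse [CharZero k] (hF : F.IsAdmissible) :
    D.bgSqToSmashSq (Ring.inverse F.JBG) = (hF.twist⁻¹ : D.SmashSqˣ).val := by
  have hu : IsUnit F.JBG := by
    rw [← F.toBGSq_J]
    exact hF.isUnit_J.map D.toBGSq
  have h1 : D.bgSqToSmashSq F.JBG = hF.twist.val := hF.nicholsSqToSmashSq_J
  rw [← Ring.inverse_unit, ← h1]
  obtain ⟨u, hu⟩ := hu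
  rw [← hu, Ring.inverse_unit]
  exact (Ring.inverse_unit (Units.map (D.bgSqToSmashSq : _ →* D.SmashSq) u)).symm

/-- Under the identification of `A(V, G, 𝒟)` with `𝔅(V) # kG` the comultiplication becomes the
twisted one. -/
lemma IsAdmissible.map_smashComul [CharZero k] (hF : F.IsAdmissible) (z : D.BGSmash) :
    Algebra.TensorProduct.map D.foldSmash D.foldSmash (F.smashComul z) =
      twistComul hF.twist (D.foldSmash z) := by
  refine D.bgSmash_induction (p := fun z =>
    Algebra.TensorProduct.map D.foldSmash D.foldSmash (F.smashComul z) =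
      twistComul hF.twist (D.foldSmash z)) ?_ ?_ ?_ z
  · simp
  · intro a b ha hb
    simp only [map_add, ha, hb]
  · intro h s v
    have h1 : D.bgSqToSmashSq (F.twistedComul (D.singleBG s v)) =
        (hF.twist⁻¹ : D.SmashSqˣ).val * comul (R := k) (D.smashSingle s v) * hF.twist.val := by
      have : F.twistedComul (D.singleBG s v) = Ring.inverse F.JBG * D.comulBG (D.singleBG s v) *
        F.JBG := rfl
      rw [this, map_mul, map_mul, hF.bgSqToSmashSq_inverse, bgSqToSmashSq_comulBG]
      congr 1
      exact hF.nicholsSqToSmashSq_J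
    have h2 : D.foldSmash (SkewMonoidAlgebra.single h (1 : D.BG)) = D.grp h := by
      rw [foldSmash_single, map_one, one_mul]
    rw [smashComul, bosonComul_single, map_mul, Algebra.TensorProduct.map_tmul, h2,
      foldSmash_single, bgToSmash_single, twistComul_apply, Bialgebra.comul_mul, comul_grp]
    refine (congrArg (· * D.grpDiag (h : G)) h1).trans ?_
    rw [mul_assoc, mul_assoc, ← (hF.commute_twist_grpDiag h.2).eq, grpDiag_apply]
    simp only [mul_assoc]

section

variable [CharZero k]

/-- The bialgebra `A(V, G, 𝒟)`. -/
abbrev IsAdmissible.bialgebra (hF : F.IsAdmissible) : Bialgebra k D.A :=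
  twistBialgebra D.aEquiv hF.isTwist

lemma IsAdmissible.isQuotientCoalgebra (hF : F.IsAdmissible) :
    letI := hF.bialgebra
    F.IsQuotientCoalgebra := by
  let _ := hF.bialgebra
  constructor
  · intro z
    have h1 : CoalgebraStruct.comul (R := k) (D.toA z) =
        Algebra.TensorProduct.map D.aEquiv.symm.toAlgHom D.aEquiv.symm.toAlgHom
          (twistComul hF.twist (D.aEquiv (D.toA z))) := rfl
    rw [h1, aEquiv_toA, ← hF.map_smashComul]
    generalize F.smashComul z = y
    induction y with
    | zero => simp
    | add a b ha hb => rw [map_add, map_add, map_add, ha, hb]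
    | tmul a b =>
      simp only [Algebra.TensorProduct.map_tmul, TensorProduct.map_tmul]
      exact congrArg₂ _ (D.aEquiv_symm_foldSmash a) (D.aEquiv_symm_foldSmash b)
  · intro z
    have h1 : CoalgebraStruct.counit (R := k) (D.toA z) =
        counit (R := k) (D.aEquiv (D.toA z)) := rfl
    rw [h1, aEquiv_toA]
    refine D.bgSmash_induction (p := fun z => counit (R := k) (D.foldSmash z) = F.smashCounit z)
      ?_ ?_ ?_ z
    · simp
    · intro a b ha hb
      rw [map_add, map_add, map_add, ha, hb]
    · intro h s v
      rw [foldSmash_single, Bialgebra.counit_mul, counit_grp, mul_one, bgToSmash_single,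
        smashCounit,
        bosonCounit_single, counitBG, liftBG_single]
      exact D.counit_single s v

end

end ScalarFamily

end QLSDatum

namespace QLSDatum

open Coalgebra Bialgebra

variable {k G : Type*} [Field k] [Group G] {θ : ℕ} (D : QLSDatum k G θ)

/-! ### The filtration by degree -/

/-- The space spanned by the generators `x_i`. -/
def genSpan : Submodule k D.NicholsSmash := ∑ i, k ∙ D.gen i

/-- The space spanned by the group elements. -/
def grpSpan : Submodule k D.NicholsSmash := Submodule.span k (Set.range D.grp)

lemma gen_mem_genSpan (i : Fin θ) : D.gen i ∈ D.genSpan :=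
  Finset.single_le_sum (f := fun i => k ∙ D.gen i) (fun _ _ => zero_le) (Finset.mem_univ i)
    (Submodule.mem_span_singleton_self _)

lemma grp_mem_grpSpan (s : G) : D.grp s ∈ D.grpSpan := Submodule.subset_span ⟨s, rfl⟩

lemma isNilpotent_genSpan : IsNilpotent D.genSpan := by
  refine Commute.isNilpotent_sum (fun i _ => ⟨D.N i, ?_⟩) fun i j _ _ => ?_
  · rw [Submodule.span_pow, Set.singleton_pow, gen_pow]
    simp
  · rcases eq_or_ne i j with rfl | h
    · exact Commute.refl _
    · rw [Commute, SemiconjBy, Submodule.span_mul_span, Submodule.span_mul_span,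
        Set.singleton_mul_singleton, Set.singleton_mul_singleton, D.gen_mul_gen h]
      exact Submodule.span_singleton_smul_eq (IsUnit.mk0 _ (D.q_ne_zero i j)) _

lemma top_mul_genSpan_le : ⊤ * D.genSpan ≤ D.genSpan * ⊤ := by
  have h : ∀ i a, a * D.gen i ∈ D.genSpan * ⊤ := by
    intro i a
    induction a using D.smash_induction with
    | zero => rw [zero_mul]; exact Submodule.zero_mem _
    | add a b ha hb => rw [add_mul]; exact Submodule.add_mem _ ha hb
    | smul c a ha => rw [smul_mul_assoc]; exact Submodule.smul_mem _ _ ha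
    | grp s =>
      rw [grp_mul_gen]
      exact Submodule.smul_mem _ _ (Submodule.mul_mem_mul (D.gen_mem_genSpan i) trivial)
    | gen_mul j a _ =>
      rw [mul_assoc]
      exact Submodule.mul_mem_mul (D.gen_mem_genSpan j) trivial
  rw [genSpan, Finset.mul_sum]
  refine Finset.sum_induction _ (fun P => P ≤ (∑ i, k ∙ D.gen i) * ⊤) (fun P Q hP hQ => ?_)
    zero_le fun i _ => ?_
  · rw [Submodule.add_eq_sup]; exact sup_le hP hQ
  · rw [Submodule.mul_le]
    intro a _ b hb
    obtain ⟨c, rfl⟩ := Submodule.mem_span_singleton.mp hb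
    rw [mul_smul_comm]
    exact Submodule.smul_mem _ _ (h i a)

/-- The ideal generated by the `x_i` is nilpotent. -/
lemma isNilpotent_genSpan_mul_top : IsNilpotent (D.genSpan * ⊤) := by
  have h : ∀ n, (D.genSpan * ⊤) ^ n ≤ D.genSpan ^ n * ⊤ := by
    intro n
    induction n with
    | zero => simp
    | succ n ih =>
      calc (D.genSpan * ⊤) ^ (n + 1) ≤ D.genSpan ^ n * ⊤ * (D.genSpan * ⊤) := by
            rw [pow_succ]; exact mul_le_mul_left ih _
        _ = D.genSpan ^ n * (⊤ * D.genSpan) * ⊤ := by simp only [mul_assoc]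
        _ ≤ D.genSpan ^ n * (D.genSpan * ⊤) * ⊤ :=
            mul_le_mul_left (mul_le_mul_right D.top_mul_genSpan_le _) _
        _ = D.genSpan ^ (n + 1) * (⊤ * ⊤) := by simp only [pow_succ, mul_assoc]
        _ ≤ D.genSpan ^ (n + 1) * ⊤ := mul_le_mul_right le_top _
  obtain ⟨n, hn⟩ := D.isNilpotent_genSpan
  refine ⟨n, le_bot_iff.mp ((h n).trans ?_)⟩
  rw [hn, zero_mul]
  exact le_rfl

/-- The space spanned by the products `x_{i₁} ⋯ x_{i_m} s` with `m ≤ n`. -/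
def filt (n : ℕ) : Submodule k D.NicholsSmash :=
  (∑ m ∈ Finset.range (n + 1), D.genSpan ^ m) * D.grpSpan

lemma filt_zero : D.filt 0 = D.grpSpan := by simp [filt]

lemma filt_succ (n : ℕ) : D.filt (n + 1) = D.genSpan * D.filt n ⊔ D.grpSpan := by
  rw [filt, Finset.sum_range_succ', pow_zero, add_mul, one_mul, Submodule.add_eq_sup, filt,
    ← mul_assoc, Finset.mul_sum]
  simp only [pow_succ']

lemma filt_mono : Monotone D.filt := fun _ _ h =>
  mul_le_mul_left (Finset.sum_le_sum_of_subset (Finset.range_subset_range.mpr (by omega))) _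

lemma exists_mem_filt (a : D.NicholsSmash) : ∃ n, a ∈ D.filt n := by
  induction a using D.smash_induction with
  | zero => exact ⟨0, Submodule.zero_mem _⟩
  | add a b ha hb =>
    obtain ⟨m, hm⟩ := ha
    obtain ⟨n, hn⟩ := hb
    exact ⟨max m n, Submodule.add_mem _ (D.filt_mono (le_max_left m n) hm)
      (D.filt_mono (le_max_right m n) hn)⟩
  | smul c a ha =>
    obtain ⟨n, hn⟩ := ha
    exact ⟨n, Submodule.smul_mem _ _ hn⟩
  | grp s => exact ⟨0, by rw [filt_zero]; exact D.grp_mem_grpSpan s⟩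
  | gen_mul i a ha =>
    obtain ⟨n, hn⟩ := ha
    refine ⟨n + 1, ?_⟩
    rw [filt_succ]
    exact Submodule.mem_sup_left (Submodule.mul_mem_mul (D.gen_mem_genSpan i) hn)

lemma exists_filt_eq_top : ∃ n, D.filt n = ⊤ := by
  obtain ⟨M, hM⟩ := D.isNilpotent_genSpan
  refine ⟨M, eq_top_iff.mpr fun a _ => ?_⟩
  obtain ⟨n, hn⟩ := D.exists_mem_filt a
  rcases le_total n M with h | h
  · exact D.filt_mono h hn
  · rw [filt] at hn ⊢
    rwa [Finset.sum_subset (Finset.range_subset_range.mpr (Nat.succ_le_succ h)) fun m _ hm => ?_]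
    rw [Finset.mem_range] at hm
    exact pow_eq_zero_of_le (by omega) hM

instance [Finite G] : FiniteDimensional k D.NicholsSmash := by
  obtain ⟨n, hn⟩ := D.exists_filt_eq_top
  refine ⟨?_⟩
  have hU : D.genSpan.FG := by
    refine Finset.sum_induction _ Submodule.FG (fun P Q hP hQ => ?_) Submodule.fg_bot fun i _ =>
      Submodule.fg_span_singleton _
    rw [Submodule.add_eq_sup]; exact hP.sup hQ
  rw [← hn, filt]
  refine Submodule.FG.mul ?_ (Submodule.fg_span (Set.finite_range _))
  refine Finset.sum_induction _ Submodule.FG (fun P Q hP hQ => ?_) Submodule.fg_bot fun m _ =>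
    hU.pow m
  rw [Submodule.add_eq_sup]; exact hP.sup hQ

/-! ### The bosonization is pointed -/

/-- The space `∑_{i + j = n} F i ⊗ F j` for the filtration `F` by degree. -/
def filtSq (n : ℕ) : Submodule k D.SmashSq :=
  Submodule.span k {z | ∃ i j a b, i + j = n ∧ a ∈ D.filt i ∧ b ∈ D.filt j ∧ a ⊗ₜ[k] b = z}

lemma filtSq_mono : Monotone D.filtSq := by
  refine monotone_nat_of_le_succ fun n => Submodule.span_mono ?_
  rintro _ ⟨i, j, a, b, hij, ha, hb, rfl⟩
  exact ⟨i + 1, j, a, b, by omega, D.filt_mono (Nat.le_succ i) ha, hb, rfl⟩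

lemma gen_mul_mem_filt (i : Fin θ) {n : ℕ} {a : D.NicholsSmash} (ha : a ∈ D.filt n) :
    D.gen i * a ∈ D.filt (n + 1) := by
  rw [filt_succ]
  exact Submodule.mem_sup_left (Submodule.mul_mem_mul (D.gen_mem_genSpan i) ha)

/-- Induction on the filtration by degree, following the products `x_{i₁} ⋯ x_{i_m} s`. -/
lemma filt_induction {p : ℕ → D.NicholsSmash → Prop}
    (zero : ∀ n, p n 0) (add : ∀ n a b, p n a → p n b → p n (a + b))
    (smul : ∀ n (c : k) a, p n a → p n (c • a)) (grp : ∀ n s, p n (D.grp s))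
    (gen_mul : ∀ n i a, a ∈ D.filt n → p n a → p (n + 1) (D.gen i * a))
    {n : ℕ} {a : D.NicholsSmash} (ha : a ∈ D.filt n) : p n a := by
  have hT : ∀ n, ∀ a ∈ D.grpSpan, p n a := by
    intro n a ha
    induction ha using Submodule.span_induction with
    | mem a ha => obtain ⟨s, rfl⟩ := ha; exact grp n s
    | zero => exact zero n
    | add a b _ _ ha hb => exact add n _ _ ha hb
    | smul c a _ ha => exact smul n c _ ha
  induction n generalizing a with
  | zero => rw [filt_zero] at ha; exact hT 0 a ha
  | succ n ih =>
    rw [filt_succ] at ha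
    obtain ⟨b, hb, c, hc, rfl⟩ := Submodule.mem_sup.mp ha
    refine add _ _ _ ?_ (hT _ c hc)
    refine Submodule.mul_induction_on hb (fun u hu v hv => ?_) fun u v hu hv => add _ _ _ hu hv
    rw [genSpan] at hu
    obtain ⟨f, hf⟩ : ∃ f : Fin θ → k, ∑ i, f i • D.gen i = u := by
      rw [← Submodule.mem_span_range_iff_exists_fun]
      have : ∑ i, k ∙ D.gen i ≤ Submodule.span k (Set.range D.gen) := by
        refine Finset.sum_induction _ (· ≤ Submodule.span k (Set.range D.gen))
          (fun P Q hP hQ => ?_) bot_le fun i _ => ?_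
        · rw [Submodule.add_eq_sup]; exact sup_le hP hQ
        · rw [Submodule.span_singleton_le_iff_mem]
          exact Submodule.subset_span ⟨i, rfl⟩
      exact this hu
    rw [← hf, Finset.sum_mul]
    refine Finset.sum_induction _ (p (n + 1)) (add _) (zero _) fun i _ => ?_
    rw [smul_mul_assoc]
    exact smul _ _ _ (gen_mul n i v hv (ih hv))

lemma grp_mul_mem_filt (s : G) {n : ℕ} {a : D.NicholsSmash} (ha : a ∈ D.filt n) :
    D.grp s * a ∈ D.filt n := by
  refine D.filt_induction (p := fun n a => D.grp s * a ∈ D.filt n) ?_ ?_ ?_ ?_ ?_ ha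
  · intro n; rw [mul_zero]; exact Submodule.zero_mem _
  · intro n a b ha hb; rw [mul_add]; exact Submodule.add_mem _ ha hb
  · intro n c a ha; rw [mul_smul_comm]; exact Submodule.smul_mem _ _ ha
  · intro n t
    rw [← map_mul]
    exact D.filt_mono (Nat.zero_le n) (by rw [filt_zero]; exact D.grp_mem_grpSpan _)
  · intro n i a _ h
    rw [← mul_assoc, grp_mul_gen, smul_mul_assoc, mul_assoc]
    exact Submodule.smul_mem _ _ (D.gen_mul_mem_filt i h)

lemma comul_mem_filtSq {n : ℕ} {a : D.NicholsSmash} (ha : a ∈ D.filt n) :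
    comul (R := k) a ∈ D.filtSq n := by
  have hg : ∀ i n z, z ∈ D.filtSq n → comul (R := k) (D.gen i) * z ∈ D.filtSq (n + 1) := by
    intro i n z hz
    induction hz using Submodule.span_induction with
    | mem z hz =>
      obtain ⟨l, m, a, b, hlm, ha, hb, rfl⟩ := hz
      rw [comul_gen, add_mul, Algebra.TensorProduct.tmul_mul_tmul,
        Algebra.TensorProduct.tmul_mul_tmul, one_mul]
      refine Submodule.add_mem _ (Submodule.subset_span ?_) (Submodule.subset_span ?_)
      · exact ⟨l + 1, m, _, _, by omega, D.gen_mul_mem_filt i ha, hb, rfl⟩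
      · exact ⟨l, m + 1, _, _, by omega, D.grp_mul_mem_filt _ ha, D.gen_mul_mem_filt i hb, rfl⟩
    | zero => rw [mul_zero]; exact Submodule.zero_mem _
    | add a b _ _ ha hb => rw [mul_add]; exact Submodule.add_mem _ ha hb
    | smul c a _ ha => rw [mul_smul_comm]; exact Submodule.smul_mem _ _ ha
  refine D.filt_induction (p := fun n a => comul (R := k) a ∈ D.filtSq n) ?_ ?_ ?_ ?_ ?_ ha
  · intro n; rw [map_zero]; exact Submodule.zero_mem _
  · intro n a b ha hb; rw [map_add]; exact Submodule.add_mem _ ha hb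
  · intro n c a ha; rw [map_smul]; exact Submodule.smul_mem _ _ ha
  · intro n s
    refine D.filtSq_mono (Nat.zero_le n) (Submodule.subset_span ?_)
    rw [comul_grp]
    have h : D.grp s ∈ D.filt 0 := by rw [filt_zero]; exact D.grp_mem_grpSpan _
    exact ⟨0, 0, _, _, rfl, h, h, rfl⟩
  · intro n i a _ h
    rw [Bialgebra.comul_mul]
    exact hg i n _ h

lemma isGroupLikeElem_grp (s : G) : IsGroupLikeElem k (D.grp s) :=
  ⟨D.counit_grp s, D.comul_grp s⟩

/-- The bosonization `𝔅(V) # kG` is pointed. -/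
lemma isPointed_nicholsSmash : IsPointed k D.NicholsSmash := by
  refine isPointed_of_filtration D.filt D.filt_mono D.exists_mem_filt (fun n c hc => ?_) ?_
  · have h := D.comul_mem_filtSq hc
    generalize comul (R := k) c = z at h
    induction h using Submodule.span_induction with
    | mem z hz =>
      obtain ⟨i, j, a, b, hij, ha, hb, rfl⟩ := hz
      rw [TensorProduct.map_tmul]
      rcases Nat.eq_zero_or_pos j with rfl | hj
      · rw [Submodule.mkQ_apply _ b, (Submodule.Quotient.mk_eq_zero _).mpr hb,
          TensorProduct.tmul_zero]
      · rw [Submodule.mkQ_apply _ a,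
          (Submodule.Quotient.mk_eq_zero _).mpr (D.filt_mono (by omega) ha),
          TensorProduct.zero_tmul]
    | zero => exact map_zero _
    | add a b _ _ ha hb => rw [map_add, ha, hb, add_zero]
    | smul c a _ ha => rw [map_smul, ha, smul_zero]
  · rw [filt_zero]
    refine Submodule.span_mono ?_
    rintro _ ⟨s, rfl⟩
    exact D.isGroupLikeElem_grp s

/-! ### The projection to the group algebra -/

/-- The projection of the bosonization to the group algebra. -/
def toGroupAlgebra : D.NicholsSmash →ₐ[k] MonoidAlgebra k G :=
  D.smashLift ((Algebra.ofId k _).comp D.nicholsCounit) (MonoidAlgebra.of k G) (by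
    simp [nicholsCounit])

@[simp] lemma toGroupAlgebra_gen (i : Fin θ) : D.toGroupAlgebra (D.gen i) = 0 := by
  simp [toGroupAlgebra, nicholsCounit]

@[simp] lemma toGroupAlgebra_grp (s : G) :
    D.toGroupAlgebra (D.grp s) = MonoidAlgebra.of k G s := D.smashLift_grp _ _ _ s

lemma toGroupAlgebra_surjective : Function.Surjective D.toGroupAlgebra := by
  intro y
  induction y using MonoidAlgebra.induction_on with
  | of s => exact ⟨D.grp s, D.toGroupAlgebra_grp s⟩
  | add a b ha hb =>
    obtain ⟨a, rfl⟩ := ha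
    obtain ⟨b, rfl⟩ := hb
    exact ⟨a + b, map_add _ _ _⟩
  | smul c a ha =>
    obtain ⟨a, rfl⟩ := ha
    exact ⟨c • a, map_smul _ _ _⟩

lemma ker_toGroupAlgebra_le :
    LinearMap.ker D.toGroupAlgebra.toLinearMap ≤ D.genSpan * ⊤ := by
  let σ : MonoidAlgebra k G →ₐ[k] D.NicholsSmash := MonoidAlgebra.lift k D.NicholsSmash G D.grp
  have hσ : ∀ s, σ (MonoidAlgebra.of k G s) = D.grp s := fun s => by
    simp [σ]
  have h : ∀ a, a - σ (D.toGroupAlgebra a) ∈ D.genSpan * ⊤ := by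
    intro a
    induction a using D.smash_induction with
    | zero => simp
    | add a b ha hb =>
      have e : a + b - σ (D.toGroupAlgebra (a + b)) =
          (a - σ (D.toGroupAlgebra a)) + (b - σ (D.toGroupAlgebra b)) := by
        rw [map_add, map_add]; abel
      rw [e]
      exact Submodule.add_mem _ ha hb
    | smul c a ha =>
      rw [map_smul, map_smul, ← smul_sub]
      exact Submodule.smul_mem _ _ ha
    | grp s => rw [toGroupAlgebra_grp, hσ, sub_self]; exact Submodule.zero_mem _
    | gen_mul i a _ =>
      rw [map_mul, toGroupAlgebra_gen, zero_mul, map_zero, sub_zero]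
      exact Submodule.mul_mem_mul (D.gen_mem_genSpan i) trivial
  intro a ha
  have := h a
  rwa [show D.toGroupAlgebra a = 0 from ha, map_zero, sub_zero] at this

lemma toGroupAlgebra_qDivPow (q : k) (i : Fin θ) {n : ℕ} (hn : n ≠ 0) :
    D.toGroupAlgebra (qDivPow q (D.gen i) n) = 0 := by
  rw [qDivPow, map_smul, map_pow, toGroupAlgebra_gen, zero_pow hn, smul_zero]

variable {D} in
lemma map_toGroupAlgebra_of_mem_twistSpan {X : D.SmashSq} (hX : X ∈ D.twistSpan) :
    Algebra.TensorProduct.map D.toGroupAlgebra D.toGroupAlgebra X = 0 := by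
  induction hX using Submodule.span_induction with
  | mem X hX =>
    rcases hX with ⟨i, -, rfl⟩ | ⟨i, j, -, rfl⟩
    · rw [T_eq_sum, map_sum]
      refine Finset.sum_eq_zero fun ab hab => ?_
      rw [Finset.HasAntidiagonal.mem_antidiagonal] at hab
      rw [Algebra.TensorProduct.map_tmul]
      rcases Nat.eq_zero_or_pos ab.1 with h | h
      · rw [D.toGroupAlgebra_qDivPow _ i (n := ab.2) (by have := D.one_lt_N i; omega),
          TensorProduct.tmul_zero]
      · rw [map_mul, D.toGroupAlgebra_qDivPow _ i h.ne', zero_mul, TensorProduct.zero_tmul]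
    · rw [B_eq, Algebra.TensorProduct.map_tmul, toGroupAlgebra_gen, TensorProduct.tmul_zero]
  | zero => exact map_zero _
  | add a b _ _ ha hb => rw [map_add, ha, hb, add_zero]
  | smul c a _ ha => rw [map_smul, ha, smul_zero]

lemma map_toGroupAlgebra_comul (a : D.NicholsSmash) :
    Algebra.TensorProduct.map D.toGroupAlgebra D.toGroupAlgebra (comul (R := k) a) =
      comul (R := k) (D.toGroupAlgebra a) := by
  have : (Algebra.TensorProduct.map D.toGroupAlgebra D.toGroupAlgebra).comp
      (comulAlgHom k D.NicholsSmash) = (comulAlgHom k _).comp D.toGroupAlgebra := by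
    refine smash_algHom_ext (fun i => ?_) fun s => ?_
    · simp
    · simp only [AlgHom.comp_apply, comulAlgHom_apply, comul_grp, Algebra.TensorProduct.map_tmul,
        toGroupAlgebra_grp]
      exact (MonoidAlgebra.isGroupLikeElem_of s).comul_eq_tmul_self.symm
  exact DFunLike.congr_fun this a

lemma counit_toGroupAlgebra (a : D.NicholsSmash) :
    counit (R := k) (D.toGroupAlgebra a) = counit (R := k) a := by
  have : (counitAlgHom k _).comp D.toGroupAlgebra = counitAlgHom k D.NicholsSmash := by
    refine smash_algHom_ext (fun i => ?_) fun s => ?_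
    · simp
    · simp only [AlgHom.comp_apply, counitAlgHom_apply, counit_grp, toGroupAlgebra_grp]
      exact (MonoidAlgebra.isGroupLikeElem_of s).counit_eq_one
  exact DFunLike.congr_fun this a

namespace ScalarFamily

variable {D} {F : D.ScalarFamily} [CharZero k]

lemma IsAdmissible.map_toGroupAlgebra_twist (hF : F.IsAdmissible) :
    Algebra.TensorProduct.map D.toGroupAlgebra D.toGroupAlgebra hF.twist.val = 1 := by
  refine (map_nilExp k _ (twistSpan_isNilpotent hF.logJ_mem)).trans ?_
  rw [map_toGroupAlgebra_of_mem_twistSpan hF.logJ_mem, nilExp_zero]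

/-- The projection of `A(V, G, 𝒟)` to the group algebra, which is not affected by the twist. -/
def IsAdmissible.aToGroupAlgebra (hF : F.IsAdmissible) :
    letI := hF.bialgebra
    D.A →ₐc[k] MonoidAlgebra k G :=
  let _ := hF.bialgebra
  BialgHom.ofAlgHom (D.toGroupAlgebra.comp D.aEquiv.toAlgHom)
    (by ext a; exact D.counit_toGroupAlgebra (D.aEquiv a))
    (by
      ext1 a
      let p := D.toGroupAlgebra
      have h1 : ∀ z : D.SmashSq, Algebra.TensorProduct.map (p.comp D.aEquiv.toAlgHom)
          (p.comp D.aEquiv.toAlgHom) (Algebra.TensorProduct.map D.aEquiv.symm.toAlgHom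
            D.aEquiv.symm.toAlgHom z) = Algebra.TensorProduct.map p p z := by
        intro z
        induction z using TensorProduct.induction_on with
        | zero => simp
        | add a b ha hb => simp only [map_add, ha, hb]
        | tmul a b => simp
      have h2 : Algebra.TensorProduct.map p p (hF.twist⁻¹ : D.SmashSqˣ).val = 1 := by
        have := congrArg (Algebra.TensorProduct.map p p) hF.twist.inv_mul
        rwa [map_mul, hF.map_toGroupAlgebra_twist, mul_one, map_one] at this
      refine (h1 (twistComul hF.twist (D.aEquiv a))).trans ?_
      rw [twistComul_apply, map_mul, map_mul, h2, hF.map_toGroupAlgebra_twist, one_mul, mul_one]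
      exact D.map_toGroupAlgebra_comul _)

lemma IsAdmissible.isHopfAlgebra (hF : F.IsAdmissible) :
    letI := hF.bialgebra
    IsHopfAlgebra k D.A := by
  let _ := hF.bialgebra
  refine isHopfAlgebra_of_isNilpotent_ker hF.aToGroupAlgebra ?_ ?_
  · exact D.toGroupAlgebra_surjective.comp D.aEquiv.surjective
  · have h : LinearMap.ker (hF.aToGroupAlgebra : D.A →ₗ[k] MonoidAlgebra k G) ≤
        (D.genSpan * ⊤).map D.aEquiv.symm.toLinearMap := by
      intro a ha
      exact ⟨D.aEquiv a, D.ker_toGroupAlgebra_le ha, D.aEquiv.symm_apply_apply a⟩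
    obtain ⟨n, hn⟩ := D.isNilpotent_genSpan_mul_top
    refine ⟨n, le_bot_iff.mp ((pow_le_pow_left' h n).trans ?_)⟩
    have := Submodule.map_pow (D.genSpan * ⊤) D.aEquiv.symm.toAlgHom n
    rw [hn] at this
    exact (this.symm.trans (Submodule.map_bot _)).le

end ScalarFamily

end QLSDatum

namespace QLSDatum

open Coalgebra Bialgebra

variable {k G : Type*} [Field k] [Group G] {θ : ℕ} {D : QLSDatum k G θ}

namespace ScalarFamily

/-! ### Invariant families -/

/-- The family with scalars `χ_i(s) χ_j(s) a_{ij}` and `χ_i(s) ^ N_i ξ_i`. -/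
def act (F : D.ScalarFamily) (s : G) : D.ScalarFamily where
  a i j := (D.χ i s : k) * D.χ j s * F.a i j
  ξ i := (D.χ i s : k) ^ D.N i * F.ξ i

lemma bTerm_congr {F F' : D.ScalarFamily} {i j : Fin θ} (h : i ≠ j → F.a i j = F'.a i j) :
    F.bTerm i j = F'.bTerm i j := by
  rw [bTerm, bTerm]
  split_ifs with hij
  · rfl
  · rw [h hij]

lemma logJ_congr {F F' : D.ScalarFamily} (ha : ∀ i j, i ≠ j → F.a i j = F'.a i j)
    (hξ : ∀ i, F.ξ i = F'.ξ i) : F.logJ = F'.logJ := by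
  rw [logJ, logJ]
  congr 1
  · exact Finset.sum_congr rfl fun i _ => by rw [hξ]
  · exact Finset.sum_congr rfl fun i _ => Finset.sum_congr rfl fun j _ => bTerm_congr (ha i j)

lemma grpDiag_mul_logJ (F : D.ScalarFamily) (s : G) :
    D.grpDiag s * F.logJ = (F.act s).logJ * D.grpDiag s := by
  rw [logJ, logJ, mul_add, add_mul, Finset.mul_sum, Finset.mul_sum, Finset.sum_mul,
    Finset.sum_mul]
  congr 1
  · refine Finset.sum_congr rfl fun i _ => ?_
    rw [mul_smul_comm, grpDiag_mul_T, smul_smul, smul_mul_assoc, act, mul_comm]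
  · refine Finset.sum_congr rfl fun i _ => ?_
    rw [Finset.mul_sum, Finset.sum_mul]
    refine Finset.sum_congr rfl fun j _ => ?_
    rw [bTerm, bTerm]
    split_ifs with hij
    · rw [mul_zero, zero_mul]
    · rw [mul_smul_comm, grpDiag_mul_B, smul_smul, smul_mul_assoc, act, mul_comm]

lemma IsAdmissible.act {F : D.ScalarFamily} (hF : F.IsAdmissible) (s : G) :
    (F.act s).IsAdmissible where
  isLinked i j hij h := hF.isLinked i j hij (right_ne_zero_of_mul h)
  isLiftable i h := hF.isLiftable i (right_ne_zero_of_mul h)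

variable [CharZero k]

lemma IsAdmissible.commute_logJ_comul {F : D.ScalarFamily} (hF : F.IsAdmissible)
    (hinv : F.IsInvariant Set.univ) (h : D.NicholsSmash) :
    Commute F.logJ (comul (R := k) h) := by
  induction h using D.smash_induction with
  | zero => rw [map_zero]; exact Commute.zero_right _
  | add a b ha hb => rw [map_add]; exact ha.add_right hb
  | smul c a ha => rw [map_smul]; exact ha.smul_right c
  | grp s =>
    have h1 : (F.act s).logJ = F.logJ :=
      logJ_congr (fun i j hij => (hinv s trivial).1 i j hij) fun i => (hinv s trivial).2 i
    have h2 := F.grpDiag_mul_logJ s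
    rw [h1] at h2
    rw [comul_grp]
    exact h2.symm
  | gen_mul i a ha =>
    rw [Bialgebra.comul_mul]
    exact (mem_infTwist_commute (D.twistSpan_le_infTwist hF.logJ_mem) (D.gen_mem_subΓ i)).mul_right
      ha

/-! ### Symmetric and alternating parts -/

/-- The symmetric part of a family of scalars, including the scalars `ξ_i`. -/
def symPart (F : D.ScalarFamily) : D.ScalarFamily where
  a i j := 2⁻¹ * (F.a i j + F.a j i)
  ξ := F.ξ

/-- The alternating part of a family of scalars. -/
def altPart (F : D.ScalarFamily) : D.ScalarFamily where
  a i j := 2⁻¹ * (F.a i j - F.a j i)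
  ξ _ := 0

lemma logJ_eq_add (F : D.ScalarFamily) : F.logJ = F.symPart.logJ + F.altPart.logJ := by
  have h1 : ∀ i j, F.bTerm i j = F.symPart.bTerm i j + F.altPart.bTerm i j := by
    intro i j
    rw [bTerm, bTerm, bTerm]
    split_ifs with hij
    · rw [add_zero]
    · rw [← add_smul]
      congr 1
      simp only [symPart, altPart]
      field_simp
      ring
  rw [logJ, logJ, logJ]
  simp only [h1, Finset.sum_add_distrib]
  simp only [symPart, altPart, zero_smul, Finset.sum_const_zero]
  abel

variable {F : D.ScalarFamily}

omit [CharZero k] in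
lemma IsAdmissible.isLinked_of_or (hF : F.IsAdmissible) {i j : Fin θ} (hij : i ≠ j)
    (h : F.a i j ≠ 0 ∨ F.a j i ≠ 0) : D.IsLinked i j :=
  h.elim (hF.isLinked i j hij) fun h => (hF.isLinked j i hij.symm h).symm

omit [CharZero k] in
lemma IsAdmissible.symPart (hF : F.IsAdmissible) : F.symPart.IsAdmissible where
  isLinked i j hij h := hF.isLinked_of_or hij (by
    by_contra! h0
    exact h (by simp [ScalarFamily.symPart, h0]))
  isLiftable := hF.isLiftable

omit [CharZero k] in
lemma IsAdmissible.altPart (hF : F.IsAdmissible) : F.altPart.IsAdmissible where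
  isLinked i j hij h := hF.isLinked_of_or hij (by
    by_contra! h0
    exact h (by simp [ScalarFamily.altPart, h0]))
  isLiftable i h := absurd rfl h

omit [CharZero k] in
lemma IsAdmissible.hat_a (hF : F.IsAdmissible) {i j : Fin θ} (hij : i ≠ j) :
    F.hat.a i j = -(F.a i j + F.a j i) := by
  by_cases h : F.a i j ≠ 0 ∨ F.a j i ≠ 0
  · change D.q i j * F.a j i - F.a i j = _
    rw [(hF.isLinked_of_or hij h).q_eq]
    ring
  · push Not at h
    simp [hat, h.1, h.2]

lemma IsAdmissible.isInvariant_symPart (hF : F.IsAdmissible)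
    (hinv : F.hat.IsInvariant Set.univ) : F.symPart.IsInvariant Set.univ := by
  intro s hs
  refine ⟨fun i j hij => ?_, (hinv s hs).2⟩
  have h1 := (hinv s hs).1 i j hij
  rw [hF.hat_a hij] at h1
  have h2 : F.symPart.a i j = -2⁻¹ * -(F.a i j + F.a j i) := by
    rw [ScalarFamily.symPart]; ring
  rw [h2, mul_left_comm, h1]

end ScalarFamily

/-! ### Twists by coboundaries -/

section

variable {i j : Fin θ}

lemma IsLinked.commute_gen [CharZero k] (h : D.IsLinked i j) (l : Fin θ) :
    Commute (D.gen l) (D.gen i * D.gen j) := by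
  have h0 : D.gen i * D.gen i = 0 := by
    rw [← pow_two]; exact D.gen_pow_of_le h.N_eq.le
  have h0' : D.gen j * D.gen j = 0 := by
    rw [← pow_two]; exact D.gen_pow_of_le h.symm.N_eq.le
  rw [Commute, SemiconjBy]
  rcases eq_or_ne l i with rfl | hi
  · rw [← mul_assoc, h0, zero_mul, mul_assoc, D.gen_mul_gen h.ne.symm, mul_smul_comm, ← mul_assoc,
      h0, zero_mul, smul_zero]
  rcases eq_or_ne l j with rfl | hj
  · rw [← mul_assoc, D.gen_mul_gen hi, smul_mul_assoc, mul_assoc, h0', mul_zero, smul_zero]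
  · rw [← mul_assoc, D.gen_mul_gen hi, smul_mul_assoc, mul_assoc, D.gen_mul_gen hj, mul_smul_comm,
      smul_smul, h.q_mul_q, one_smul, mul_assoc]

lemma IsLinked.commute_grp (h : D.IsLinked i j) {s : G} (hs : s ∈ D.Γ) :
    Commute (D.grp s) (D.gen i * D.gen j) := by
  rw [Commute, SemiconjBy, ← mul_assoc, grp_mul_gen, smul_mul_assoc, mul_assoc, grp_mul_gen,
    mul_smul_comm, smul_smul, h.χ_mul_χ s hs, one_smul, mul_assoc]

/-- The element `x_i x_j` is a coboundary for the difference of `x_i ⊗ x_j` and `x_j ⊗ x_i`. -/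
lemma IsLinked.comul_gen_mul_gen (h : D.IsLinked i j) :
    comul (R := k) (D.gen i * D.gen j) =
      D.B i j - D.B j i + (D.gen i * D.gen j) ⊗ₜ 1 + 1 ⊗ₜ (D.gen i * D.gen j) := by
  have h1 : D.genL i * D.genL j = (D.gen i * D.gen j) ⊗ₜ 1 := by
    rw [genL, genL, Algebra.TensorProduct.tmul_mul_tmul, one_mul]
  have h2 : D.genR i * D.genR j = 1 ⊗ₜ (D.gen i * D.gen j) := by
    rw [genR, genR, Algebra.TensorProduct.tmul_mul_tmul, ← map_mul, h.g_mul_g, map_one]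
  have h3 : D.genR i * D.genL j = -D.B j i := by
    rw [genR_mul_genL, h.q_eq, neg_one_smul, B]
  rw [Bialgebra.comul_mul, comul_gen_eq, comul_gen_eq, add_mul, mul_add, mul_add, h1, h2, h3, ← B]
  abel

end

variable (D) in
/-- The space spanned by the products `x_i x_j` for linked `i` and `j`. -/
def linkSpan : Submodule k D.NicholsSmash :=
  Submodule.span k {w | ∃ i j, D.IsLinked i j ∧ D.gen i * D.gen j = w}

section

variable [CharZero k] {w : D.NicholsSmash}

lemma linkSpan_commute_gen (hw : w ∈ D.linkSpan) (l : Fin θ) : Commute (D.gen l) w := by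
  induction hw using Submodule.span_induction with
  | mem w hw => obtain ⟨i, j, h, rfl⟩ := hw; exact h.commute_gen l
  | zero => exact Commute.zero_right _
  | add a b _ _ ha hb => exact ha.add_right hb
  | smul c a _ ha => exact ha.smul_right c

omit [CharZero k] in
lemma linkSpan_commute_grp (hw : w ∈ D.linkSpan) {s : G} (hs : s ∈ D.Γ) :
    Commute (D.grp s) w := by
  induction hw using Submodule.span_induction with
  | mem w hw => obtain ⟨i, j, h, rfl⟩ := hw; exact h.commute_grp hs
  | zero => exact Commute.zero_right _
  | add a b _ _ ha hb => exact ha.add_right hb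
  | smul c a _ ha => exact ha.smul_right c

lemma linkSpan_isNilpotent (hw : w ∈ D.linkSpan) : IsNilpotent w := by
  refine isNilpotent_of_mem_span ?_ ?_ hw
  · rintro _ ⟨i, j, h, rfl⟩ _ ⟨l, m, h', rfl⟩
    exact (h'.commute_gen i).mul_left (h'.commute_gen j)
  · rintro _ ⟨i, j, h, rfl⟩
    refine ⟨2, ?_⟩
    have h0 : D.gen i * D.gen i = 0 := by
      rw [← pow_two]; exact D.gen_pow_of_le h.N_eq.le
    rw [pow_two, ← mul_assoc, ← (h.commute_gen i).eq, ← mul_assoc, h0, zero_mul, zero_mul]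

lemma linkSpan_commute_twistSpan_left (hw : w ∈ D.linkSpan) {X : D.SmashSq}
    (hX : X ∈ D.twistSpan) : Commute (w ⊗ₜ 1) X := by
  have hL : ∀ i, Commute (w ⊗ₜ[k] (1 : D.NicholsSmash)) (D.genL i) := fun i => by
    rw [Commute, SemiconjBy, genL, Algebra.TensorProduct.tmul_mul_tmul,
      Algebra.TensorProduct.tmul_mul_tmul, (linkSpan_commute_gen hw i).eq]
  have hR : ∀ i, Commute (w ⊗ₜ[k] (1 : D.NicholsSmash)) (D.genR i) := fun i => by
    rw [Commute, SemiconjBy, genR, Algebra.TensorProduct.tmul_mul_tmul,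
      Algebra.TensorProduct.tmul_mul_tmul, (linkSpan_commute_grp hw (D.g_mem_Γ i)).eq, one_mul,
      mul_one]
  induction hX using Submodule.span_induction with
  | mem X hX =>
    rcases hX with ⟨i, -, rfl⟩ | ⟨i, j, -, rfl⟩
    · rw [T, coprodDivPow]
      exact Commute.sum_right _ _ _ fun ab _ =>
        (((hL i).pow_right _).smul_right _).mul_right (((hR i).pow_right _).smul_right _)
    · exact (hL i).mul_right (hR j)
  | zero => exact Commute.zero_right _
  | add a b _ _ ha hb => exact ha.add_right hb
  | smul c a _ ha => exact ha.smul_right c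

lemma linkSpan_commute_twistSpan_right (hw : w ∈ D.linkSpan) {X : D.SmashSq}
    (hX : X ∈ D.twistSpan) : Commute (1 ⊗ₜ w) X := by
  have hL : ∀ i, Commute ((1 : D.NicholsSmash) ⊗ₜ[k] w) (D.genL i) := fun i => by
    rw [Commute, SemiconjBy, genL, Algebra.TensorProduct.tmul_mul_tmul,
      Algebra.TensorProduct.tmul_mul_tmul, one_mul, mul_one, one_mul, mul_one]
  have hR : ∀ i, Commute ((1 : D.NicholsSmash) ⊗ₜ[k] w) (D.genR i) := fun i => by
    rw [Commute, SemiconjBy, genR, Algebra.TensorProduct.tmul_mul_tmul,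
      Algebra.TensorProduct.tmul_mul_tmul, (linkSpan_commute_gen hw i).eq, one_mul, mul_one]
  induction hX using Submodule.span_induction with
  | mem X hX =>
    rcases hX with ⟨i, -, rfl⟩ | ⟨i, j, -, rfl⟩
    · rw [T, coprodDivPow]
      exact Commute.sum_right _ _ _ fun ab _ =>
        (((hL i).pow_right _).smul_right _).mul_right (((hR i).pow_right _).smul_right _)
    · exact (hL i).mul_right (hR j)
  | zero => exact Commute.zero_right _
  | add a b _ _ ha hb => exact ha.add_right hb
  | smul c a _ ha => exact ha.smul_right c

/-- If `X = Δ(w) - w ⊗ 1 - 1 ⊗ w`, then `exp(X)` is the coboundary of `exp(w)`. -/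
lemma comul_nilExp_of_mem_linkSpan (hw : w ∈ D.linkSpan) {X : D.SmashSq} (hX : X ∈ D.twistSpan)
    (h : comul (R := k) w = X + w ⊗ₜ 1 + 1 ⊗ₜ w) :
    comul (R := k) (nilExp k w) = nilExp k X * (nilExp k w ⊗ₜ nilExp k w) := by
  have hn := linkSpan_isNilpotent hw
  have hl := linkSpan_commute_twistSpan_left hw hX
  have hr := linkSpan_commute_twistSpan_right hw hX
  have hlr : Commute (w ⊗ₜ[k] (1 : D.NicholsSmash)) (1 ⊗ₜ w) := by
    simp [Commute, SemiconjBy]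
  let iL : D.NicholsSmash →ₐ[k] D.SmashSq := Algebra.TensorProduct.includeLeft
  let iR : D.NicholsSmash →ₐ[k] D.SmashSq := Algebra.TensorProduct.includeRight
  have hnl : IsNilpotent (w ⊗ₜ[k] (1 : D.NicholsSmash)) := hn.map iL
  have hnr : IsNilpotent ((1 : D.NicholsSmash) ⊗ₜ[k] w) := hn.map iR
  have el : nilExp k w ⊗ₜ[k] (1 : D.NicholsSmash) = nilExp k (w ⊗ₜ[k] 1) := map_nilExp k iL hn
  have er : (1 : D.NicholsSmash) ⊗ₜ[k] nilExp k w = nilExp k (1 ⊗ₜ[k] w) := map_nilExp k iR hn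
  have e : nilExp k w ⊗ₜ[k] nilExp k w = nilExp k (w ⊗ₜ[k] 1) * nilExp k (1 ⊗ₜ[k] w) := by
    rw [← el, ← er, Algebra.TensorProduct.tmul_mul_tmul, one_mul, mul_one]
  have hXn := twistSpan_isNilpotent hX
  refine (map_nilExp k (comulAlgHom k D.NicholsSmash) hn).trans ?_
  rw [comulAlgHom_apply, h, nilExp_add k (hr.symm.add_left hlr) (hl.symm.isNilpotent_add hXn hnl)
    hnr, nilExp_add k hl.symm hXn hnl, e, mul_assoc]

end

namespace ScalarFamily

variable [CharZero k] {F : D.ScalarFamily}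

/-- The element `½ ∑_{i ≠ j} a_{ij} x_i x_j`, whose coboundary is the logarithm of the twist when
`a` is alternating and `ξ = 0`. -/
def linkElem (F : D.ScalarFamily) : D.NicholsSmash :=
  (2⁻¹ : k) • ∑ i, ∑ j, if i = j then 0 else F.a i j • (D.gen i * D.gen j)

omit [CharZero k] in
lemma IsAdmissible.linkElem_mem (hF : F.IsAdmissible) : F.linkElem ∈ D.linkSpan := by
  refine Submodule.smul_mem _ _ (Submodule.sum_mem _ fun i _ => Submodule.sum_mem _ fun j _ => ?_)
  split_ifs with hij
  · exact Submodule.zero_mem _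
  rcases eq_or_ne (F.a i j) 0 with h | h
  · rw [h, zero_smul]; exact Submodule.zero_mem _
  · exact Submodule.smul_mem _ _ (Submodule.subset_span ⟨i, j, hF.isLinked i j hij h, rfl⟩)

lemma IsAdmissible.comul_linkElem (hF : F.IsAdmissible) (halt : ∀ i j, F.a i j = -F.a j i)
    (hξ : ∀ i, F.ξ i = 0) :
    comul (R := k) F.linkElem = F.logJ + F.linkElem ⊗ₜ 1 + 1 ⊗ₜ F.linkElem := by
  have h1 : ∀ i j, comul (R := k) (if i = j then 0 else F.a i j • (D.gen i * D.gen j)) =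
      (F.bTerm i j + F.bTerm j i) +
        ((if i = j then 0 else F.a i j • (D.gen i * D.gen j)) ⊗ₜ 1 +
        1 ⊗ₜ (if i = j then 0 else F.a i j • (D.gen i * D.gen j))) := by
    intro i j
    rw [bTerm, bTerm]
    rcases eq_or_ne i j with hij | hij
    · simp [hij]
    · rw [if_neg hij, if_neg hij, if_neg hij.symm]
      rcases eq_or_ne (F.a i j) 0 with h | h
      · rw [halt j i, h]; simp
      · rw [map_smul, (hF.isLinked i j hij h).comul_gen_mul_gen, halt j i, neg_smul, smul_add,
          smul_add, smul_sub, TensorProduct.smul_tmul', TensorProduct.tmul_smul]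
        abel
  have h2 : F.logJ = (2⁻¹ : k) • ∑ i, ∑ j, (F.bTerm i j + F.bTerm j i) := by
    simp only [Finset.sum_add_distrib]
    rw [Finset.sum_comm (f := fun i j => F.bTerm j i), ← two_smul k, smul_smul,
      inv_mul_cancel₀ two_ne_zero, one_smul, logJ]
    simp [hξ]
  rw [h2, linkElem, map_smul, map_sum]
  simp only [map_sum, h1, Finset.sum_add_distrib, smul_add, TensorProduct.tmul_smul,
    ← TensorProduct.smul_tmul', TensorProduct.sum_tmul, TensorProduct.tmul_sum]
  abel

/-- If the family of scalars `b_{ij}`, `ξ_i` is invariant, then the twist is a product of a factor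
`S` commuting with `Δ` and of the coboundary `C` of `u = exp(w)`, and conjugation by `u` removes
`C`. -/
lemma IsAdmissible.nonempty_bialgEquiv (hF : F.IsAdmissible)
    (hinv : F.hat.IsInvariant Set.univ) :
    letI := hF.bialgebra
    Nonempty (D.A ≃ₐc[k] D.NicholsSmash) := by
  let _ := hF.bialgebra
  set w := F.altPart.linkElem with hw
  have hwm : w ∈ D.linkSpan := hF.altPart.linkElem_mem
  let u := nilExpUnit k (linkSpan_isNilpotent hwm)
  let S := hF.symPart.twist
  let C := hF.altPart.twist
  have hSC : hF.twist = S * C := by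
    ext
    refine (congrArg (nilExp k) F.logJ_eq_add).trans ?_
    exact nilExp_add k (twistSpan_commute hF.symPart.logJ_mem hF.altPart.logJ_mem)
      (twistSpan_isNilpotent hF.symPart.logJ_mem) (twistSpan_isNilpotent hF.altPart.logJ_mem)
  have hS : ∀ h : D.NicholsSmash, Commute (comul (R := k) h) S.val := fun h =>
    commute_nilExp k (hF.symPart.commute_logJ_comul (hF.isInvariant_symPart hinv) h).symm
      (twistSpan_isNilpotent hF.symPart.logJ_mem)
  have hC : comul (R := k) u.val = C.val * (u.val ⊗ₜ u.val) :=
    comul_nilExp_of_mem_linkSpan hwm hF.altPart.logJ_mem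
      (hF.altPart.comul_linkElem (fun i j => by simp only [ScalarFamily.altPart]; ring)
        fun _ => rfl)
  -- `C = Δ(u) (u⁻¹ ⊗ u⁻¹)`, so twisting by `C` amounts to conjugating by `u`
  have huu : (u⁻¹.val ⊗ₜ[k] u⁻¹.val : D.SmashSq) * (u.val ⊗ₜ u.val) = 1 := by
    rw [Algebra.TensorProduct.tmul_mul_tmul, Units.inv_mul, Algebra.TensorProduct.one_def]
  have huu' : (u.val ⊗ₜ[k] u.val : D.SmashSq) * (u⁻¹.val ⊗ₜ u⁻¹.val) = 1 := by
    rw [Algebra.TensorProduct.tmul_mul_tmul, Units.mul_inv, Algebra.TensorProduct.one_def]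
  have hΔ : comul (R := k) u⁻¹.val * comul (R := k) u.val = (1 : D.SmashSq) := by
    rw [← Bialgebra.comul_mul, Units.inv_mul, Bialgebra.comul_one]
  have hC' : C.val = comul (R := k) u.val * (u⁻¹.val ⊗ₜ u⁻¹.val) := by
    rw [hC, mul_assoc, huu', mul_one]
  have hCinv : (C⁻¹).val = (u.val ⊗ₜ u.val) * comul (R := k) u⁻¹.val := by
    symm
    refine Units.eq_inv_of_mul_eq_one_left ?_
    rw [hC', mul_assoc, ← mul_assoc (_ ⊗ₜ[k] _), huu, one_mul, ← Bialgebra.comul_mul, Units.mul_inv,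
      Bialgebra.comul_one]
  have hmap : ∀ z : D.SmashSq, Algebra.TensorProduct.map (conjUnit (k := k) u) (conjUnit u) z =
      (u⁻¹.val ⊗ₜ u⁻¹.val) * z * (u.val ⊗ₜ u.val) := by
    intro z
    induction z using TensorProduct.induction_on with
    | zero => simp
    | add a b ha hb => simp only [map_add, mul_add, add_mul, ha, hb]
    | tmul a b => simp
  have key : ∀ h : D.NicholsSmash, Algebra.TensorProduct.map (conjUnit (k := k) u) (conjUnit u)
      (twistComul hF.twist h) = comul (R := k) (conjUnit (k := k) u h) := by
    intro h
    have e1 : (S⁻¹).val * comul (R := k) h * S.val = comul (R := k) h := by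
      rw [mul_assoc, (hS h).eq, Units.inv_mul_cancel_left]
    have e2 : twistComul hF.twist h = (C⁻¹).val * comul (R := k) h * C.val := by
      rw [twistComul_apply, hSC, mul_inv_rev, Units.val_mul, Units.val_mul]
      nth_rw 2 [← e1]
      simp only [mul_assoc]
    rw [hmap, e2, hC', hCinv, conjUnit_apply, Bialgebra.comul_mul, Bialgebra.comul_mul]
    calc (u⁻¹.val ⊗ₜ[k] u⁻¹.val : D.SmashSq) * ((u.val ⊗ₜ u.val) * comul (R := k) u⁻¹.val *
          comul (R := k) h * (comul (R := k) u.val * (u⁻¹.val ⊗ₜ u⁻¹.val))) * (u.val ⊗ₜ u.val)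
        = ((u⁻¹.val ⊗ₜ[k] u⁻¹.val : D.SmashSq) * (u.val ⊗ₜ u.val)) * (comul (R := k) u⁻¹.val *
          comul (R := k) h * comul (R := k) u.val) *
            ((u⁻¹.val ⊗ₜ u⁻¹.val) * (u.val ⊗ₜ u.val)) := by
          simp only [mul_assoc]
      _ = _ := by rw [huu, one_mul, mul_one]
  let φ : D.NicholsSmash ≃ₐ[k] D.NicholsSmash := AlgEquiv.ofAlgHom (conjUnit u) (conjUnit u⁻¹)
    (by ext h; simp [mul_assoc]) (by ext h; simp [mul_assoc])
  refine ⟨BialgEquiv.ofAlgEquiv (D.aEquiv.trans φ) ?_ ?_⟩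
  · ext a
    change counit (R := k) (conjUnit (k := k) u (D.aEquiv a)) = counit (R := k) (D.aEquiv a)
    rw [conjUnit_apply, Bialgebra.counit_mul, Bialgebra.counit_mul, mul_right_comm,
      ← Bialgebra.counit_mul, Units.inv_mul, Bialgebra.counit_one, one_mul]
  · ext1 a
    have h1 : ∀ z : D.SmashSq, Algebra.TensorProduct.map (D.aEquiv.trans φ : D.A →ₐ[k] _)
        (D.aEquiv.trans φ : D.A →ₐ[k] _) (Algebra.TensorProduct.map D.aEquiv.symm.toAlgHom
          D.aEquiv.symm.toAlgHom z) = Algebra.TensorProduct.map (conjUnit (k := k) u)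
            (conjUnit u) z := by
      intro z
      induction z using TensorProduct.induction_on with
      | zero => simp
      | add a b ha hb => simp only [map_add, ha, hb]
      | tmul a b => simp [φ]
    exact (h1 (twistComul hF.twist (D.aEquiv a))).trans (key (D.aEquiv a))

end ScalarFamily

end QLSDatum

namespace QLSDatum

open Coalgebra Bialgebra WithConv

variable {k G : Type*} [Field k] [Group G] {θ : ℕ} (D : QLSDatum k G θ)

/-! ### Coefficient functionals -/

/-- The shift `f ↦ (0, f 0, f 1, …, f (n - 2), 0, 0, …)`. -/
def truncShift (k : Type*) [Field k] (n : ℕ) : Module.End k (ℕ → k) where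
  toFun f m := if 0 < m ∧ m < n then f (m - 1) else 0
  map_add' f g := by ext m; dsimp only [Pi.add_apply]; split_ifs <;> simp
  map_smul' c f := by ext m; dsimp only [Pi.smul_apply]; split_ifs <;> simp

lemma truncShift_apply (n : ℕ) (f : ℕ → k) (m : ℕ) :
    truncShift k n f m = if 0 < m ∧ m < n then f (m - 1) else 0 := rfl

lemma truncShift_pow {n : ℕ} (hn : 0 < n) : truncShift k n ^ n = 0 := by
  have h : ∀ l f m, m < l ∨ n ≤ m → 0 < l → (truncShift k n ^ l) f m = 0 := by
    intro l
    induction l with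
    | zero => intro f m _ h; omega
    | succ l ih =>
      intro f m hm _
      rw [pow_succ', Module.End.mul_apply, truncShift_apply]
      split_ifs with h
      · exact ih f (m - 1) (by omega) (by omega)
      · rfl
  ext f m
  exact h n _ m (by omega) hn

/-- The operator `f ↦ (m ↦ c ^ m f m)`. -/
def powDiag (k : Type*) [Field k] : k →* Module.End k (ℕ → k) where
  toFun c :=
    { toFun f m := c ^ m * f m
      map_add' f g := by ext m; simp [mul_add]
      map_smul' r f := by ext m; simp [mul_left_comm] }
  map_one' := by ext; simp
  map_mul' c d := by ext; simp [mul_pow, mul_assoc]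

lemma powDiag_apply (c : k) (f : ℕ → k) (m : ℕ) : powDiag k c f m = c ^ m * f m := rfl

/-- The representation of the bosonization on sequences in which `x_i` acts by a truncated shift,
the other `x_j` act as zero and a group element `s` acts on the `m`-th term by `χ_i(s) ^ m`. -/
def coeffRep (i : Fin θ) : D.NicholsSmash →ₐ[k] Module.End k (ℕ → k) :=
  D.smashLift
    (D.nicholsLift (fun j => if j = i then truncShift k (D.N i) else 0)
      (fun j => by
        split_ifs with h
        · rw [h, truncShift_pow (by have := D.one_lt_N i; omega)]
        · exact zero_pow (by have := D.one_lt_N j; omega))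
      (fun j l hjl => by
        split_ifs with h h'
        · exact absurd (h.trans h'.symm) hjl
        all_goals simp))
    ((powDiag k).comp ((Units.coeHom k).comp (D.χ i)))
    (by
      intro s j
      rw [nicholsLift_x]
      split_ifs with h
      · subst h
        ext f m
        simp only [MonoidHom.comp_apply, Units.coeHom_apply, Module.End.mul_apply, powDiag_apply,
          LinearMap.smul_apply, Pi.smul_apply, truncShift_apply, smul_eq_mul]
        split_ifs with hm
        · obtain ⟨m, rfl⟩ : ∃ l, m = l + 1 := ⟨m - 1, by omega⟩
          rw [pow_succ', Nat.add_sub_cancel, mul_assoc]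
        · rw [mul_zero, mul_zero]
      · simp)

/-- The coefficient functional of `x_i ^ m`, summed over the group elements: it is `1` on
`x_i ^ m s` if `m < N_i`, and `0` on `x_i ^ n s` with `n ≠ m` and on products involving some `x_j`,
`j ≠ i`. -/
def coeff (i : Fin θ) (m : ℕ) : D.NicholsSmash →ₗ[k] k :=
  LinearMap.proj m ∘ₗ (LinearMap.applyₗ (Pi.single 0 1 : ℕ → k)) ∘ₗ (D.coeffRep i).toLinearMap

lemma coeff_apply (i : Fin θ) (m : ℕ) (a : D.NicholsSmash) :
    D.coeff i m a = D.coeffRep i a (Pi.single 0 1) m := rfl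

lemma coeff_grp (i : Fin θ) (m : ℕ) (s : G) :
    D.coeff i m (D.grp s) = if m = 0 then 1 else 0 := by
  rw [coeff_apply, coeffRep, smashLift_grp]
  simp only [MonoidHom.comp_apply, Units.coeHom_apply, powDiag_apply]
  rcases eq_or_ne m 0 with rfl | h
  · simp
  · simp [h]

lemma coeff_gen_mul (i j : Fin θ) (m : ℕ) (a : D.NicholsSmash) : D.coeff i m (D.gen j * a) =
    if j = i ∧ 0 < m ∧ m < D.N i then D.coeff i (m - 1) a else 0 := by
  rw [coeff_apply, map_mul, Module.End.mul_apply]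
  nth_rw 1 [coeffRep]
  rw [smashLift_gen, nicholsLift_x]
  by_cases h : j = i
  · rw [if_pos h, truncShift_apply]
    simp only [h, true_and, coeff_apply]
  · rw [if_neg h]
    simp [h]

lemma coeff_grp_mul (i : Fin θ) (m : ℕ) (s : G) (a : D.NicholsSmash) :
    D.coeff i m (D.grp s * a) = (D.χ i s : k) ^ m * D.coeff i m a := by
  rw [coeff_apply, map_mul, Module.End.mul_apply]
  nth_rw 1 [coeffRep]
  rw [smashLift_grp]
  rfl

lemma coeff_zero (i : Fin θ) : D.coeff i 0 = Coalgebra.counit := by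
  ext a
  induction a using D.smash_induction with
  | zero => simp
  | add a b ha hb => rw [map_add, map_add, ha, hb]
  | smul c a ha => rw [map_smul, map_smul, ha]
  | grp s => rw [coeff_grp, counit_grp, if_pos rfl]
  | gen_mul j a _ => rw [coeff_gen_mul, Bialgebra.counit_mul, counit_gen, zero_mul]; simp

lemma coeff_comp_gen_self {i : Fin θ} {m : ℕ} (hm : m + 1 < D.N i) :
    D.coeff i (m + 1) ∘ₗ LinearMap.mulLeft k (D.gen i) = D.coeff i m := by
  ext a; simp [coeff_gen_mul, hm]

lemma coeff_comp_gen_of_ne {i j : Fin θ} (m : ℕ) (h : j ≠ i) :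
    D.coeff i m ∘ₗ LinearMap.mulLeft k (D.gen j) = 0 := by
  ext a; simp [coeff_gen_mul, h]

lemma coeff_zero_comp_gen (i j : Fin θ) :
    D.coeff i 0 ∘ₗ LinearMap.mulLeft k (D.gen j) = 0 := by
  ext a; simp [coeff_gen_mul]

lemma coeff_comp_grp (i : Fin θ) (m : ℕ) (s : G) :
    D.coeff i m ∘ₗ LinearMap.mulLeft k (D.grp s) = (D.χ i s : k) ^ m • D.coeff i m := by
  ext a; simp [coeff_grp_mul]

/-- The coefficient of the group element `t` in the image in the group algebra. -/
def grpCoeff (t : G) : D.NicholsSmash →ₗ[k] k :=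
  Finsupp.lapply t ∘ₗ (MonoidAlgebra.coeffLinearEquiv k).toLinearMap ∘ₗ
    D.toGroupAlgebra.toLinearMap

lemma grpCoeff_apply (t : G) (a : D.NicholsSmash) :
    D.grpCoeff t a = (D.toGroupAlgebra a).coeff t := rfl

lemma grpCoeff_comp_gen (t : G) (i : Fin θ) :
    D.grpCoeff t ∘ₗ LinearMap.mulLeft k (D.gen i) = 0 := by
  ext a; simp [grpCoeff_apply]

lemma grpCoeff_comp_grp (t s : G) :
    D.grpCoeff t ∘ₗ LinearMap.mulLeft k (D.grp s) = D.grpCoeff (s⁻¹ * t) := by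
  ext a
  simp [grpCoeff_apply]

/-! ### Functionals on the tensor square -/

section Tens

variable {D}

/-- The functional `f ⊗ g` on the tensor square. -/
def tensFun (f g : D.NicholsSmash →ₗ[k] k) : D.SmashSq →ₗ[k] k :=
  LinearMap.mul' k k ∘ₗ TensorProduct.map f g

@[simp] lemma tensFun_tmul (f g : D.NicholsSmash →ₗ[k] k) (a b : D.NicholsSmash) :
    tensFun f g (a ⊗ₜ b) = f a * g b := rfl

lemma tensFun_tmul_mul (f g : D.NicholsSmash →ₗ[k] k) (a b : D.NicholsSmash) (z : D.SmashSq) :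
    tensFun f g (a ⊗ₜ b * z) =
      tensFun (f ∘ₗ LinearMap.mulLeft k a) (g ∘ₗ LinearMap.mulLeft k b) z := by
  induction z using TensorProduct.induction_on with
  | zero => simp
  | add x y hx hy => rw [mul_add, map_add, map_add, hx, hy]
  | tmul c d => simp

lemma tensFun_zero_left (g : D.NicholsSmash →ₗ[k] k) : tensFun 0 g = 0 := by
  ext; simp

lemma tensFun_zero_right (f : D.NicholsSmash →ₗ[k] k) : tensFun f 0 = 0 := by
  ext; simp

lemma tensFun_smul_left (c : k) (f g : D.NicholsSmash →ₗ[k] k) :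
    tensFun (c • f) g = c • tensFun f g := by
  ext; simp [mul_assoc]

lemma tensFun_counit_comul (g : D.NicholsSmash →ₗ[k] k) (a : D.NicholsSmash) :
    tensFun Coalgebra.counit g (comul (R := k) a) = g a := by
  have h : ∀ z : D.SmashSq, tensFun Coalgebra.counit g z =
      LinearMap.mul' k k (TensorProduct.map .id g ((Coalgebra.counit (R := k)).rTensor _ z)) := by
    intro z
    induction z using TensorProduct.induction_on with
    | zero => simp
    | add x y hx hy => simp only [map_add, hx, hy]
    | tmul c d => simp
  rw [h, Coalgebra.rTensor_counit_comul]
  simp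

lemma tensFun_comul_counit (f : D.NicholsSmash →ₗ[k] k) (a : D.NicholsSmash) :
    tensFun f Coalgebra.counit (comul (R := k) a) = f a := by
  have h : ∀ z : D.SmashSq, tensFun f Coalgebra.counit z =
      LinearMap.mul' k k (TensorProduct.map f .id ((Coalgebra.counit (R := k)).lTensor _ z)) := by
    intro z
    induction z using TensorProduct.induction_on with
    | zero => simp
    | add x y hx hy => simp only [map_add, hx, hy]
    | tmul c d => simp
  rw [h, Coalgebra.lTensor_counit_comul]
  simp

end Tens

variable {D}

/-! ### Evaluating functionals on the twist -/

lemma coeff_comp_gen_pow_of_ne {i j : Fin θ} (m : ℕ) (h : j ≠ i) {n : ℕ} (hn : n ≠ 0) :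
    D.coeff i m ∘ₗ LinearMap.mulLeft k (D.gen j ^ n) = 0 := by
  obtain ⟨n, rfl⟩ := Nat.exists_eq_succ_of_ne_zero hn
  rw [pow_succ', LinearMap.mulLeft_mul, ← LinearMap.comp_assoc, coeff_comp_gen_of_ne D m h,
    LinearMap.zero_comp]

lemma coeff_comp_gen_pow_of_lt (i : Fin θ) {m n : ℕ} (h : m < n) :
    D.coeff i m ∘ₗ LinearMap.mulLeft k (D.gen i ^ n) = 0 := by
  ext a
  induction n generalizing m with
  | zero => omega
  | succ n ih =>
    have := fun h' => ih (m := m - 1) h'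
    simp only [LinearMap.comp_apply, LinearMap.mulLeft_apply, LinearMap.zero_apply] at this ⊢
    rw [pow_succ', mul_assoc, coeff_gen_mul]
    split_ifs with h1
    · exact this (by omega)
    · rfl

lemma coeff_comp_gen_pow_self (i : Fin θ) {m : ℕ} (h : m < D.N i) :
    D.coeff i m ∘ₗ LinearMap.mulLeft k (D.gen i ^ m) = Coalgebra.counit := by
  induction m with
  | zero => ext a; simp [coeff_zero]
  | succ m ih =>
    rw [pow_succ', LinearMap.mulLeft_mul, ← LinearMap.comp_assoc, coeff_comp_gen_self D h,
      ih (by omega)]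

lemma counit_comp_gen (i : Fin θ) :
    (Coalgebra.counit : D.NicholsSmash →ₗ[k] k) ∘ₗ LinearMap.mulLeft k (D.gen i) = 0 := by
  ext a; simp

lemma counit_comp_grp (s : G) :
    (Coalgebra.counit : D.NicholsSmash →ₗ[k] k) ∘ₗ LinearMap.mulLeft k (D.grp s) =
      Coalgebra.counit := by
  ext a; simp

lemma tensFun_T_mul (f g : D.NicholsSmash →ₗ[k] k) (i : Fin θ) (W : D.SmashSq) :
    tensFun f g (D.T i * W) = ∑ ab ∈ Finset.HasAntidiagonal.antidiagonal (D.N i),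
      ((qFactorial (D.q i i) ab.1)⁻¹ * (qFactorial (D.q i i) ab.2)⁻¹) *
        tensFun (f ∘ₗ LinearMap.mulLeft k (D.gen i ^ ab.1) ∘ₗ
          LinearMap.mulLeft k (D.grp (D.g i) ^ ab.2))
          (g ∘ₗ LinearMap.mulLeft k (D.gen i ^ ab.2)) W := by
  rw [T_eq_sum, Finset.sum_mul, map_sum]
  refine Finset.sum_congr rfl fun ab _ => ?_
  rw [qDivPow, qDivPow, smul_mul_assoc, TensorProduct.tmul_smul, ← TensorProduct.smul_tmul',
    smul_smul, smul_mul_assoc, map_smul, tensFun_tmul_mul, LinearMap.mulLeft_mul, smul_eq_mul,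
    mul_comm (qFactorial _ ab.2)⁻¹]

lemma tensFun_B_mul (f g : D.NicholsSmash →ₗ[k] k) (i j : Fin θ) (W : D.SmashSq) :
    tensFun f g (D.B i j * W) = tensFun ((f ∘ₗ LinearMap.mulLeft k (D.gen i)) ∘ₗ
      LinearMap.mulLeft k (D.grp (D.g j))) (g ∘ₗ LinearMap.mulLeft k (D.gen j)) W := by
  rw [B_eq, tensFun_tmul_mul, LinearMap.mulLeft_mul, LinearMap.comp_assoc]

/-- The hypothesis concerns positive exponents only, since the terms of `T i` with exponents `0` and
`N_i` vanish. -/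
lemma tensFun_T_mul_eq_zero {f g : D.NicholsSmash →ₗ[k] k} {i : Fin θ}
    (h : ∀ n m, n + m = D.N i → n ≠ 0 → m ≠ 0 →
      f ∘ₗ LinearMap.mulLeft k (D.gen i ^ n) = 0 ∨ g ∘ₗ LinearMap.mulLeft k (D.gen i ^ m) = 0)
    (W : D.SmashSq) : tensFun f g (D.T i * W) = 0 := by
  rw [tensFun_T_mul]
  refine Finset.sum_eq_zero fun ab hab => ?_
  rw [Finset.HasAntidiagonal.mem_antidiagonal] at hab
  have hz : ∀ f : D.NicholsSmash →ₗ[k] k, f ∘ₗ LinearMap.mulLeft k (D.gen i ^ D.N i) = 0 := by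
    intro f; ext a; simp [gen_pow]
  have h' : f ∘ₗ LinearMap.mulLeft k (D.gen i ^ ab.1) = 0 ∨
      g ∘ₗ LinearMap.mulLeft k (D.gen i ^ ab.2) = 0 := by
    rcases Nat.eq_zero_or_pos ab.1 with h1 | h1
    · right
      rw [show ab.2 = D.N i by omega]; exact hz g
    rcases Nat.eq_zero_or_pos ab.2 with h2 | h2
    · left
      rw [show ab.1 = D.N i by omega]; exact hz f
    exact h ab.1 ab.2 hab h1.ne' h2.ne'
  rcases h' with h' | h'
  · rw [← LinearMap.comp_assoc, h', LinearMap.zero_comp, tensFun_zero_left, LinearMap.zero_apply,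
      mul_zero]
  · rw [h', tensFun_zero_right, LinearMap.zero_apply, mul_zero]

lemma tensFun_B_mul_eq_zero {f g : D.NicholsSmash →ₗ[k] k} {i j : Fin θ}
    (h : f ∘ₗ LinearMap.mulLeft k (D.gen i) = 0 ∨ g ∘ₗ LinearMap.mulLeft k (D.gen j) = 0)
    (W : D.SmashSq) : tensFun f g (D.B i j * W) = 0 := by
  rw [tensFun_B_mul]
  rcases h with h | h
  · rw [h, LinearMap.zero_comp, tensFun_zero_left, LinearMap.zero_apply]
  · rw [h, tensFun_zero_right, LinearMap.zero_apply]

lemma ScalarFamily.map_logJ_mul (F : D.ScalarFamily) (Ξ : D.SmashSq →ₗ[k] k) (W : D.SmashSq) :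
    Ξ (F.logJ * W) = ∑ i, F.ξ i * Ξ (D.T i * W) +
      ∑ i, ∑ j, if i = j then 0 else F.a i j * Ξ (D.B i j * W) := by
  simp only [logJ, add_mul, Finset.sum_mul, map_add, map_sum, smul_mul_assoc, map_smul,
    smul_eq_mul, bTerm]
  congr 1
  refine Finset.sum_congr rfl fun i _ => Finset.sum_congr rfl fun j _ => ?_
  split_ifs with hij
  · rw [zero_mul, map_zero]
  · rw [smul_mul_assoc, map_smul, smul_eq_mul]

lemma ScalarFamily.tensFun_logJ_mul_eq_zero_left (F : D.ScalarFamily)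
    {f g : D.NicholsSmash →ₗ[k] k} (h : ∀ i, f ∘ₗ LinearMap.mulLeft k (D.gen i) = 0)
    (W : D.SmashSq) : tensFun f g (F.logJ * W) = 0 := by
  have h' : ∀ i n, n ≠ 0 → f ∘ₗ LinearMap.mulLeft k (D.gen i ^ n) = 0 := by
    intro i n hn
    obtain ⟨n, rfl⟩ := Nat.exists_eq_succ_of_ne_zero hn
    rw [pow_succ', LinearMap.mulLeft_mul, ← LinearMap.comp_assoc, h, LinearMap.zero_comp]
  rw [map_logJ_mul]
  simp only [tensFun_T_mul_eq_zero (fun n m _ hn _ => Or.inl (h' _ n hn)),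
    tensFun_B_mul_eq_zero (Or.inl (h _))]
  simp

lemma ScalarFamily.tensFun_logJ_mul_eq_zero_right (F : D.ScalarFamily)
    {f g : D.NicholsSmash →ₗ[k] k} (h : ∀ i, g ∘ₗ LinearMap.mulLeft k (D.gen i) = 0)
    (W : D.SmashSq) : tensFun f g (F.logJ * W) = 0 := by
  have h' : ∀ i n, n ≠ 0 → g ∘ₗ LinearMap.mulLeft k (D.gen i ^ n) = 0 := by
    intro i n hn
    obtain ⟨n, rfl⟩ := Nat.exists_eq_succ_of_ne_zero hn
    rw [pow_succ', LinearMap.mulLeft_mul, ← LinearMap.comp_assoc, h, LinearMap.zero_comp]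
  rw [map_logJ_mul]
  simp only [tensFun_T_mul_eq_zero (fun n m _ _ hm => Or.inr (h' _ m hm)),
    tensFun_B_mul_eq_zero (Or.inr (h _))]
  simp

/-- The functional `coeff i 1 ⊗ coeff i (N_i - 1)` detects the scalar `ξ_i`. -/
lemma ScalarFamily.tensFun_coeff_logJ_mul_ξ (F : D.ScalarFamily) (i : Fin θ) (W : D.SmashSq) :
    tensFun (D.coeff i 1) (D.coeff i (D.N i - 1)) (F.logJ * W) =
      (qFactorial (D.q i i) (D.N i - 1))⁻¹ * F.ξ i *
        tensFun Coalgebra.counit Coalgebra.counit W := by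
  have hN := D.one_lt_N i
  have hT : ∀ j, j ≠ i → tensFun (D.coeff i 1) (D.coeff i (D.N i - 1)) (D.T j * W) = 0 :=
    fun j hj => tensFun_T_mul_eq_zero
      (fun n m _ hn _ => Or.inl (coeff_comp_gen_pow_of_ne 1 hj hn)) W
  have hB : ∀ j l, (if j = l then 0 else F.a j l *
      tensFun (D.coeff i 1) (D.coeff i (D.N i - 1)) (D.B j l * W)) = 0 := by
    intro j l
    split_ifs with hjl
    · rfl
    · rw [tensFun_B_mul_eq_zero, mul_zero]
      by_cases hj : j = i
      · exact Or.inr (coeff_comp_gen_of_ne D _ fun hl => hjl (hj.trans hl.symm))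
      · exact Or.inl (coeff_comp_gen_of_ne D _ hj)
  have hTi : tensFun (D.coeff i 1) (D.coeff i (D.N i - 1)) (D.T i * W) =
      (qFactorial (D.q i i) (D.N i - 1))⁻¹ * tensFun Coalgebra.counit Coalgebra.counit W := by
    rw [tensFun_T_mul, Finset.sum_eq_single (1, D.N i - 1)]
    · have h1 := coeff_comp_gen_pow_self (D := D) i hN
      rw [← LinearMap.comp_assoc, h1, coeff_comp_gen_pow_self i (by omega), ← map_pow,
        counit_comp_grp]
      simp [qFactorial, qNumber]
    · rintro ⟨a, b⟩ hab hne
      rw [Finset.HasAntidiagonal.mem_antidiagonal] at hab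
      simp only at hab ⊢
      rcases Nat.lt_trichotomy a 1 with h | h | h
      · rw [coeff_comp_gen_pow_of_lt i (show D.N i - 1 < b by omega), tensFun_zero_right]
        simp
      · exact absurd (Prod.ext h (by simp only; omega)) hne
      · rw [← LinearMap.comp_assoc, coeff_comp_gen_pow_of_lt i h, LinearMap.zero_comp,
          tensFun_zero_left]
        simp
    · intro h
      exact absurd (Finset.HasAntidiagonal.mem_antidiagonal.mpr (by simp only; omega)) h
  rw [map_logJ_mul, Finset.sum_eq_single i (fun j _ hj => by rw [hT j hj, mul_zero])
    (fun h => absurd (Finset.mem_univ i) h), hTi]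
  simp only [hB, Finset.sum_const_zero, add_zero]
  ring

/-- The functional `coeff i 1 ⊗ coeff j 1` detects the scalar `a_{ij}`. -/
lemma ScalarFamily.tensFun_coeff_logJ_mul_a (F : D.ScalarFamily) {i j : Fin θ} (hij : i ≠ j)
    (W : D.SmashSq) :
    tensFun (D.coeff i 1) (D.coeff j 1) (F.logJ * W) =
      F.a i j * tensFun Coalgebra.counit Coalgebra.counit W := by
  have hT : ∀ l, tensFun (D.coeff i 1) (D.coeff j 1) (D.T l * W) = 0 := by
    refine fun l => tensFun_T_mul_eq_zero (fun n m _ hn hm => ?_) W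
    by_cases hl : l = i
    · exact Or.inr (coeff_comp_gen_pow_of_ne 1 (fun h => hij (hl.symm.trans h)) hm)
    · exact Or.inl (coeff_comp_gen_pow_of_ne 1 hl hn)
  have hB : ∀ l m, l ≠ i ∨ m ≠ j → tensFun (D.coeff i 1) (D.coeff j 1) (D.B l m * W) = 0 :=
    fun l m h => tensFun_B_mul_eq_zero
      (h.imp (coeff_comp_gen_of_ne D 1) (coeff_comp_gen_of_ne D 1)) W
  have hBij : tensFun (D.coeff i 1) (D.coeff j 1) (D.B i j * W) =
      tensFun Coalgebra.counit Coalgebra.counit W := by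
    rw [tensFun_B_mul, coeff_comp_gen_self D (D.one_lt_N i), coeff_comp_gen_self D (D.one_lt_N j),
      coeff_zero, coeff_zero, counit_comp_grp]
  rw [map_logJ_mul]
  simp only [hT, mul_zero, Finset.sum_const_zero, zero_add]
  rw [Finset.sum_eq_single i, Finset.sum_eq_single j, if_neg hij, hBij]
  · intro m _ hm
    rw [hB i m (Or.inr hm), mul_zero, ite_self]
  · exact fun h => absurd (Finset.mem_univ j) h
  · intro l _ hl
    refine Finset.sum_eq_zero fun m _ => ?_
    rw [hB l m (Or.inl hl), mul_zero, ite_self]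
  · exact fun h => absurd (Finset.mem_univ i) h

/-! ### Evaluating functionals on coproducts -/

lemma tensFun_comul_gen_mul (f g : D.NicholsSmash →ₗ[k] k) (l : Fin θ) (a : D.NicholsSmash) :
    tensFun f g (comul (R := k) (D.gen l * a)) =
      tensFun (f ∘ₗ LinearMap.mulLeft k (D.gen l)) g (comul (R := k) a) +
      tensFun (f ∘ₗ LinearMap.mulLeft k (D.grp (D.g l))) (g ∘ₗ LinearMap.mulLeft k (D.gen l))
        (comul (R := k) a) := by
  rw [Bialgebra.comul_mul, comul_gen, add_mul, map_add, tensFun_tmul_mul, tensFun_tmul_mul,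
    LinearMap.mulLeft_one, LinearMap.comp_id]

/-- The coproduct of `x_i ^ (n + 1)` contains `x_i ⊗ x_i ^ n` with coefficient `(n + 1)_q`, which
vanishes for `n = N_i - 1`. -/
lemma tensFun_coeff_comul (i : Fin θ) {n : ℕ} (hn : n < D.N i) (a : D.NicholsSmash) :
    tensFun (D.coeff i 1) (D.coeff i n) (comul (R := k) a) =
      qNumber (D.q i i) (n + 1) * D.coeff i (n + 1) a := by
  have hN := D.one_lt_N i
  induction a using D.smash_induction generalizing n with
  | zero => simp
  | add a b ha hb => rw [map_add, map_add, map_add, ha hn, hb hn, mul_add]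
  | smul c a ha => rw [map_smul, map_smul, map_smul, ha hn, smul_eq_mul, smul_eq_mul]; ring
  | grp s => simp [coeff_grp]
  | gen_mul l a ih =>
    rw [tensFun_comul_gen_mul]
    rcases eq_or_ne l i with rfl | hl
    · rw [coeff_comp_gen_self D hN, coeff_zero, tensFun_counit_comul, coeff_comp_grp,
        tensFun_smul_left, pow_one]
      have hq : (D.χ l (D.g l) : k) = D.q l l := rfl
      rw [hq, LinearMap.smul_apply]
      have e : D.coeff l n a + D.q l l * (qNumber (D.q l l) n * D.coeff l n a) =
          qNumber (D.q l l) (n + 1) * D.coeff l n a := by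
        rw [add_comm n 1, qNumber_add]
        simp [qNumber]
        ring
      have hl : D.coeff l (n + 1) (D.gen l * a) =
          if n + 1 < D.N l then D.coeff l n a else 0 := by
        rw [coeff_gen_mul]; simp
      have h2 : tensFun (D.coeff l 1) (D.coeff l n ∘ₗ LinearMap.mulLeft k (D.gen l))
          (comul (R := k) a) = qNumber (D.q l l) n * D.coeff l n a := by
        rcases Nat.eq_zero_or_pos n with rfl | h0
        · rw [coeff_zero_comp_gen, tensFun_zero_right]; simp [qNumber]
        · obtain ⟨m, rfl⟩ : ∃ m, n = m + 1 := ⟨n - 1, by omega⟩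
          rw [coeff_comp_gen_self D hn]
          exact ih (by omega)
      rw [h2, smul_eq_mul, e, hl]
      split_ifs with h3
      · rfl
      · have h4 : n + 1 = orderOf (D.q l l) := by change n + 1 = D.N l; omega
        rw [h4, qNumber_orderOf (q := D.q l l) (D.one_lt_orderOf l), zero_mul, zero_mul]
    · rw [coeff_comp_gen_of_ne D _ hl, coeff_comp_gen_of_ne D _ hl, tensFun_zero_left,
        tensFun_zero_right, coeff_gen_mul]
      simp [hl]

/-- The coefficients of `x_i ⊗ x_j` and `x_j ⊗ x_i` in a coproduct agree up to a factor
`q_{ij}`. -/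
lemma tensFun_coeff_comul_swap {i j : Fin θ} (hij : i ≠ j) (a : D.NicholsSmash) :
    tensFun (D.coeff j 1) (D.coeff i 1) (comul (R := k) a) =
      D.q i j * tensFun (D.coeff i 1) (D.coeff j 1) (comul (R := k) a) := by
  induction a using D.smash_induction with
  | zero => simp
  | add a b ha hb => simp only [map_add, ha, hb, mul_add]
  | smul c a ha => simp only [map_smul, ha, smul_eq_mul]; ring
  | grp s => simp [coeff_grp]
  | gen_mul l a _ =>
    have hq : (D.χ j (D.g i) : k) = D.q i j := rfl
    have hq' : (D.χ i (D.g j) : k) = D.q j i := rfl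
    rw [tensFun_comul_gen_mul, tensFun_comul_gen_mul]
    rcases eq_or_ne l i with rfl | hi
    · rw [coeff_comp_gen_of_ne D 1 hij, coeff_comp_gen_self D (D.one_lt_N l), coeff_zero,
        tensFun_zero_left, tensFun_zero_right, coeff_comp_grp, tensFun_smul_left,
        LinearMap.smul_apply, tensFun_comul_counit, tensFun_counit_comul, pow_one, hq]
      simp
    rcases eq_or_ne l j with rfl | hj
    · rw [coeff_comp_gen_of_ne D 1 hi, coeff_comp_gen_self D (D.one_lt_N l), coeff_zero,
        tensFun_zero_left, tensFun_zero_right, coeff_comp_grp, tensFun_smul_left,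
        LinearMap.smul_apply, tensFun_comul_counit, tensFun_counit_comul, pow_one, hq',
        smul_eq_mul]
      simp only [LinearMap.zero_apply, zero_add, add_zero]
      rw [← mul_assoc, D.q_mul_q hij, one_mul]
    · simp [coeff_comp_gen_of_ne D 1 hi, coeff_comp_gen_of_ne D 1 hj, tensFun_zero_left,
        tensFun_zero_right]

/-- Only the multiples `x_i t` of `x_i` contribute, and `Δ(x_i t) = x_i t ⊗ t + g_i t ⊗ x_i t`. -/
lemma tensFun_coeff_grpCoeff_comul (i : Fin θ) (t : G) (a : D.NicholsSmash) :
    tensFun (D.coeff i 1) (D.grpCoeff t) (comul (R := k) a) =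
      tensFun (D.grpCoeff (D.g i * t)) (D.coeff i 1) (comul (R := k) a) := by
  induction a using D.smash_induction with
  | zero => simp
  | add a b ha hb => simp only [map_add, ha, hb]
  | smul c a ha => simp only [map_smul, ha]
  | grp s => simp [coeff_grp]
  | gen_mul l a _ =>
    rw [tensFun_comul_gen_mul, tensFun_comul_gen_mul, grpCoeff_comp_gen, grpCoeff_comp_gen,
      grpCoeff_comp_grp, tensFun_zero_left, tensFun_zero_right]
    rcases eq_or_ne l i with rfl | hl
    · rw [coeff_comp_gen_self D (D.one_lt_N l), coeff_zero, tensFun_counit_comul,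
        tensFun_comul_counit, inv_mul_cancel_left]
      simp
    · rw [coeff_comp_gen_of_ne D 1 hl, tensFun_zero_left, tensFun_zero_right]

end QLSDatum

/-! ### Group-like elements of the twisted bialgebra -/

lemma mul_nilExp_of_mul_eq (k : Type*) [Field k] [CharZero k] {A : Type*} [Ring A] [Algebra k A]
    {a b z : A} (h : z * a = b * z) (ha : IsNilpotent a) (hb : IsNilpotent b) :
    z * nilExp k a = nilExp k b * z := by
  obtain ⟨m, hm⟩ := ha
  obtain ⟨n, hn⟩ := hb
  rw [nilExp_eq_sum k (n := m + n) (by rw [pow_add, hm, zero_mul]),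
    nilExp_eq_sum k (n := m + n) (by rw [pow_add, hn, mul_zero]), Finset.mul_sum, Finset.sum_mul]
  refine Finset.sum_congr rfl fun i _ => ?_
  rw [mul_smul_comm, smul_mul_assoc]
  congr 1
  exact SemiconjBy.pow_right (x := a) (y := b) h i

namespace QLSDatum

open Coalgebra Bialgebra WithConv

variable {k G : Type*} [Field k] [Group G] {θ : ℕ} {D : QLSDatum k G θ}

lemma ofNichols_mem_subΓ (v : D.Nichols) : D.ofNichols v ∈ D.subΓ := by
  induction v using D.nichols_induction with
  | one => rw [map_one]; exact D.subΓ.one_mem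
  | add a b ha hb => rw [map_add]; exact D.subΓ.add_mem ha hb
  | smul c a ha => rw [map_smul]; exact D.subΓ.smul_mem ha c
  | x_mul i a ha => rw [map_mul]; exact D.subΓ.mul_mem (D.gen_mem_subΓ i) ha

variable (D) in
/-- The character of the bosonization given by a character of `G`. -/
def charHom (η : G →* k) : D.NicholsSmash →ₐ[k] k :=
  (MonoidAlgebra.lift k k G η).comp D.toGroupAlgebra

lemma charHom_eq {η : G →* k} {a : D.NicholsSmash} {s : G}
    (h : D.toGroupAlgebra a = MonoidAlgebra.of k G s) : D.charHom η a = η s := by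
  rw [charHom, AlgHom.comp_apply, h]
  simp

lemma charHom_single (η : G →* k) (t : G) (w : D.Nichols) :
    D.charHom η (D.smashSingle t w) = counit (R := k) (D.smashSingle t w) * η t := by
  have h1 : (D.charHom η).comp D.ofNichols = (counitAlgHom k _).comp D.ofNichols := by
    refine nichols_algHom_ext fun i => ?_
    change D.charHom η (D.gen i) = counit (R := k) (D.gen i)
    rw [charHom, AlgHom.comp_apply, toGroupAlgebra_gen, map_zero, counit_gen]
  have h2 : D.charHom η (D.ofNichols w) = counit (R := k) (D.ofNichols w) :=
    DFunLike.congr_fun h1 w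
  rw [← ofNichols_mul_grp, map_mul, h2, charHom_eq (D.toGroupAlgebra_grp t), Bialgebra.counit_mul,
    counit_grp, mul_one]

namespace ScalarFamily

variable [CharZero k] {F : D.ScalarFamily}

lemma IsAdmissible.grpDiag_mul_twist (hF : F.IsAdmissible) (t : G) :
    D.grpDiag t * hF.twist.val = (hF.act t).twist.val * D.grpDiag t :=
  mul_nilExp_of_mul_eq k (F.grpDiag_mul_logJ t) (twistSpan_isNilpotent hF.logJ_mem)
    (twistSpan_isNilpotent (hF.act t).logJ_mem)

lemma IsAdmissible.comul_mul_twist (hF : F.IsAdmissible) (t : G) (w : D.Nichols) :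
    comul (R := k) (D.smashSingle t w) * hF.twist.val =
      (hF.act t).twist.val * comul (R := k) (D.smashSingle t w) := by
  have h : Commute (comul (R := k) (D.ofNichols w)) (hF.act t).twist.val :=
    commute_nilExp k (mem_infTwist_commute (D.twistSpan_le_infTwist (hF.act t).logJ_mem)
      (ofNichols_mem_subΓ w)).symm (twistSpan_isNilpotent (hF.act t).logJ_mem)
  rw [← ofNichols_mul_grp, Bialgebra.comul_mul, comul_grp, ← grpDiag_apply, mul_assoc,
    hF.grpDiag_mul_twist, ← mul_assoc, h.eq, mul_assoc]

omit [CharZero k] in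
lemma tensFun_counit_logJ_mul (F : D.ScalarFamily) (W : D.SmashSq) :
    tensFun counit counit (F.logJ * W) = 0 :=
  F.tensFun_logJ_mul_eq_zero_left counit_comp_gen W

lemma IsAdmissible.map_twist_mul (hF : F.IsAdmissible) {Ξ : D.SmashSq →ₗ[k] k} {c : k}
    (hΞ : ∀ W, Ξ (F.logJ * W) = c * tensFun counit counit W) (W : D.SmashSq) :
    Ξ (hF.twist.val * W) = Ξ W + c * tensFun counit counit W := by
  have h := map_nilExp_mul k (f := Ξ) (g := c • tensFun counit counit)
    (twistSpan_isNilpotent hF.logJ_mem)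
    (fun W => by rw [hΞ, LinearMap.smul_apply, smul_eq_mul])
    (fun W => by rw [LinearMap.smul_apply, tensFun_counit_logJ_mul, smul_zero]) W
  rwa [LinearMap.smul_apply, smul_eq_mul] at h

/-- Let `v` be group-like for the twisted comultiplication, with image `s` in the group algebra, and
let `Ξ` be a functional which detects a scalar `c` of the family, on which `G` acts by `η`.
Evaluating `Ξ` on `Δ(v) 𝒥 = 𝒥 (v ⊗ v)` relates `c` and `η(s) c`. -/
lemma IsAdmissible.map_comul_add (hF : F.IsAdmissible) {v : D.NicholsSmash} {s : G}
    (hv : comul (R := k) v * hF.twist.val = hF.twist.val * (v ⊗ₜ v))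
    (hs : D.toGroupAlgebra v = MonoidAlgebra.of k G s) {Ξ : D.SmashSq →ₗ[k] k} {c : k}
    {η : G →* k} (hΞ : ∀ t W, Ξ ((F.act t).logJ * W) = c * η t * tensFun counit counit W) :
    Ξ (comul (R := k) v) + c * η s = Ξ (v ⊗ₜ v) + c := by
  have h1 : ∀ h : D.NicholsSmash, Ξ (comul (R := k) h * hF.twist.val) =
      Ξ (comul (R := k) h) + c * D.charHom η h := by
    intro h
    induction h using D.smash_induction_single with
    | zero => simp
    | add a b ha hb => rw [map_add, map_add, map_add, add_mul, map_add, ha, hb, mul_add]; abel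
    | single t w =>
      rw [hF.comul_mul_twist, (hF.act t).map_twist_mul (hΞ t), tensFun_counit_comul,
        charHom_single, mul_assoc, mul_comm (η t)]
  have h2 : ∀ W, Ξ (F.logJ * W) = c * tensFun counit counit W := by
    intro W
    have h := hΞ 1 W
    rwa [map_one, mul_one, logJ_congr (F' := F) (fun i j _ => by simp [ScalarFamily.act])
      (fun i => by simp [ScalarFamily.act])] at h
  have hε : counit (R := k) v = 1 := by
    rw [← counit_toGroupAlgebra, hs]
    exact (MonoidAlgebra.isGroupLikeElem_of s).counit_eq_one
  have h3 := h1 v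
  rw [hv, hF.map_twist_mul h2, charHom_eq hs, tensFun_tmul, hε, mul_one, mul_one] at h3
  exact h3.symm

omit [CharZero k] in
lemma grpCoeff_eq {v : D.NicholsSmash} {s : G} (hs : D.toGroupAlgebra v = MonoidAlgebra.of k G s)
    (t : G) [Decidable (s = t)] : D.grpCoeff t v = if s = t then 1 else 0 := by
  rw [grpCoeff_apply, hs, MonoidAlgebra.of_apply, MonoidAlgebra.coeff_single]
  simp [Finsupp.single_apply]

variable {v : D.NicholsSmash} {s : G}

/-- Group-like elements of the twisted bialgebra have no component along the `x_i`. -/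
lemma IsAdmissible.coeff_one_eq_zero (hF : F.IsAdmissible)
    (hv : comul (R := k) v * hF.twist.val = hF.twist.val * (v ⊗ₜ v))
    (hs : D.toGroupAlgebra v = MonoidAlgebra.of k G s) (i : Fin θ) : D.coeff i 1 v = 0 := by
  classical
  have h1 := hF.map_comul_add hv hs (Ξ := tensFun (D.coeff i 1) (D.grpCoeff s)) (c := 0) (η := 1)
    fun t W => by
      rw [(F.act t).tensFun_logJ_mul_eq_zero_right (D.grpCoeff_comp_gen s)]; simp
  have h2 := hF.map_comul_add hv hs (Ξ := tensFun (D.grpCoeff (D.g i * s)) (D.coeff i 1))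
    (c := 0) (η := 1) fun t W => by
      rw [(F.act t).tensFun_logJ_mul_eq_zero_left (D.grpCoeff_comp_gen _)]; simp
  -- `g_i ≠ 1` as `q_{ii} ≠ 1`
  have hne : s ≠ D.g i * s := by
    intro h
    have hg : D.g i = 1 := mul_right_cancel (b := s) (by rw [← h, one_mul])
    have := D.one_lt_N i
    rw [N, q, hg, map_one, Units.val_one, orderOf_one] at this
    exact lt_irrefl _ this
  rw [zero_mul, add_zero, add_zero, tensFun_tmul, grpCoeff_eq hs] at h1 h2
  rw [if_pos rfl, mul_one] at h1
  rw [if_neg hne, zero_mul] at h2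
  rw [← h1, tensFun_coeff_grpCoeff_comul, h2]

lemma IsAdmissible.χ_pow_mul_ξ (hF : F.IsAdmissible)
    (hv : comul (R := k) v * hF.twist.val = hF.twist.val * (v ⊗ₜ v))
    (hs : D.toGroupAlgebra v = MonoidAlgebra.of k G s) (i : Fin θ) :
    (D.χ i s : k) ^ D.N i * F.ξ i = F.ξ i := by
  have hN := D.one_lt_N i
  have h0 : qFactorial (D.q i i) (D.N i - 1) ≠ 0 := by
    refine Finset.prod_ne_zero_iff.mpr fun m hm => ?_
    exact qNumber_ne_zero (q := D.q i i) (Nat.succ_pos m)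
      (by rw [Finset.mem_range] at hm; change _ < D.N i; omega)
  have h1 := hF.map_comul_add hv hs
    (Ξ := tensFun (D.coeff i 1) (D.coeff i (D.N i - 1)))
    (c := (qFactorial (D.q i i) (D.N i - 1))⁻¹ * F.ξ i)
    (η := (powMonoidHom (D.N i)).comp ((Units.coeHom k).comp (D.χ i)))
    fun t W => by
      rw [tensFun_coeff_logJ_mul_ξ]
      simp only [ScalarFamily.act, MonoidHom.comp_apply, powMonoidHom_apply, Units.coeHom_apply]
      ring
  have h2 : qNumber (D.q i i) (D.N i - 1 + 1) = 0 := by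
    rw [Nat.sub_add_cancel hN.le]
    exact qNumber_orderOf (q := D.q i i) (D.one_lt_orderOf i)
  rw [tensFun_coeff_comul i (by omega), h2, zero_mul, zero_add, tensFun_tmul,
    hF.coeff_one_eq_zero hv hs, zero_mul, zero_add] at h1
  refine mul_left_cancel₀ (inv_ne_zero h0) (Eq.trans ?_ h1)
  simp only [MonoidHom.comp_apply, powMonoidHom_apply, Units.coeHom_apply]
  ring

lemma IsAdmissible.χ_mul_χ_mul_a (hF : F.IsAdmissible)
    (hv : comul (R := k) v * hF.twist.val = hF.twist.val * (v ⊗ₜ v))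
    (hs : D.toGroupAlgebra v = MonoidAlgebra.of k G s) {i j : Fin θ} (hij : i ≠ j) :
    (D.χ i s : k) * D.χ j s * F.hat.a i j = F.hat.a i j := by
  have h : ∀ {i j : Fin θ}, i ≠ j → tensFun (D.coeff i 1) (D.coeff j 1) (comul (R := k) v) =
      F.a i j - F.a i j * (D.χ i s * D.χ j s) := by
    intro i j hij
    have h1 := hF.map_comul_add hv hs (Ξ := tensFun (D.coeff i 1) (D.coeff j 1)) (c := F.a i j)
      (η := (Units.coeHom k).comp (D.χ i * D.χ j)) fun t W => by
        rw [(F.act t).tensFun_coeff_logJ_mul_a hij]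
        simp only [ScalarFamily.act, MonoidHom.comp_apply, Units.coeHom_apply,
          MonoidHom.mul_apply, Units.val_mul]
        ring
    rw [tensFun_tmul, hF.coeff_one_eq_zero hv hs, zero_mul, zero_add] at h1
    simp only [MonoidHom.comp_apply, Units.coeHom_apply, MonoidHom.mul_apply, Units.val_mul] at h1
    exact eq_sub_of_add_eq h1
  have h1 := tensFun_coeff_comul_swap hij.symm v
  rw [h hij, h hij.symm] at h1
  rw [hF.hat_a hij]
  by_cases h0 : F.a i j ≠ 0 ∨ F.a j i ≠ 0
  · rw [(hF.isLinked_of_or hij h0).symm.q_eq] at h1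
    linear_combination h1
  · push Not at h0
    simp [h0.1, h0.2]

/-- Reading off the coefficient of `s` in the image in the group algebra is an idempotent of the
dual algebra. -/
lemma grpCoeff_idempotent (hF : F.IsAdmissible) (s : G) :
    letI := hF.bialgebra
    toConv (D.grpCoeff s ∘ₗ D.aEquiv.toLinearMap) * toConv (D.grpCoeff s ∘ₗ D.aEquiv.toLinearMap) =
      toConv (D.grpCoeff s ∘ₗ D.aEquiv.toLinearMap) := by
  classical
  let _ := hF.bialgebra
  let l : MonoidAlgebra k G →ₗ[k] k :=
    Finsupp.lapply s ∘ₗ (MonoidAlgebra.coeffLinearEquiv k).toLinearMap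
  have hl : ∀ y, LinearMap.mul' k k (TensorProduct.map l l (comul (R := k) y)) = l y := by
    intro y
    induction y using MonoidAlgebra.induction_on with
    | of t =>
      have h1 : l (MonoidAlgebra.of k G t) = if t = s then 1 else 0 := by
        change (MonoidAlgebra.of k G t).coeff s = _
        rw [MonoidAlgebra.of_apply, MonoidAlgebra.coeff_single]
        simp [Finsupp.single_apply]
      rw [(MonoidAlgebra.isGroupLikeElem_of t).comul_eq_tmul_self, TensorProduct.map_tmul,
        LinearMap.mul'_apply, h1]
      split_ifs <;> simp
    | add a b ha hb => simp only [map_add, ha, hb]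
    | smul c a ha => simp only [map_smul, ha]
  have h2 : ∀ z : D.A ⊗[k] D.A,
      LinearMap.mul' k k (TensorProduct.map (D.grpCoeff s ∘ₗ D.aEquiv.toLinearMap)
        (D.grpCoeff s ∘ₗ D.aEquiv.toLinearMap) z) = LinearMap.mul' k k (TensorProduct.map l l
        (TensorProduct.map (hF.aToGroupAlgebra : D.A →ₗ[k] MonoidAlgebra k G)
          (hF.aToGroupAlgebra : D.A →ₗ[k] MonoidAlgebra k G) z)) := by
    intro z
    induction z with
    | zero => simp
    | add a b ha hb => simp only [map_add, ha, hb]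
    | tmul a b => rfl
  ext a
  rw [LinearMap.convMul_apply]
  refine (h2 _).trans ?_
  have h3 := CoalgHomClass.map_comp_comul_apply hF.aToGroupAlgebra a
  rw [h3, hl]
  rfl

/-- If `A(V, G, 𝒟)` is pointed, then every element of `G` lifts to a group-like element. -/
lemma IsAdmissible.exists_lift [IsAlgClosed k] [Finite G] (hF : F.IsAdmissible)
    (hA : letI := hF.bialgebra; IsPointed k D.A) (s : G) :
    ∃ v : D.NicholsSmash, comul (R := k) v * hF.twist.val = hF.twist.val * (v ⊗ₜ v) ∧
      D.toGroupAlgebra v = MonoidAlgebra.of k G s := by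
  classical
  let _ := hF.bialgebra
  have : FiniteDimensional k D.A := Module.Finite.equiv D.aEquiv.symm.toLinearEquiv
  have hs : D.grpCoeff s (D.grp s) = 1 := by
    rw [grpCoeff_eq (D.toGroupAlgebra_grp s), if_pos rfl]
  obtain ⟨u, hu, hu1⟩ := IsPointed.exists_isGroupLikeElem (k := k) (C := D.A) hA
    (D.grpCoeff s ∘ₗ D.aEquiv.toLinearMap) (grpCoeff_idempotent hF s) (by
      intro h
      have := LinearMap.congr_fun h (D.aEquiv.symm (D.grp s))
      rw [LinearMap.comp_apply, AlgEquiv.toLinearMap_apply, AlgEquiv.apply_symm_apply, hs] at this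
      exact one_ne_zero this)
  refine ⟨D.aEquiv u, ?_, ?_⟩
  · have h1 : Algebra.TensorProduct.map D.aEquiv.symm.toAlgHom D.aEquiv.symm.toAlgHom
        (twistComul hF.twist (D.aEquiv u)) = u ⊗ₜ u := hu.comul_eq_tmul_self
    have h2 : ∀ z : D.SmashSq, Algebra.TensorProduct.map D.aEquiv.toAlgHom D.aEquiv.toAlgHom
        (Algebra.TensorProduct.map D.aEquiv.symm.toAlgHom D.aEquiv.symm.toAlgHom z) = z := by
      intro z
      induction z using TensorProduct.induction_on with
      | zero => simp
      | add a b ha hb => simp only [map_add, ha, hb]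
      | tmul a b => simp
    have h3 : twistComul hF.twist (D.aEquiv u) = D.aEquiv u ⊗ₜ D.aEquiv u := by
      rw [← h2 (twistComul hF.twist (D.aEquiv u)), h1]
      rfl
    rw [← h3, twistComul_apply, mul_assoc, Units.mul_inv_cancel_left]
  · have h1 : IsGroupLikeElem k (D.toGroupAlgebra (D.aEquiv u)) := hu.map hF.aToGroupAlgebra
    obtain ⟨t, ht⟩ := MonoidAlgebra.isGroupLikeElem_iff_mem_range_of.mp h1
    have h2 : D.grpCoeff s (D.aEquiv u) = 1 := hu1
    rw [grpCoeff_eq ht.symm] at h2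
    split_ifs at h2 with h
    · rw [← ht, h]
    · exact absurd h2 zero_ne_one

lemma IsAdmissible.isPointed_iff [IsAlgClosed k] [Finite G] (hF : F.IsAdmissible) :
    letI := hF.bialgebra
    IsPointed k D.A ↔ F.hat.IsInvariant Set.univ := by
  let _ := hF.bialgebra
  constructor
  · intro hA s _
    obtain ⟨v, hv, hs⟩ := hF.exists_lift hA s
    exact ⟨fun i j hij => hF.χ_mul_χ_mul_a hv hs hij, hF.χ_pow_mul_ξ hv hs⟩
  · intro hinv
    obtain ⟨e⟩ := hF.nonempty_bialgEquiv hinv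
    exact D.isPointed_nicholsSmash.of_equiv (e.symm : D.NicholsSmash ≃ₗc[k] D.A)

/-- Here `b_{ij} = -2 a_{ij}`. -/
lemma isInvariant_hat_iff (hq : F.IsQSymmetric) :
    F.hat.IsInvariant Set.univ ↔ F.IsInvariant Set.univ := by
  have h : ∀ i j, i ≠ j → F.hat.a i j = -2 * F.a i j := by
    intro i j hij
    change D.q i j * F.a j i - F.a i j = _
    linear_combination hq i j hij
  refine forall₂_congr fun s _ => and_congr_left' (forall₃_congr fun i j hij => ?_)
  rw [h i j hij, mul_left_comm]
  exact (mul_right_injective₀ (by norm_num : (-2 : k) ≠ 0)).eq_iff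

end ScalarFamily

end QLSDatum

end

theorem mainTheorem4 {k G : Type*} [Field k] [IsAlgClosed k] [CharZero k] [Group G] [Finite G]
    {θ : ℕ} (D : QLSDatum k G θ) (F : D.ScalarFamily) (hcompat : F.IsCompatible)
    (hΓ : F.IsInvariant (D.Γ : Set G)) :
    ∃ _ : Coalgebra k D.A,
      F.IsQuotientCoalgebra ∧ IsHopfAlgebra k D.A ∧
      (IsPointed k D.A ↔ F.hat.IsInvariant Set.univ) ∧
      (F.IsQSymmetric →
        (IsPointed k D.A ↔ F.IsInvariant Set.univ) ∧
        (F.IsInvariant Set.univ ↔ Nonempty (D.A ≃ₐc[k] D.NicholsSmash))) := by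
  have hF := F.isAdmissible hcompat hΓ
  let _ := hF.bialgebra
  refine ⟨hF.bialgebra.toCoalgebra, hF.isQuotientCoalgebra, hF.isHopfAlgebra, hF.isPointed_iff,
    fun hq => ?_⟩
  have hhat := QLSDatum.ScalarFamily.isInvariant_hat_iff hq
  refine ⟨hF.isPointed_iff.trans hhat, fun h => hF.nonempty_bialgEquiv (hhat.mpr h),
    fun ⟨e⟩ => hhat.mp (hF.isPointed_iff.mp ?_)⟩
  exact D.isPointed_nicholsSmash.of_equiv (e.symm : D.NicholsSmash ≃ₗc[k] D.A)
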